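/- Let $n\ge 3$ and $0\le p<1$, let $q_0,q_1>0$ with $q_0+q_1=1$, write $C=\binom{2n}{n}$, and set $$\lambda_0=\frac{Cq_0}{Cq_0+2q_1},\qquad \lambda_1=\frac{2q_1}{Cq_0+2q_1},\qquad \vec\lambda=(\lambda_0,\lambda_1).$$ Assume $\lambda_0\ge\lambda_1$ (equivalently $q_0\ge 2/(C+2)$). *Notation.* $B_{m,k}$ is the set of $m$-bit strings of Hamming weight $k$. For a set $A$ of qubits, $\mathcal Z_A^m$ is the projector onto the span of the computational basis states of $A$ of Hamming weight $m$ ($0$ if $m<0$); the subscript is omitted if $A$ contains all $2n$ qubits. $|{\rm GHZ}_{2n}\rangle=(|0^{2n}\rangle+|1^{2n}\rangle)/\sqrt2$, $|D_{2n}^n\rangle=C^{-1/2}\sum_{z\in B_{2n,n}}|z\rangle$, and $J(2n,n)=\sum_{u,v\in B_{2n,n},\,u\oplus v\in B_{2n,2}}|u\rangle\langle v|$. $X,Z$ are Pauli operators, $S=|0\rangle\langle0|+i|1\rangle\langle1|$, and $\tau^{\pm}$ is the projector onto the eigenspace of the Pauli operator $\tau$ with eigenvalue $\pm1$. *Strategies.*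 For $l=(l_0,l_1)$ with $l_0,l_1\ge0$ and $l_0+l_1=1$, put $F=\sqrt2(\sqrt{l_0}|0\rangle\langle0|+\sqrt{l_1}|1\rangle\langle1|)$. The strategy for the $n$-qubit GHZ-like state $\sqrt{l_0}|0^n\rangle+\sqrt{l_1}|1^n\rangle$ is $$\Omega_{\rm GHZ-like}(p,l)=p\sum_{z=0}^1(|z\rangle\langle z|)^{\otimes n}+\frac{1-p}{n}\sum_{k=1}^n\frac1{2^{n-1}}\sum_{o\in\{0,1\}}\ \sum_{\substack{r\in\{0,1\}^n\\ \bigoplus_i r_i=0}}\frac{I+(-1)^{o}\bigotimes_{i\ne k}S^{r_i}XS^{\dagger r_i}}2\otimes F_k\,\frac{I_k+(-1)^{o+(\sum_i r_i)/2}S^{r_k}X_kS^{\dagger r_k}}2\,F_k ,$$ and the strategy for the $n$-qubit Dicke state with $k$ excitations is $$\Omega_{\rm Dicke}(k)=\frac1{\binom n2}\sum_{k_1<k_2}\Big[\mathcal Z^{k}_{\overline{\{k_1,k_2\}}}\otimes Z^+_{k_1}\otimes Z^+_{k_2}+\mathcal Z^{k-2}_{\overline{\{k_1,k_2\}}}\otimes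 Z^-_{k_1}\otimes Z^-_{k_2}+\mathcal Z^{k-1}_{\overline{\{k_1,k_2\}}}\otimes(X_{k_1}\otimes X_{k_2})^+\Big].$$ The strategy for $\sqrt{q_0}|{\rm GHZ}_{2n}\rangle+\sqrt{q_1}|D_{2n}^n\rangle$ is $$\Omega=\frac1C\sum_{|R|=n}\Big[\mathcal Z_R^0\otimes\Omega_{{\rm GHZ-like},\overline R}(p,\vec\lambda)+\mathcal Z_R^n\otimes\Omega_{{\rm GHZ-like},\overline R}(p,(1,1)-\vec\lambda)+\sum_{l=1}^{n-1}\mathcal Z_R^l\otimes\Omega_{{\rm Dicke},\overline R}(n-l)\Big],$$ where $R$ runs over the sets of $n$ of the $2n$ qubits and $\overline R$ is the complement of $R$. Further let $$\Omega^{(1)}=[p+(1-p)\lambda_0](\mathcal Z^0+\mathcal Z^{2n})+\Big[\frac{3n-2}{2(2n-1)}-\frac{2(1-p)\lambda_0}{C}\Big]\mathcal Z^n+\frac{J(2n,n)}{2n(2n-1)}+(1-p)\sqrt{\frac{2\lambda_0\lambda_1}{C}}\big(|{\rm GHZ}_{2n}\rangle\langle D_{2n}^n|+|D_{2n}^n\rangle\langle{\rm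 GHZ}_{2n}|\big),$$ $$\Omega^{(2)}=(n+1)\Big\{\frac1{4(2n-1)}+\frac{1-p}{C}\Big[1-\frac1n-\Big(1-\frac2n\Big)\lambda_0\Big]\Big\}(\mathcal Z^{n-1}+\mathcal Z^{n+1})+\frac1{2n(2n-1)}\sum_{\substack{u\in B_{2n,n-1},\,v\in B_{2n,n+1}\\ u\oplus v\in B_{2n,2}}}(|u\rangle\langle v|+|v\rangle\langle u|),$$ $$\Omega^{(3)}=\frac{1-p}{C}\sum_{l=1}^{n-2}\binom{2n-l}{n}\Big[\frac ln+\Big(1-\frac{2l}n\Big)\lambda_0\Big](\mathcal Z^l+\mathcal Z^{2n-l}).$$ *Claim.* The operators $\Omega,\Omega^{(1)},\Omega^{(2)},\Omega^{(3)}$ on $(\mathbb C^2)^{\otimes 2n}$ are Hermitian. Write $\Lambda_1$ for the largest and $\beta$ for the second largest eigenvalue of a Hermitian operator (counted with multiplicity). Then $$\beta(\Omega)=\beta(\Omega^{(1)})=\begin{cases}p+(1-p)\lambda_0&\text{if }1\le\lambda_0\big(1+\frac2C\big)+\frac1{(2n-1)(1-p)},\\[1mm] 1-\frac1{2n-1}-\frac{2(1-p)\lambda_0}{C}&\text{otherwise,}\end{cases}$$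 $$\Lambda_1(\Omega^{(2)})=\frac{n+1}{2(2n-1)}+\frac{(1-p)(n+1)}{C}\Big[1-\frac1n-\Big(1-\frac2n\Big)\lambda_0\Big],\qquad \Lambda_1(\Omega^{(3)})=\frac{(1-p)[(n-2)\lambda_0+1]}{2n},$$ and $\Lambda_1(\Omega^{(2)})\le\beta(\Omega)$, $\Lambda_1(\Omega^{(3)})\le\beta(\Omega)$. -/

import Mathlib

open scoped Matrix

namespace GHZDickeQSV

noncomputable section

/-- Operators on the qubits labelled by `V`, in the computational basis: the basis kets are indexed
by the bit strings `V → Fin 2`. -/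
abbrev Op (V : Type) : Type := Matrix (V → Fin 2) (V → Fin 2) ℂ

/-- The Hamming weight of a bit string. -/
def weight {V : Type} [Fintype V] (u : V → Fin 2) : ℕ :=
  (Finset.univ.filter fun i => u i = 1).card

/-- The set of all bit strings of Hamming weight `k`. -/
def strings (V : Type) [Fintype V] [DecidableEq V] (k : ℕ) : Finset (V → Fin 2) :=
  Finset.univ.filter fun u => weight u = k

/-- The computational basis vector `|u⟩`. -/
def ket {V : Type} [Fintype V] [DecidableEq V] (u : V → Fin 2) : (V → Fin 2) → ℂ := Pi.single u 1

/-- The rank-one operator `|a⟩⟨b|`. -/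
def ketbra {V : Type} (a b : (V → Fin 2) → ℂ) : Op V := Matrix.vecMulVec a (star b)

/-- The GHZ state `(|0…0⟩ + |1…1⟩) / √2`. -/
def ghz (V : Type) [Fintype V] [DecidableEq V] : (V → Fin 2) → ℂ :=
  ((1 / Real.sqrt 2 : ℝ) : ℂ) • (ket (fun _ => 0) + ket (fun _ => 1))

/-- The Dicke state with `k` excitations: the uniform superposition of all strings of weight `k`. -/
def dicke (V : Type) [Fintype V] [DecidableEq V] (k : ℕ) : (V → Fin 2) → ℂ :=
  ((1 / Real.sqrt ((Fintype.card V).choose k) : ℝ) : ℂ) • ∑ u ∈ strings V k, ket u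

/-! ### Single-qubit operators, tensor products and embeddings -/

/-- The Pauli operator `X`. -/
def pauliX : Matrix (Fin 2) (Fin 2) ℂ := !![0, 1; 1, 0]

/-- The Pauli operator `Z`. -/
def pauliZ : Matrix (Fin 2) (Fin 2) ℂ := !![1, 0; 0, -1]

/-- The phase gate `S = |0⟩⟨0| + i |1⟩⟨1|`. -/
def phaseS : Matrix (Fin 2) (Fin 2) ℂ := !![1, 0; 0, Complex.I]

/-- The tensor product, over all qubits `i`, of the single-qubit operators `M i`. -/
def tensorOp {V : Type} [Fintype V] (M : V → Matrix (Fin 2) (Fin 2) ℂ) : Op V :=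
  Matrix.of fun u v => ∏ i, M i (u i) (v i)

/-- The single-qubit operator `M` applied to the qubit `k` (identity on all others). -/
def siteOp {V : Type} [Fintype V] [DecidableEq V] (k : V) (M : Matrix (Fin 2) (Fin 2) ℂ) : Op V :=
  tensorOp fun i => if i = k then M else 1

/-- The operator `M` on the qubits of `A`, seen as an operator on all qubits (identity outside
`A`). A tensor product of operators on disjoint sets of qubits is the matrix product of their
embeddings. -/
def onQubits {V : Type} [Fintype V] [DecidableEq V] (A : Finset V) (M : Op A) : Op V :=
  Matrix.of fun u v =>
    if ∀ i, i ∉ A → u i = v i then M (fun i => u i) (fun i => v i) else 0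

/-- The projector `𝒵_A^m`, acting on the qubits of `A` and as the identity elsewhere, onto the
strings whose restriction to `A` has Hamming weight `m`. It is `0` for negative `m`. -/
def weightProj {V : Type} [Fintype V] [DecidableEq V] (A : Finset V) (m : ℤ) : Op V :=
  Matrix.diagonal fun u => if ((A.filter fun i => u i = 1).card : ℤ) = m then 1 else 0

/-- For an involution `T` (a tensor product of Pauli operators), the projector onto the
eigenspace with eigenvalue `+1`. -/
def plusProj {V : Type} [Fintype V] [DecidableEq V] (T : Op V) : Op V := (1 / 2 : ℂ) • (1 + T)

/-- For an involution `T` (a tensor product of Pauli operators), the projector onto the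
eigenspace with eigenvalue `-1`. -/
def minusProj {V : Type} [Fintype V] [DecidableEq V] (T : Op V) : Op V := (1 / 2 : ℂ) • (1 - T)

/-! ### The strategy for GHZ-like states -/

/-- The filter `F = √2 (√l₀ |0⟩⟨0| + √l₁ |1⟩⟨1|)`. -/
def filterF (l : Fin 2 → ℝ) : Matrix (Fin 2) (Fin 2) ℂ :=
  Matrix.diagonal fun z => ((Real.sqrt 2 * Real.sqrt (l z) : ℝ) : ℂ)

/-- The single-qubit operator `S^b X (S†)^b`. -/
def rotX (b : Fin 2) : Matrix (Fin 2) (Fin 2) ℂ :=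
  phaseS ^ (b : ℕ) * pauliX * phaseSᴴ ^ (b : ℕ)

/-- The strategy of the verification protocol for the GHZ-like state `√l₀ |0…0⟩ + √l₁ |1…1⟩` on
the qubits of `V`. With probability `p` all qubits are measured in the `Z` basis and the outcomes
must agree. Otherwise a qubit `k` is drawn uniformly; the other qubits are measured in the basis of
`S^{r_i} X (S†)^{r_i}` for random bits `r_i`, and finally the qubit `k` is projected according to
the parity `o` of their outcomes; `r_k` makes the number of ones in `r` even. -/
def ghzStrategy (V : Type) [Fintype V] [DecidableEq V] (p : ℝ) (l : Fin 2 → ℝ) : Op V :=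
  (p : ℂ) • ∑ z : Fin 2, tensorOp (fun _ : V => Matrix.single z z (1 : ℂ)) +
  ((1 - p) / Fintype.card V : ℂ) • ∑ k : V,
    ((1 / 2 ^ (Fintype.card V - 1) : ℂ) • ∑ o : Fin 2,
      ∑ r ∈ Finset.univ.filter (fun r : V → Fin 2 => Even (∑ i, (r i : ℕ))),
        ((1 / 2 : ℂ) • (1 + ((-1 : ℂ) ^ (o : ℕ)) •
            tensorOp (fun i => if i = k then 1 else rotX (r i)))) *
        siteOp k (filterF l *
          ((1 / 2 : ℂ) • (1 + ((-1 : ℂ) ^ ((o : ℕ) + (∑ i, (r i : ℕ)) / 2)) • rotX (r k))) *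
          filterF l))

/-! ### The strategy for Dicke states -/

/-- The strategy of the verification protocol for the Dicke state with `k` excitations: a pair
`k₁ < k₂` is drawn uniformly, the other qubits are measured in the `Z` basis, and the pair is
measured in the `Z` or in the `X` basis, depending on the outcomes. -/
def dickeStrategy (V : Type) [Fintype V] [LinearOrder V] (k : ℤ) : Op V :=
  (1 / ((Fintype.card V).choose 2 : ℂ)) •
    ∑ x ∈ Finset.univ.filter (fun x : V × V => x.1 < x.2),
      (weightProj ({x.1, x.2}ᶜ : Finset V) k *
          plusProj (siteOp x.1 pauliZ) * plusProj (siteOp x.2 pauliZ) +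
        weightProj ({x.1, x.2}ᶜ : Finset V) (k - 2) *
          minusProj (siteOp x.1 pauliZ) * minusProj (siteOp x.2 pauliZ) +
        weightProj ({x.1, x.2}ᶜ : Finset V) (k - 1) *
          plusProj (siteOp x.1 pauliX * siteOp x.2 pauliX))

/-! ### The strategy for the superposition of GHZ and Dicke states on `2n` qubits -/

/-- The weights `(λ₀, λ₁)` of the GHZ-like state that the target `√q₀ |GHZ⟩ + √q₁ |D⟩` on `2n`
qubits collapses to when `n` of its qubits are found in `|0…0⟩`. -/
def lam (n : ℕ) (q0 q1 : ℝ) : Fin 2 → ℝ :=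
  ![((2 * n).choose n * q0) / ((2 * n).choose n * q0 + 2 * q1),
    (2 * q1) / ((2 * n).choose n * q0 + 2 * q1)]

/-- The strategy conditioned on the set `R` of qubits that are measured first: the outcomes on `R`
decide which of the two protocols is run on the complement of `R`. -/
def strategyR (n : ℕ) (p : ℝ) (l : Fin 2 → ℝ) (R : Finset (Fin (2 * n))) : Op (Fin (2 * n)) :=
  weightProj R 0 * onQubits Rᶜ (ghzStrategy (Rᶜ : Finset (Fin (2 * n))) p l) +
  weightProj R n * onQubits Rᶜ (ghzStrategy (Rᶜ : Finset (Fin (2 * n))) p (1 - l)) +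
  ∑ m ∈ Finset.Icc 1 (n - 1),
    weightProj R m * onQubits Rᶜ (dickeStrategy (Rᶜ : Finset (Fin (2 * n))) ((n : ℤ) - m))

/-- The strategy `Ω`: the set `R` of `n` qubits is drawn uniformly. -/
def strategy (n : ℕ) (p : ℝ) (l : Fin 2 → ℝ) : Op (Fin (2 * n)) :=
  (1 / ((2 * n).choose n : ℂ)) •
    ∑ R ∈ Finset.powersetCard n (Finset.univ : Finset (Fin (2 * n))), strategyR n p l R

/-- `𝒵^m` on all `2n` qubits. -/
def zProj (n : ℕ) (m : ℤ) : Op (Fin (2 * n)) := weightProj Finset.univ m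

/-- The adjacency matrix `J(2n, n)` of the Johnson graph; `u + v` is the bitwise sum. -/
def johnson (n : ℕ) : Op (Fin (2 * n)) :=
  ∑ u ∈ strings (Fin (2 * n)) n, ∑ v ∈ strings (Fin (2 * n)) n,
    if weight (u + v) = 2 then ketbra (ket u) (ket v) else 0

/-- The component `Ω⁽¹⁾`. -/
def omega1 (n : ℕ) (p : ℝ) (l : Fin 2 → ℝ) : Op (Fin (2 * n)) :=
  ((p + (1 - p) * l 0 : ℝ) : ℂ) • (zProj n 0 + zProj n (2 * n)) +
  (((3 * n - 2) / (2 * (2 * n - 1)) - 2 * (1 - p) * l 0 / (2 * n).choose n : ℝ) : ℂ) • zProj n n +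
  ((1 / (2 * n * (2 * n - 1)) : ℝ) : ℂ) • johnson n +
  (((1 - p) * Real.sqrt (2 * l 0 * l 1 / (2 * n).choose n) : ℝ) : ℂ) •
    (ketbra (ghz (Fin (2 * n))) (dicke (Fin (2 * n)) n) +
      ketbra (dicke (Fin (2 * n)) n) (ghz (Fin (2 * n))))

/-- The component `Ω⁽²⁾`. -/
def omega2 (n : ℕ) (p : ℝ) (l : Fin 2 → ℝ) : Op (Fin (2 * n)) :=
  (((n + 1) * (1 / (4 * (2 * n - 1)) +
      (1 - p) / (2 * n).choose n * (1 - 1 / n - (1 - 2 / n) * l 0)) : ℝ) : ℂ) •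
    (zProj n ((n : ℤ) - 1) + zProj n ((n : ℤ) + 1)) +
  ((1 / (2 * n * (2 * n - 1)) : ℝ) : ℂ) •
    ∑ u ∈ strings (Fin (2 * n)) (n - 1), ∑ v ∈ strings (Fin (2 * n)) (n + 1),
      if weight (u + v) = 2 then ketbra (ket u) (ket v) + ketbra (ket v) (ket u) else 0

/-- The component `Ω⁽³⁾`. -/
def omega3 (n : ℕ) (p : ℝ) (l : Fin 2 → ℝ) : Op (Fin (2 * n)) :=
  (((1 - p) / (2 * n).choose n : ℝ) : ℂ) • ∑ m ∈ Finset.Icc 1 (n - 2),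
    (((2 * n - m).choose n * ((m : ℝ) / n + (1 - 2 * m / n) * l 0) : ℝ) : ℂ) •
      (zProj n m + zProj n (2 * n - m))

/-! ### Ordered eigenvalues -/

/-- The `j`-th entry, counting from `0`, of the list of the eigenvalues of a Hermitian operator in
decreasing order and with multiplicity (`0` if the dimension is at most `j`). -/
def sortedEigenvalue {V : Type} [Fintype V] [DecidableEq V] {A : Op V} (hA : A.IsHermitian)
    (j : ℕ) : ℝ :=
  if h : j < Fintype.card (V → Fin 2) then hA.eigenvalues₀ ⟨j, h⟩ else 0

/-- The largest eigenvalue. -/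
def largestEigenvalue {V : Type} [Fintype V] [DecidableEq V] {A : Op V} (hA : A.IsHermitian) : ℝ :=
  sortedEigenvalue hA 0

/-- The second largest eigenvalue, with multiplicity. -/
def secondEigenvalue {V : Type} [Fintype V] [DecidableEq V] {A : Op V} (hA : A.IsHermitian) : ℝ :=
  sortedEigenvalue hA 1

end

end GHZDickeQSV

/-!
All operators in sight have real entries in the computational basis, and the strategy `Ω` splits
into blocks: bit strings of weight `0`, `n`, `2n`, those of weight `n - 1`, `n + 1`, and the rest.
The three blocks are `Ω⁽¹⁾`, `Ω⁽²⁾`, `Ω⁽³⁾` (`strategy_eq_realOp`, `omega1_eq_realOp`,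
`omega2_eq_realOp`, `omega3_eq_realOp`). The identification rests on two observations. In the
GHZ-like strategy the average over the local bases `r` is a character sum that leaves only the
diagonal and the coherence between `0…0` and `1…1` (`ghzStrategy_apply`). In the Dicke strategies
the excitation number on the complement of `R` is such that the operator measured on a pair of
qubits depends on the whole string only, not on `R` (`pairEntry_restrict`); hence averaging over `R`
counts how many `R` avoid a pair, and the sum over pairs is a diagonal plus a Johnson graph
(`sum_pairs_pairEntry`).

The spectrum is found from explicit eigenvectors together with matching bounds on the quadratic form
(`secondEigenvalue_realOp`, `largestEigenvalue_realOp`).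

* On the weights `0`, `n`, `2n` the target state is an eigenvector with eigenvalue `1`. On its
  orthogonal complement the coherence between the weights contributes a nonpositive amount
  (`form_entry1_le`), so that only two eigenvalues compete there: `p + (1 - p) λ₀`, attained at
  `|0…0⟩ - |1…1⟩`, and the one which `Ω⁽¹⁾` has on the eigenspace of the Johnson graph `J(2n, n)` for
  its second largest eigenvalue `n² - 2n`, attained at the sign of a single bit. That no other
  function of mean zero on the strings of weight `n` exceeds `n² - 2n` is the spectral gap
  `sum_lower_sq_le`. It is proved by induction on the weight: for the lowering operator `L` on `N`
  bits, `L L† - L† L = N - 2k` on weight `k`, and `L† L` and `L L†` have the same nonzero spectrum.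
* `Ω⁽²⁾` has nonnegative entries and constant row sums on its block, so its largest eigenvalue is
  the row sum (`form_le_row_sums`).
* `Ω⁽³⁾` is diagonal, and its entries decrease with the distance of the weight from `0` and `2n`
  (`coeff3_succ_le`).

The condition in the theorem says which of the two competing eigenvalues is larger. As `λ₀ ≥ 1/2`,
the first one is at least `1/2`, and this dominates the other two blocks (`coeff2_add_le_half`,
`coeff3_one_le`).
-/

namespace GHZDickeQSV

/-! ### Extremal eigenvalues from the quadratic form -/

section Variational

open scoped InnerProductSpace

variable {E : Type*} [NormedAddCommGroup E] [InnerProductSpace ℂ E]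

/-- In the span of two orthogonal nonzero vectors there is a nonzero vector orthogonal to any given
vector. -/
theorem exists_combination_orthogonal (e ψ φ : E) (hψ : ψ ≠ 0) (hφ : φ ≠ 0) (h : ⟪ψ, φ⟫_ℂ = 0) :
    ∃ c d : ℂ, c • ψ + d • φ ≠ 0 ∧ ⟪e, c • ψ + d • φ⟫_ℂ = 0 := by
  by_cases h0 : ⟪e, φ⟫_ℂ = 0
  · exact ⟨0, 1, by simpa using hφ, by simpa using h0⟩
  · refine ⟨⟪e, φ⟫_ℂ, -⟪e, ψ⟫_ℂ, fun h1 => h0 ?_, ?_⟩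
    · have h2 : ⟪ψ, ⟪e, φ⟫_ℂ • ψ + (-⟪e, ψ⟫_ℂ) • φ⟫_ℂ = 0 := by rw [h1, inner_zero_right]
      rw [inner_add_right, inner_smul_right, inner_smul_right, h, mul_zero, add_zero] at h2
      exact (mul_eq_zero.1 h2).resolve_right (inner_self_ne_zero.2 hψ)
    · rw [inner_add_right, inner_smul_right, inner_smul_right]
      ring

variable [FiniteDimensional ℂ E] {T : E →ₗ[ℂ] E} {m : ℕ}

theorem re_inner_eq_sum_eigenvalues (hT : T.IsSymmetric) (hm : Module.finrank ℂ E = m) (x : E) :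
    (⟪x, T x⟫_ℂ).re = ∑ i, hT.eigenvalues hm i * ‖⟪hT.eigenvectorBasis hm i, x⟫_ℂ‖ ^ 2 := by
  rw [← (hT.eigenvectorBasis hm).sum_inner_mul_inner x (T x), Complex.re_sum]
  refine Finset.sum_congr rfl fun i _ => ?_
  have h1 : ⟪hT.eigenvectorBasis hm i, T x⟫_ℂ
      = (hT.eigenvalues hm i : ℂ) * ⟪hT.eigenvectorBasis hm i, x⟫_ℂ := by
    rw [← hT, hT.apply_eigenvectorBasis, inner_smul_left]
    simp
  rw [h1, mul_left_comm, ← inner_conj_symm x, ← Complex.normSq_eq_conj_mul_self,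
    Complex.normSq_eq_norm_sq, ← Complex.ofReal_mul, Complex.ofReal_re]

theorem norm_sq_eq_sum_eigenvectorBasis (hT : T.IsSymmetric) (hm : Module.finrank ℂ E = m) (x : E) :
    ‖x‖ ^ 2 = ∑ i, ‖⟪hT.eigenvectorBasis hm i, x⟫_ℂ‖ ^ 2 :=
  ((hT.eigenvectorBasis hm).sum_sq_norm_inner_right x).symm

/-- If the quadratic form at a nonzero vector orthogonal to the first `j` eigenvectors is at least
`b`, then so is the `j`-th eigenvalue. -/
theorem le_eigenvalue_of_form_ge (hT : T.IsSymmetric) (hm : Module.finrank ℂ E = m) (j : Fin m)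
    {b : ℝ} {x : E} (hx : x ≠ 0) (hort : ∀ i < j, ⟪hT.eigenvectorBasis hm i, x⟫_ℂ = 0)
    (hb : b * ‖x‖ ^ 2 ≤ (⟪x, T x⟫_ℂ).re) : b ≤ hT.eigenvalues hm j := by
  have hpos : 0 < ‖x‖ ^ 2 := by positivity
  refine le_of_mul_le_mul_right (hb.trans ?_) hpos
  rw [re_inner_eq_sum_eigenvalues hT hm, norm_sq_eq_sum_eigenvectorBasis hT hm, Finset.mul_sum]
  refine Finset.sum_le_sum fun i _ => ?_
  rcases lt_or_ge i j with h | h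
  · simp [hort i h]
  · exact mul_le_mul_of_nonneg_right (hT.eigenvalues_antitone hm h) (by positivity)

/-- If the quadratic form at a nonzero vector orthogonal to all eigenvectors after the `j`-th is at
most `b`, then so is the `j`-th eigenvalue. -/
theorem eigenvalue_le_of_form_le (hT : T.IsSymmetric) (hm : Module.finrank ℂ E = m) (j : Fin m)
    {b : ℝ} {x : E} (hx : x ≠ 0) (hort : ∀ i, j < i → ⟪hT.eigenvectorBasis hm i, x⟫_ℂ = 0)
    (hb : (⟪x, T x⟫_ℂ).re ≤ b * ‖x‖ ^ 2) : hT.eigenvalues hm j ≤ b := by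
  have hpos : 0 < ‖x‖ ^ 2 := by positivity
  refine le_of_mul_le_mul_right (le_trans ?_ hb) hpos
  rw [re_inner_eq_sum_eigenvalues hT hm, norm_sq_eq_sum_eigenvectorBasis hT hm, Finset.mul_sum]
  refine Finset.sum_le_sum fun i _ => ?_
  rcases lt_or_ge j i with h | h
  · simp [hort i h]
  · exact mul_le_mul_of_nonneg_right (hT.eigenvalues_antitone hm h) (by positivity)

/-- The second eigenvalue is `b`, if there is an eigenvector `ψ` with eigenvalue `c ≥ b`, an
eigenvector `φ ⟂ ψ` with eigenvalue `b`, and the quadratic form is at most `b` on `ψ^⊥`. -/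
theorem second_eigenvalue_eq (hT : T.IsSymmetric) (hm : Module.finrank ℂ E = m) (hm1 : 1 < m)
    {b c : ℝ} {ψ φ : E} (hψ : ψ ≠ 0) (hφ : φ ≠ 0) (h : ⟪ψ, φ⟫_ℂ = 0) (hbc : b ≤ c)
    (hTψ : T ψ = (c : ℂ) • ψ) (hTφ : T φ = (b : ℂ) • φ)
    (hform : ∀ x, ⟪ψ, x⟫_ℂ = 0 → (⟪x, T x⟫_ℂ).re ≤ b * ‖x‖ ^ 2) :
    hT.eigenvalues hm ⟨1, hm1⟩ = b := by
  set e := hT.eigenvectorBasis hm with he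
  have hlt : ∀ i : Fin m, i < ⟨1, hm1⟩ → i = ⟨0, by omega⟩ := by
    intro i hi
    ext
    have := Fin.lt_def.1 hi
    simp only at this ⊢
    omega
  apply le_antisymm
  -- the span of the first two eigenvectors of `T` meets `ψ^⊥`
  · obtain ⟨α, β, hne, hort⟩ := exists_combination_orthogonal ψ (e ⟨0, by omega⟩) (e ⟨1, hm1⟩)
      (e.orthonormal.ne_zero _) (e.orthonormal.ne_zero _) (e.orthonormal.2 (by simp))
    refine eigenvalue_le_of_form_le hT hm ⟨1, hm1⟩ hne (fun i hi => ?_) (hform _ hort)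
    have h0 : i ≠ ⟨0, by omega⟩ := by intro h0; simp [h0, Fin.lt_def] at hi
    rw [← he, inner_add_right, inner_smul_right, inner_smul_right, e.orthonormal.2 h0,
      e.orthonormal.2 hi.ne']
    simp
  -- the span of `ψ` and `φ` meets the complement of the first eigenvector
  · obtain ⟨α, β, hne, hort⟩ := exists_combination_orthogonal (e ⟨0, by omega⟩) ψ φ hψ hφ h
    refine le_eigenvalue_of_form_ge hT hm ⟨1, hm1⟩ hne (fun i hi => ?_) ?_
    · rw [hlt i hi]; exact hort
    · have h' : ⟪φ, ψ⟫_ℂ = 0 := by rw [← inner_conj_symm, h, map_zero]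
      have e1 : ⟪α • ψ + β • φ, T (α • ψ + β • φ)⟫_ℂ
          = ((c * (‖α‖ ^ 2 * ‖ψ‖ ^ 2) + b * (‖β‖ ^ 2 * ‖φ‖ ^ 2) : ℝ) : ℂ) := by
        simp only [map_add, map_smul, hTψ, hTφ, inner_add_left, inner_add_right, inner_smul_left,
          inner_smul_right, h, h', inner_self_eq_norm_sq_to_K]
        have ha := Complex.normSq_eq_conj_mul_self (z := α)
        have hb := Complex.normSq_eq_conj_mul_self (z := β)
        rw [Complex.normSq_eq_norm_sq] at ha hb
        push_cast at ha hb ⊢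
        rw [ha, hb]
        simp only [Complex.coe_algebraMap]
        ring
      have e2 : ‖α • ψ + β • φ‖ ^ 2 = ‖α‖ ^ 2 * ‖ψ‖ ^ 2 + ‖β‖ ^ 2 * ‖φ‖ ^ 2 := by
        have := norm_add_sq_eq_norm_sq_add_norm_sq_of_inner_eq_zero (α • ψ) (β • φ)
          (by rw [inner_smul_left, inner_smul_right, h]; simp)
        rw [norm_smul, norm_smul] at this
        rw [sq, this]
        ring
      rw [e1, e2, Complex.ofReal_re, mul_add]
      gcongr

theorem first_eigenvalue_eq (hT : T.IsSymmetric) (hm : Module.finrank ℂ E = m) (hm0 : 0 < m)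
    {b : ℝ} {φ : E} (hφ : φ ≠ 0) (hTφ : T φ = (b : ℂ) • φ)
    (hform : ∀ x, (⟪x, T x⟫_ℂ).re ≤ b * ‖x‖ ^ 2) :
    hT.eigenvalues hm ⟨0, hm0⟩ = b := by
  set e := hT.eigenvectorBasis hm with he
  apply le_antisymm
  · refine eigenvalue_le_of_form_le hT hm ⟨0, hm0⟩ (e.orthonormal.ne_zero ⟨0, hm0⟩)
      (fun i hi => e.orthonormal.2 hi.ne') (hform _)
  · refine le_eigenvalue_of_form_ge hT hm ⟨0, hm0⟩ hφ (fun i hi => ?_) ?_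
    · simp [Fin.lt_def] at hi
    · rw [hTφ, inner_smul_right, inner_self_eq_norm_sq_to_K]
      norm_cast
      rw [Complex.re_ofReal_mul]
      exact le_rfl

end Variational

section RealMatrix

variable {V : Type} [Fintype V] [DecidableEq V]

/-- The operator with the real entries `a u v`. -/
noncomputable def realOp {V : Type} (a : (V → Fin 2) → (V → Fin 2) → ℝ) : Op V :=
  Matrix.of fun u v => (a u v : ℂ)

theorem realOp_isHermitian {V : Type} {a : (V → Fin 2) → (V → Fin 2) → ℝ} (h : ∀ u v, a u v = a v u) :
    (realOp a).IsHermitian := by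
  ext u v
  simp [realOp, Matrix.conjTranspose_apply, h u v]

theorem re_inner_realOp (a : (V → Fin 2) → (V → Fin 2) → ℝ) (x : EuclideanSpace ℂ (V → Fin 2)) :
    (inner ℂ x (Matrix.toEuclideanLin (realOp a) x)).re =
      (∑ u, ∑ v, a u v * (x u).re * (x v).re) + ∑ u, ∑ v, a u v * (x u).im * (x v).im := by
  simp only [PiLp.inner_apply, Complex.re_sum, ← Finset.sum_add_distrib]
  refine Finset.sum_congr rfl fun u _ => ?_
  simp only [Matrix.toLpLin_apply, Matrix.mulVec, dotProduct, realOp, Matrix.of_apply,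
    RCLike.inner_apply, Complex.mul_re, Complex.conj_re, Complex.conj_im, Complex.re_sum,
    Complex.ofReal_re, Complex.ofReal_im, Complex.mul_im, Finset.sum_mul]
  refine Finset.sum_congr rfl fun v _ => ?_
  ring

/-- A real function on the bit strings, as a state vector. -/
noncomputable def realVec {V : Type} (f : (V → Fin 2) → ℝ) : EuclideanSpace ℂ (V → Fin 2) :=
  WithLp.toLp 2 fun u => (f u : ℂ)

theorem toEuclideanLin_realOp_realVec {a : (V → Fin 2) → (V → Fin 2) → ℝ} {f : (V → Fin 2) → ℝ}
    {b : ℝ} (h : ∀ u, ∑ v, a u v * f v = b * f u) :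
    Matrix.toEuclideanLin (realOp a) (realVec f) = (b : ℂ) • realVec f := by
  ext u
  simp only [Matrix.toLpLin_apply, Matrix.mulVec, dotProduct, realOp, Matrix.of_apply, realVec,
    PiLp.smul_apply, smul_eq_mul]
  rw [← Complex.ofReal_mul, ← h u]
  push_cast
  rfl

theorem realVec_ne_zero {V : Type} {f : (V → Fin 2) → ℝ} {u : V → Fin 2} (h : f u ≠ 0) : realVec f ≠ 0 := by
  intro h0
  apply h
  have := congrFun (congrArg WithLp.ofLp h0) u
  simpa [realVec] using this

theorem inner_realVec (f : (V → Fin 2) → ℝ) (x : EuclideanSpace ℂ (V → Fin 2)) :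
    inner ℂ (realVec f) x
      = ((∑ u, f u * (x u).re : ℝ) : ℂ) + ((∑ u, f u * (x u).im : ℝ) : ℂ) * Complex.I := by
  simp only [PiLp.inner_apply, realVec, RCLike.inner_apply, Complex.conj_ofReal]
  push_cast
  rw [Finset.sum_mul, ← Finset.sum_add_distrib]
  refine Finset.sum_congr rfl fun u _ => ?_
  conv_lhs => rw [← Complex.re_add_im (x u)]
  ring

theorem norm_sq_re_im (x : EuclideanSpace ℂ (V → Fin 2)) :
    ‖x‖ ^ 2 = ∑ u, (x u).re ^ 2 + ∑ u, (x u).im ^ 2 := by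
  rw [EuclideanSpace.norm_sq_eq, ← Finset.sum_add_distrib]
  refine Finset.sum_congr rfl fun u _ => ?_
  rw [← Complex.normSq_eq_norm_sq, Complex.normSq_apply]
  ring

/-- The second largest eigenvalue of an operator with real entries, from an eigenvector `ψ` and the
quadratic form on the real vectors orthogonal to `ψ`. For a complex vector, the form is the sum of
its values at the real and the imaginary part. -/
theorem secondEigenvalue_realOp [Nonempty V] {a : (V → Fin 2) → (V → Fin 2) → ℝ} {A : Op V}
    (hA : A.IsHermitian) (ha : A = realOp a) {b c : ℝ} {ψ φ : (V → Fin 2) → ℝ} {u₀ u₁ : V → Fin 2}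
    (hψ : ψ u₀ ≠ 0) (hφ : φ u₁ ≠ 0) (h : ∑ u, ψ u * φ u = 0) (hbc : b ≤ c)
    (hAψ : ∀ u, ∑ v, a u v * ψ v = c * ψ u) (hAφ : ∀ u, ∑ v, a u v * φ v = b * φ u)
    (hform : ∀ x : (V → Fin 2) → ℝ, ∑ u, ψ u * x u = 0 →
      ∑ u, ∑ v, a u v * x u * x v ≤ b * ∑ u, x u ^ 2) :
    secondEigenvalue hA = b := by
  subst ha
  have hcard : 1 < Fintype.card (V → Fin 2) := by
    simp only [Fintype.card_pi, Fintype.card_fin, Finset.prod_const, Finset.card_univ]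
    exact Nat.one_lt_two_pow Fintype.card_ne_zero
  rw [secondEigenvalue, sortedEigenvalue, dif_pos hcard]
  refine second_eigenvalue_eq (Matrix.isSymmetric_toEuclideanLin_iff.mpr hA)
    finrank_euclideanSpace hcard (realVec_ne_zero hψ) (realVec_ne_zero hφ) ?_ hbc
    (toEuclideanLin_realOp_realVec hAψ) (toEuclideanLin_realOp_realVec hAφ) fun x hx => ?_
  · rw [inner_realVec]
    simp [realVec, h]
  · rw [inner_realVec] at hx
    have h1 := congrArg Complex.re hx
    have h2 := congrArg Complex.im hx
    simp only [Complex.add_re, Complex.ofReal_re, Complex.mul_re, Complex.I_re, mul_zero,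
      Complex.ofReal_im, Complex.I_im, mul_one, sub_self, add_zero, Complex.zero_re] at h1
    simp only [Complex.add_im, Complex.ofReal_re, Complex.mul_im, Complex.I_re, mul_zero,
      Complex.ofReal_im, Complex.I_im, mul_one, zero_add, add_zero, Complex.zero_im] at h2
    rw [re_inner_realOp, norm_sq_re_im, mul_add]
    exact add_le_add (hform _ h1) (hform _ h2)

theorem largestEigenvalue_realOp {a : (V → Fin 2) → (V → Fin 2) → ℝ} {A : Op V}
    (hA : A.IsHermitian) (ha : A = realOp a) {b : ℝ} {φ : (V → Fin 2) → ℝ} {u₁ : V → Fin 2}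
    (hφ : φ u₁ ≠ 0) (hAφ : ∀ u, ∑ v, a u v * φ v = b * φ u)
    (hform : ∀ x : (V → Fin 2) → ℝ, ∑ u, ∑ v, a u v * x u * x v ≤ b * ∑ u, x u ^ 2) :
    largestEigenvalue hA = b := by
  subst ha
  have hcard : 0 < Fintype.card (V → Fin 2) := Fintype.card_pos
  rw [largestEigenvalue, sortedEigenvalue, dif_pos hcard]
  refine first_eigenvalue_eq (Matrix.isSymmetric_toEuclideanLin_iff.mpr hA)
    finrank_euclideanSpace hcard (realVec_ne_zero hφ)
    (toEuclideanLin_realOp_realVec hAφ) fun x => ?_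
  rw [re_inner_realOp, norm_sq_re_im, mul_add]
  exact add_le_add (hform _) (hform _)

end RealMatrix

/-! ### Bit strings: weights and flips of pairs of bits -/

section BitStrings

variable {V : Type} [Fintype V] [DecidableEq V]

theorem fin2_eq_zero_or_one (b : Fin 2) : b = 0 ∨ b = 1 := by
  fin_cases b <;> simp

theorem weight_eq_sum {V : Type} [Fintype V] (u : V → Fin 2) : weight u = ∑ i, (u i : ℕ) := by
  rw [weight, Finset.card_filter]
  refine Finset.sum_congr rfl fun i _ => ?_
  rcases fin2_eq_zero_or_one (u i) with h | h <;> simp [h]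

theorem sum_val_eq_weight {V : Type} [Fintype V] (u : V → Fin 2) :
    ∑ i, ((u i : ℕ) : ℝ) = weight u := by
  rw [weight_eq_sum]; push_cast; rfl

theorem weight_le_card {V : Type} [Fintype V] (u : V → Fin 2) : weight u ≤ Fintype.card V :=
  Finset.card_le_univ _

theorem weight_update (u : V → Fin 2) (i : V) (b : Fin 2) :
    weight (Function.update u i b) + (u i : ℕ) = weight u + (b : ℕ) := by
  rw [weight_eq_sum, weight_eq_sum, ← Finset.add_sum_erase _ _ (Finset.mem_univ i),
    ← Finset.add_sum_erase Finset.univ (fun j => (u j : ℕ)) (Finset.mem_univ i),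
    Finset.sum_congr rfl fun j hj => by
      rw [Function.update_of_ne (Finset.ne_of_mem_erase hj)]]
  simp only [Function.update_self]
  ring

theorem weight_eq_zero_iff {V : Type} [Fintype V] (u : V → Fin 2) :
    weight u = 0 ↔ u = fun _ => 0 := by
  rw [weight_eq_sum]
  simp [funext_iff]

theorem weight_eq_card_iff {V : Type} [Fintype V] (u : V → Fin 2) :
    weight u = Fintype.card V ↔ u = fun _ => 1 := by
  rw [weight, Finset.card_eq_iff_eq_univ, Finset.filter_eq_self]
  simp [funext_iff]

/-- The string `u` with the bits at the positions in `s` flipped. -/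
def flipOn (s : Finset V) (u : V → Fin 2) : V → Fin 2 := fun i => if i ∈ s then u i + 1 else u i

theorem eq_flipOn_iff (s : Finset V) (u v : V → Fin 2) :
    v = flipOn s u ↔ (Finset.univ.filter fun i => (u + v) i = 1) = s := by
  simp only [funext_iff, flipOn, Finset.ext_iff, Finset.mem_filter, Finset.mem_univ, true_and,
    Pi.add_apply]
  refine forall_congr' fun i => ?_
  by_cases h : i ∈ s <;> simp only [h, if_true, if_false, iff_true, iff_false] <;>
    generalize u i = a <;> generalize v i = b <;> revert a b <;> decide

theorem flipOn_pair {V : Type} [DecidableEq V] {x y : V} (hxy : x ≠ y) (u : V → Fin 2) :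
    flipOn {x, y} u = Function.update (Function.update u x (u x + 1)) y (u y + 1) := by
  ext i
  by_cases h1 : i = y
  · subst h1; simp [flipOn]
  · by_cases h2 : i = x
    · subst h2; simp [flipOn, h1]
    · simp [flipOn, h1, h2]

theorem weight_flipOn_pair {x y : V} (hxy : x ≠ y) (u : V → Fin 2) :
    weight (flipOn {x, y} u) + 2 * (u x : ℕ) + 2 * (u y : ℕ) = weight u + 2 := by
  rw [flipOn_pair hxy]
  have h1 := weight_update u x (u x + 1)
  have h2 := weight_update (Function.update u x (u x + 1)) y (u y + 1)
  rw [Function.update_of_ne hxy.symm] at h2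
  have hb : ∀ b : Fin 2, ((b + 1 : Fin 2) : ℕ) = 1 - (b : ℕ) ∧ (b : ℕ) ≤ 1 := by decide
  obtain ⟨hx, hx'⟩ := hb (u x)
  obtain ⟨hy, hy'⟩ := hb (u y)
  omega

theorem sum_pairs_eq_half {V : Type} [Fintype V] [LinearOrder V] (F : V → V → ℝ)
    (hF : ∀ x y, F x y = F y x) :
    ∑ x ∈ Finset.univ.filter (fun x : V × V => x.1 < x.2), F x.1 x.2
      = (∑ x, ∑ y, if x ≠ y then F x y else 0) / 2 := by
  have h1 : ∑ x ∈ Finset.univ.filter (fun x : V × V => x.1 < x.2), F x.1 x.2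
      = ∑ x, ∑ y, if x < y then F x y else 0 := by
    rw [Finset.sum_filter, ← Finset.univ_product_univ, Finset.sum_product]
  have h2 : ∑ x, ∑ y, (if x < y then F x y else 0) = ∑ x, ∑ y, if y < x then F x y else 0 := by
    rw [Finset.sum_comm]
    simp_rw [hF]
  have h3 : ∑ x, ∑ y, (if x ≠ y then F x y else 0)
      = ∑ x, ∑ y, (if x < y then F x y else 0) + ∑ x, ∑ y, if y < x then F x y else 0 := by
    simp_rw [← Finset.sum_add_distrib]
    refine Finset.sum_congr rfl fun x _ => Finset.sum_congr rfl fun y _ => ?_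
    rcases lt_trichotomy x y with h | h | h
    · simp [h, h.ne, h.not_gt]
    · simp [h]
    · simp [h, h.ne', h.not_gt]
  rw [h1, h3, ← h2]
  ring

theorem sum_pairs_polynomial {V : Type} [Fintype V] [LinearOrder V] (u : V → Fin 2) (a b c : ℝ) :
    ∑ x ∈ Finset.univ.filter (fun x : V × V => x.1 < x.2),
        (a + b * (((u x.1 : ℕ) : ℝ) + ((u x.2 : ℕ) : ℝ)) + c * (((u x.1 : ℕ) : ℝ) * ((u x.2 : ℕ) : ℝ)))
      = a * (Fintype.card V * (Fintype.card V - 1) / 2) + b * ((Fintype.card V - 1) * weight u)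
        + c * (weight u * (weight u - 1) / 2) := by
  rw [sum_pairs_eq_half (fun x y => a + b * (((u x : ℕ) : ℝ) + ((u y : ℕ) : ℝ))
    + c * (((u x : ℕ) : ℝ) * ((u y : ℕ) : ℝ))) (fun x y => by ring)]
  have hs : ∀ x y : V, (if x ≠ y then a + b * (((u x : ℕ) : ℝ) + ((u y : ℕ) : ℝ))
      + c * (((u x : ℕ) : ℝ) * ((u y : ℕ) : ℝ)) else 0)
      = (a + b * ((u x : ℕ) : ℝ) + (b + c * ((u x : ℕ) : ℝ)) * ((u y : ℕ) : ℝ))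
        - if x = y then a + (2 * b + c) * ((u y : ℕ) : ℝ) else 0 := by
    intro x y
    by_cases h : x = y
    · subst h
      rcases fin2_eq_zero_or_one (u x) with h | h <;> simp [h]; ring
    · simp [h]; ring
  have hw := sum_val_eq_weight u
  simp_rw [hs, Finset.sum_sub_distrib, Finset.sum_ite_eq, Finset.sum_add_distrib,
    ← Finset.mul_sum, hw]
  simp only [Finset.mem_univ, if_true, Finset.sum_const, Finset.card_univ, nsmul_eq_mul,
    Finset.sum_add_distrib, ← Finset.mul_sum, ← Finset.sum_mul, hw]
  ring

/-- Two strings are at Hamming distance two iff they differ by flipping exactly one pair of bits. -/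
theorem sum_pairs_flipOn {V : Type} [Fintype V] [LinearOrder V] (u v : V → Fin 2) :
    ∑ x ∈ Finset.univ.filter (fun x : V × V => x.1 < x.2),
      (if v = flipOn {x.1, x.2} u then (1 : ℝ) else 0) = if weight (u + v) = 2 then 1 else 0 := by
  simp_rw [eq_flipOn_iff]
  rw [weight]
  generalize (Finset.univ.filter fun i => (u + v) i = 1) = T
  split_ifs with h
  · obtain ⟨a, b, hab, rfl⟩ : ∃ a b, a < b ∧ T = {a, b} := by
      obtain ⟨a, b, hab, rfl⟩ := Finset.card_eq_two.1 h
      rcases lt_or_gt_of_ne hab with h | h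
      · exact ⟨a, b, h, rfl⟩
      · exact ⟨b, a, h, Finset.pair_comm _ _⟩
    rw [Finset.sum_eq_single (a, b)]
    · simp
    · rintro ⟨x, y⟩ hxy hne
      rw [if_neg]
      intro heq
      have hlt : x < y := (Finset.mem_filter.1 hxy).2
      have hx : x ∈ ({a, b} : Finset V) := heq ▸ by simp
      have hy : y ∈ ({a, b} : Finset V) := heq ▸ by simp
      simp only [Finset.mem_insert, Finset.mem_singleton] at hx hy
      apply hne
      rcases hx with rfl | rfl <;> rcases hy with rfl | rfl
      · exact absurd hlt (lt_irrefl _)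
      · rfl
      · exact absurd hab hlt.not_gt
      · exact absurd hlt (lt_irrefl _)
    · intro h'
      exact absurd (Finset.mem_filter.2 ⟨Finset.mem_univ (a, b), hab⟩) h'
  · refine Finset.sum_eq_zero fun x hx => if_neg ?_
    rintro rfl
    exact h (Finset.card_pair (Finset.mem_filter.1 hx).2.ne)

theorem sum_distance_two {V : Type} [Fintype V] [LinearOrder V] (u : V → Fin 2)
    (g : (V → Fin 2) → ℝ) :
    ∑ v, (if weight (u + v) = 2 then g v else 0)
      = ∑ x ∈ Finset.univ.filter (fun x : V × V => x.1 < x.2), g (flipOn {x.1, x.2} u) := by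
  have h : ∀ v, (if weight (u + v) = 2 then g v else 0)
      = ∑ x ∈ Finset.univ.filter (fun x : V × V => x.1 < x.2),
        if v = flipOn {x.1, x.2} u then g v else 0 := by
    intro v
    have := congrArg (· * g v) (sum_pairs_flipOn u v)
    simp only [Finset.sum_mul, ite_mul, one_mul, zero_mul] at this
    exact this.symm
  simp_rw [h]
  rw [Finset.sum_comm]
  simp

end BitStrings

/-! ### The lowering operator and the spectral gap of the Johnson graph -/

section Lowering

variable {V : Type} [Fintype V] [DecidableEq V]

/-- The total lowering operator `∑ i, |0⟩⟨1|_i` on real functions of the bit strings. -/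
def lower (f : (V → Fin 2) → ℝ) : (V → Fin 2) → ℝ :=
  fun u => ∑ i, if u i = 0 then f (Function.update u i 1) else 0

/-- The total raising operator `∑ i, |1⟩⟨0|_i` on real functions of the bit strings. -/
def raise (f : (V → Fin 2) → ℝ) : (V → Fin 2) → ℝ :=
  fun u => ∑ i, if u i = 1 then f (Function.update u i 0) else 0

/-- `raise` is the adjoint of `lower`. -/
theorem sum_mul_lower (f g : (V → Fin 2) → ℝ) : ∑ u, g u * lower f u = ∑ u, raise g u * f u := by
  simp only [lower, raise, Finset.mul_sum, Finset.sum_mul]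
  rw [Finset.sum_comm, Finset.sum_comm (s := Finset.univ (α := V → Fin 2))]
  refine Finset.sum_congr rfl fun i _ => ?_
  have hinv : Function.Involutive fun u : V → Fin 2 => Function.update u i (u i + 1) := by
    intro u
    have : u i + 1 + 1 = u i := by generalize u i = b; revert b; decide
    simp [this]
  refine Fintype.sum_equiv hinv.toPerm _ _ fun u => ?_
  rcases fin2_eq_zero_or_one (u i) with h | h
  · have h1 : Function.update u i 0 = u := by rw [← h]; exact Function.update_eq_self i u
    simp [h, h1]
  · have h1 : (1 : Fin 2) + 1 = 0 := rfl
    simp [h, h1]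

/-- The commutation relation of the lowering and raising operators: the terms which move an
excitation between two different positions cancel. -/
theorem lower_raise_sub_raise_lower (f : (V → Fin 2) → ℝ) (u : V → Fin 2) :
    lower (raise f) u - raise (lower f) u = ((Fintype.card V : ℝ) - 2 * weight u) * f u := by
  simp only [lower, raise]
  have hdiag : ((Fintype.card V : ℝ) - 2 * weight u) * f u
      = ∑ i, ∑ j, if i = j then (1 - 2 * ((u j : ℕ) : ℝ)) * f u else 0 := by
    simp only [Finset.sum_ite_eq, Finset.mem_univ, if_true]
    rw [← Finset.sum_mul, Finset.sum_sub_distrib, ← Finset.mul_sum, sum_val_eq_weight]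
    simp
  have h1 : ∑ j, (if u j = 1 then ∑ i, (if Function.update u j 0 i = 0 then
        f (Function.update (Function.update u j 0) i 1) else 0) else 0)
      = ∑ i, ∑ j, if u j = 1 then (if Function.update u j 0 i = 0 then
        f (Function.update (Function.update u j 0) i 1) else 0) else 0 := by
    rw [Finset.sum_comm]
    refine Finset.sum_congr rfl fun j _ => ?_
    split_ifs <;> simp
  have h2 : ∑ i, (if u i = 0 then ∑ j, (if Function.update u i 1 j = 1 then
        f (Function.update (Function.update u i 1) j 0) else 0) else 0)
      = ∑ i, ∑ j, if u i = 0 then (if Function.update u i 1 j = 1 then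
        f (Function.update (Function.update u i 1) j 0) else 0) else 0 := by
    refine Finset.sum_congr rfl fun j _ => ?_
    split_ifs <;> simp
  rw [hdiag, h1, h2, ← Finset.sum_sub_distrib]
  refine Finset.sum_congr rfl fun i _ => ?_
  rw [← Finset.sum_sub_distrib]
  refine Finset.sum_congr rfl fun j _ => ?_
  by_cases hij : i = j
  · subst hij
    rcases fin2_eq_zero_or_one (u i) with h | h
    · have h1 : Function.update u i 0 = u := by rw [← h]; exact Function.update_eq_self i u
      simp [h, h1]
    · have h1 : Function.update u i 1 = u := by rw [← h]; exact Function.update_eq_self i u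
      simp [h, h1]; norm_num
  · rw [Function.update_of_ne hij, Function.update_of_ne (Ne.symm hij),
      Function.update_comm hij, if_neg hij]
    by_cases h1 : u i = 0 <;> by_cases h2 : u j = 1 <;> simp [h1, h2]

theorem sum_raise_sq (f : (V → Fin 2) → ℝ) {k : ℕ} (hf : ∀ u, f u ≠ 0 → weight u = k) :
    ∑ u, raise f u ^ 2 = ∑ u, lower f u ^ 2 + ((Fintype.card V : ℝ) - 2 * k) * ∑ u, f u ^ 2 := by
  have h1 : ∑ u, raise f u ^ 2 = ∑ u, f u * lower (raise f) u := by
    rw [sum_mul_lower]; simp_rw [sq]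
  have h2 : ∑ u, lower f u ^ 2 = ∑ u, f u * raise (lower f) u := by
    simp_rw [sq]
    rw [sum_mul_lower]; simp_rw [mul_comm]
  rw [h1, h2, Finset.mul_sum, ← Finset.sum_add_distrib]
  refine Finset.sum_congr rfl fun u _ => ?_
  by_cases h : f u = 0
  · simp [h]
  · have := lower_raise_sub_raise_lower f u
    rw [hf u h] at this
    linear_combination f u * this

theorem weight_of_lower_ne_zero {f : (V → Fin 2) → ℝ} {k : ℕ}
    (hf : ∀ u, f u ≠ 0 → weight u = k + 1) {u : V → Fin 2} (hu : lower f u ≠ 0) : weight u = k := by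
  obtain ⟨i, -, hi⟩ := Finset.exists_ne_zero_of_sum_ne_zero hu
  have h0 : u i = 0 := by by_contra h; simp [h] at hi
  rw [if_pos h0] at hi
  have h1 := hf _ hi
  have h2 := weight_update u i 1
  rw [h0, h1] at h2
  simpa using h2.symm

theorem sum_lower {f : (V → Fin 2) → ℝ} {k : ℕ} (hf : ∀ u, f u ≠ 0 → weight u = k) :
    ∑ u, lower f u = k * ∑ u, f u := by
  have h := sum_mul_lower f (fun _ => 1)
  simp only [one_mul] at h
  rw [h, Finset.mul_sum]
  refine Finset.sum_congr rfl fun u _ => ?_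
  by_cases h : f u = 0
  · simp [h]
  · rw [← hf u h]
    simp [raise, weight]

/-- The spectral gap: on functions of weight `k` with mean zero, `L†L` is at most `(k-1)(N-k)`, for
the lowering operator `L` on `N` bits. The bound passes from `k` to `k + 1` since `L†L` has the same
nonzero spectrum as `LL† = L†L + N - 2k` one level below. -/
theorem sum_lower_sq_le (k : ℕ) : ∀ f : (V → Fin 2) → ℝ, (∀ u, f u ≠ 0 → weight u = k) →
    ∑ u, f u = 0 →
    ∑ u, lower f u ^ 2 ≤ ((k : ℝ) - 1) * ((Fintype.card V : ℝ) - k) * ∑ u, f u ^ 2 := by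
  induction k with
  | zero =>
    intro f hf hsum
    have h0 : ∀ u, u ≠ (fun _ => 0) → f u = 0 := by
      intro u hu
      by_contra h
      exact hu ((weight_eq_zero_iff u).1 (hf u h))
    rw [Finset.sum_eq_single (fun _ => 0) (fun u _ hu => h0 u hu) (by simp)] at hsum
    have hz : f = fun _ => 0 := by
      ext u
      by_cases hu : u = fun _ => 0
      · rw [hu, hsum]
      · exact h0 u hu
    simp [hz, lower]
  | succ k ih =>
    intro f hf hsum
    have hg : ∀ u, lower f u ≠ 0 → weight u = k := fun u hu => weight_of_lower_ne_zero hf hu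
    have hgs : ∑ u, lower f u = 0 := by rw [sum_lower hf, hsum, mul_zero]
    have h1 := ih (lower f) hg hgs
    have h2 := sum_raise_sq (lower f) hg
    have h3 : ∑ u, lower f u ^ 2 = ∑ u, raise (lower f) u * f u := by
      rw [← sum_mul_lower]; simp_rw [sq]
    -- `‖L f‖⁴ = ⟨L†L f, f⟩² ≤ ‖L†(L f)‖² ‖f‖²`, and `‖L†(L f)‖²` is known one level below
    have h4 := Finset.sum_mul_sq_le_sq_mul_sq Finset.univ (raise (lower f)) f
    rw [← h3] at h4
    set G := ∑ u, lower f u ^ 2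
    set F := ∑ u, f u ^ 2
    have hF : 0 ≤ F := Finset.sum_nonneg fun u _ => sq_nonneg _
    have hG : 0 ≤ G := Finset.sum_nonneg fun u _ => sq_nonneg _
    have h5 : G ^ 2 ≤ (k * ((Fintype.card V : ℝ) - (k + 1)) * G) * F :=
      h4.trans (mul_le_mul_of_nonneg_right (by rw [h2]; linarith) hF)
    push_cast
    rcases hG.eq_or_lt with hG0 | hG0
    · rw [← hG0]
      rcases hF.eq_or_lt with hF0 | hF0
      · rw [← hF0, mul_zero]
      · obtain ⟨u, -, hu⟩ := Finset.exists_ne_zero_of_sum_ne_zero hF0.ne'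
        have hw := weight_le_card u
        rw [hf u (by simpa using hu)] at hw
        have : ((k : ℝ) + 1) ≤ Fintype.card V := by exact_mod_cast hw
        have h6 : 0 ≤ (Fintype.card V : ℝ) - (k + 1) := by linarith
        rw [add_sub_cancel_right]
        positivity
    · refine le_of_mul_le_mul_right ?_ hG0
      linarith

/-- The move of one excitation to an empty position, summed over all moves: the Johnson graph in
every weight. -/
def hop (f : (V → Fin 2) → ℝ) (u : V → Fin 2) : ℝ :=
  ∑ x, ∑ y, if u x = 1 ∧ u y = 0 then f (flipOn {x, y} u) else 0

/-- Lowering and raising puts the excitation back in its place, once for each excitation, or moves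
it to another position. -/
theorem raise_lower (f : (V → Fin 2) → ℝ) (u : V → Fin 2) :
    raise (lower f) u = weight u * f u + hop f u := by
  have h : (weight u : ℝ) * f u = ∑ x, ∑ y, if x = y then ((u x : ℕ) : ℝ) * f u else 0 := by
    simp [← Finset.sum_mul, sum_val_eq_weight]
  rw [h, hop, ← Finset.sum_add_distrib, raise]
  refine Finset.sum_congr rfl fun x _ => ?_
  rw [← Finset.sum_add_distrib]
  rcases fin2_eq_zero_or_one (u x) with hx | hx
  · simp [hx]
  · rw [if_pos hx, lower]
    refine Finset.sum_congr rfl fun y _ => ?_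
    by_cases hxy : x = y
    · subst hxy
      have h1 : Function.update u x 1 = u := by rw [← hx]; exact Function.update_eq_self x u
      simp [hx, h1]
    · rw [Function.update_of_ne (Ne.symm hxy), if_neg hxy, zero_add, flipOn_pair hxy]
      by_cases hy : u y = 0
      · simp [hx, hy]
      · simp [hy]

theorem sum_mul_hop_le {f : (V → Fin 2) → ℝ} {k : ℕ} (hf : ∀ u, f u ≠ 0 → weight u = k)
    (hsum : ∑ u, f u = 0) :
    ∑ u, f u * hop f u
      ≤ (((k : ℝ) - 1) * ((Fintype.card V : ℝ) - k) - k) * ∑ u, f u ^ 2 := by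
  have h1 := sum_lower_sq_le k f hf hsum
  have h2 : ∑ u, lower f u ^ 2 = ∑ u, f u * raise (lower f) u := by
    simp_rw [sq]
    rw [sum_mul_lower]; simp_rw [mul_comm]
  have h3 : ∑ u, f u * raise (lower f) u = k * ∑ u, f u ^ 2 + ∑ u, f u * hop f u := by
    rw [Finset.mul_sum, ← Finset.sum_add_distrib]
    refine Finset.sum_congr rfl fun u _ => ?_
    rw [raise_lower]
    by_cases h : f u = 0
    · simp [h]
    · rw [hf u h]; ring
  linarith

theorem sum_distance_two_eq_hop {V : Type} [Fintype V] [LinearOrder V] {f : (V → Fin 2) → ℝ} {k : ℕ}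
    (hf : ∀ u, f u ≠ 0 → weight u = k) {u : V → Fin 2} (hu : weight u = k) :
    ∑ v, (if weight (u + v) = 2 then f v else 0) = hop f u := by
  rw [sum_distance_two, sum_pairs_eq_half (fun x y => f (flipOn {x, y} u))
    (fun x y => by rw [Finset.pair_comm])]
  have h1 : hop f u = ∑ x, ∑ y, if u y = 1 ∧ u x = 0 then f (flipOn {x, y} u) else 0 := by
    rw [hop, Finset.sum_comm]
    simp_rw [Finset.pair_comm]
  have h2 : ∑ x, ∑ y, (if x ≠ y then f (flipOn {x, y} u) else 0) = hop f u + hop f u := by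
    nth_rw 2 [h1]
    rw [hop]
    simp_rw [← Finset.sum_add_distrib]
    refine Finset.sum_congr rfl fun x _ => Finset.sum_congr rfl fun y _ => ?_
    by_cases hxy : x = y
    · subst hxy
      rcases fin2_eq_zero_or_one (u x) with h | h <;> simp [h]
    · have h3 : u x = u y → f (flipOn {x, y} u) = 0 := by
        intro h
        by_contra h4
        have h5 := weight_flipOn_pair hxy u
        rw [hf _ h4, hu, h] at h5
        rcases fin2_eq_zero_or_one (u y) with h6 | h6 <;> simp [h6] at h5
      rcases fin2_eq_zero_or_one (u x) with hx | hx <;>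
        rcases fin2_eq_zero_or_one (u y) with hy | hy <;> simp [hx, hy] at h3 ⊢ <;> simp [hxy, h3]
  rw [h2]
  ring

end Lowering

section Weights

variable {V : Type} [Fintype V] [DecidableEq V]

theorem card_weight_eq (k : ℕ) :
    (Finset.univ.filter fun u : V → Fin 2 => weight u = k).card = (Fintype.card V).choose k := by
  rw [← Finset.card_univ, ← Finset.card_powersetCard]
  refine Finset.card_bij' (fun u _ => Finset.univ.filter fun i => u i = 1)
    (fun s _ => fun i => if i ∈ s then 1 else 0) ?_ ?_ ?_ ?_
  · intro u hu
    exact Finset.mem_powersetCard.2 ⟨Finset.subset_univ _, (Finset.mem_filter.1 hu).2⟩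
  · intro s hs
    refine Finset.mem_filter.2 ⟨Finset.mem_univ _, ?_⟩
    simpa [weight] using (Finset.mem_powersetCard.1 hs).2
  · intro u _
    ext i
    rcases fin2_eq_zero_or_one (u i) with h | h <;> simp [h]
  · intro s _
    ext i
    simp

theorem exists_weight_eq {k : ℕ} (hk : k ≤ Fintype.card V) : ∃ u : V → Fin 2, weight u = k := by
  have h : 0 < (Finset.univ.filter fun u : V → Fin 2 => weight u = k).card := by
    rw [card_weight_eq]; exact Nat.choose_pos hk
  obtain ⟨u, hu⟩ := Finset.card_pos.1 h
  exact ⟨u, (Finset.mem_filter.1 hu).2⟩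

/-- Flipping all bits. -/
def flipAll {V : Type} (u : V → Fin 2) : V → Fin 2 := fun i => u i + 1

theorem flipAll_involutive {V : Type} : Function.Involutive (flipAll (V := V)) := by
  intro u
  ext i
  have : ∀ b : Fin 2, b + 1 + 1 = b := by decide
  simp [flipAll, this]

theorem weight_flipAll {V : Type} [Fintype V] (u : V → Fin 2) :
    weight (flipAll u) + weight u = Fintype.card V := by
  rw [weight_eq_sum, weight_eq_sum, ← Finset.sum_add_distrib, Fintype.card, Finset.card_eq_sum_ones]
  refine Finset.sum_congr rfl fun i _ => ?_
  have : ∀ b : Fin 2, ((b + 1 : Fin 2) : ℕ) + b = 1 := by decide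
  exact this _

theorem sum_extreme_weights [Nonempty V] (g : (V → Fin 2) → ℝ) :
    ∑ u, (if weight u = 0 ∨ weight u = Fintype.card V then g u else 0)
      = g (fun _ => 0) + g (fun _ => 1) := by
  have hne : (fun _ : V => (0 : Fin 2)) ≠ fun _ => 1 := by
    intro h
    obtain ⟨i⟩ := ‹Nonempty V›
    exact absurd (congrFun h i) (by decide)
  simp_rw [weight_eq_zero_iff, weight_eq_card_iff]
  rw [← Finset.sum_filter, show (Finset.univ.filter fun u : V → Fin 2 =>
    u = (fun _ => 0) ∨ u = fun _ => 1) = {fun _ => 0, fun _ => 1} by ext; simp,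
    Finset.sum_pair hne]

/-- The part of a function living on the strings of weight `k`. -/
def level {V : Type} [Fintype V] (k : ℕ) (f : (V → Fin 2) → ℝ) : (V → Fin 2) → ℝ :=
  fun u => if weight u = k then f u else 0

theorem weight_of_level_ne_zero {V : Type} [Fintype V] {k : ℕ} {f : (V → Fin 2) → ℝ} (u : V → Fin 2)
    (h : level k f u ≠ 0) : weight u = k := by
  by_contra h'
  exact h (if_neg h')

theorem sum_level_one (k : ℕ) :
    ∑ u : V → Fin 2, level k (fun _ => 1) u = (Fintype.card V).choose k := by
  simp only [level, Finset.sum_boole, card_weight_eq]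

theorem hop_level {k : ℕ} {f : (V → Fin 2) → ℝ} {u : V → Fin 2} (hu : weight u = k) :
    hop (level k f) u = hop f u := by
  refine Finset.sum_congr rfl fun x _ => Finset.sum_congr rfl fun y _ => ?_
  split_ifs with h
  · have hxy : x ≠ y := by
      rintro rfl
      rw [h.1] at h
      exact absurd h.2 (by decide)
    have hw := weight_flipOn_pair hxy u
    rw [h.1, h.2, hu] at hw
    exact if_pos (by simpa using hw)
  · rfl

theorem hop_one (u : V → Fin 2) :
    hop (fun _ => 1) u = weight u * ((Fintype.card V : ℝ) - weight u) := by
  have h : ∀ x y, (if u x = 1 ∧ u y = 0 then (1 : ℝ) else 0)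
      = ((u x : ℕ) : ℝ) * (1 - ((u y : ℕ) : ℝ)) := by
    intro x y
    rcases fin2_eq_zero_or_one (u x) with hx | hx <;>
      rcases fin2_eq_zero_or_one (u y) with hy | hy <;> simp [hx, hy]
  simp_rw [hop, h, ← Finset.mul_sum, Finset.sum_sub_distrib, ← Finset.sum_mul]
  rw [sum_val_eq_weight]
  simp

/-- The sign `±1` of a single bit is an eigenfunction of the Johnson graph on half-filled strings,
for the second largest eigenvalue. -/
theorem hop_sign {n : ℕ} (hV : Fintype.card V = 2 * n) (a : V) {u : V → Fin 2}
    (hu : weight u = n) :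
    hop (fun v => 1 - 2 * ((v a : ℕ) : ℝ)) u
      = ((n : ℝ) ^ 2 - 2 * n) * (1 - 2 * ((u a : ℕ) : ℝ)) := by
  have h : ∀ x y, (if u x = 1 ∧ u y = 0 then (1 - 2 * ((flipOn {x, y} u a : ℕ) : ℝ)) else 0)
      = (1 - 2 * ((u a : ℕ) : ℝ)) * (((u x : ℕ) : ℝ) * (1 - ((u y : ℕ) : ℝ)))
        + (if a = x then 2 * (((u a : ℕ) : ℝ) * (1 - ((u y : ℕ) : ℝ))) else 0)
        - (if a = y then 2 * (((u x : ℕ) : ℝ) * (1 - ((u a : ℕ) : ℝ))) else 0) := by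
    intro x y
    by_cases h1 : a = x
    · subst h1
      by_cases h2 : a = y
      · subst h2
        rcases fin2_eq_zero_or_one (u a) with ha | ha <;> simp [ha]
      · rcases fin2_eq_zero_or_one (u a) with ha | ha <;>
          rcases fin2_eq_zero_or_one (u y) with hy | hy <;> simp [ha, hy, h2, flipOn]
    · by_cases h2 : a = y
      · subst h2
        rcases fin2_eq_zero_or_one (u a) with ha | ha <;>
          rcases fin2_eq_zero_or_one (u x) with hx | hx <;> simp [ha, hx, h1, flipOn]
      · rcases fin2_eq_zero_or_one (u x) with hx | hx <;>
          rcases fin2_eq_zero_or_one (u y) with hy | hy <;> simp [hx, hy, h1, h2, flipOn]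
  have hw : ∑ i, ((u i : ℕ) : ℝ) = n := by rw [sum_val_eq_weight, hu]
  simp_rw [hop, h, Finset.sum_sub_distrib, Finset.sum_add_distrib]
  rw [Finset.sum_comm (f := fun x y => if a = x then
    2 * (((u a : ℕ) : ℝ) * (1 - ((u y : ℕ) : ℝ))) else 0)]
  simp only [Finset.sum_ite_eq, Finset.mem_univ, if_true, ← Finset.mul_sum, ← Finset.sum_mul,
    Finset.sum_sub_distrib, hw]
  simp only [Finset.sum_const, Finset.card_univ, hV, nsmul_eq_mul]
  push_cast
  ring

/-- Flipping all bits preserves the weight `n` and changes the sign. -/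
theorem sum_level_sign {n : ℕ} (hV : Fintype.card V = 2 * n) (a : V) :
    ∑ u, level n (fun v : V → Fin 2 => 1 - 2 * ((v a : ℕ) : ℝ)) u = 0 := by
  have h : ∑ u, level n (fun v : V → Fin 2 => 1 - 2 * ((v a : ℕ) : ℝ)) u
      = ∑ u, -level n (fun v : V → Fin 2 => 1 - 2 * ((v a : ℕ) : ℝ)) u := by
    refine Fintype.sum_equiv flipAll_involutive.toPerm _ _ fun u => ?_
    have hw := weight_flipAll u
    change level n (fun v : V → Fin 2 => 1 - 2 * ((v a : ℕ) : ℝ)) u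
      = -level n (fun v : V → Fin 2 => 1 - 2 * ((v a : ℕ) : ℝ)) (flipAll u)
    rw [level, level]
    by_cases hu : weight u = n
    · rw [if_pos hu, if_pos (by omega)]
      rcases fin2_eq_zero_or_one (u a) with ha | ha <;> norm_num [flipAll, ha]
    · rw [if_neg hu, if_neg (by omega), neg_zero]
  rw [Finset.sum_neg_distrib] at h
  linarith

/-- The Johnson graph has the eigenvalue `n²` on the constants, and at most `n² - 2n` on the
functions of mean zero. -/
theorem sum_mul_hop_level_le {n : ℕ} (hV : Fintype.card V = 2 * n) (x : (V → Fin 2) → ℝ) :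
    ∑ u, level n x u * hop (level n x) u
      ≤ ((n : ℝ) ^ 2 - 2 * n) * ∑ u, level n x u ^ 2
        + 2 * n * ((∑ u, level n x u) ^ 2 / (2 * n).choose n) := by
  have hC : (0 : ℝ) < (2 * n).choose n := by
    exact_mod_cast Nat.choose_pos (by omega)
  -- split off the mean `m` of `x` over the strings of weight `n`
  set s := ∑ u, level n x u with hs
  set m := s / (2 * n).choose n with hm
  set y : (V → Fin 2) → ℝ := level n fun u => x u - m with hy
  have hyx : ∀ u, level n x u = y u + m * level n (fun _ => 1) u := by
    intro u
    simp only [hy, level]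
    split_ifs <;> ring
  have hone : ∑ u : V → Fin 2, level n (fun _ => 1) u = (2 * n).choose n := by
    rw [sum_level_one, hV]
  have hysum : ∑ u, y u = 0 := by
    have : s = ∑ u, y u + m * (2 * n).choose n := by
      rw [hs, ← hone, Finset.mul_sum, ← Finset.sum_add_distrib]
      exact Finset.sum_congr rfl fun u _ => hyx u
    rw [hm, div_mul_cancel₀ _ hC.ne'] at this
    linarith
  have hgap := sum_mul_hop_le (f := y) (fun u => weight_of_level_ne_zero u) hysum
  have hsq : ∑ u, level n x u ^ 2 = ∑ u, y u ^ 2 + m * s := by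
    rw [hs, Finset.mul_sum, ← Finset.sum_add_distrib]
    have : ∑ u, (y u ^ 2 + m * level n x u) = ∑ u, (level n x u ^ 2 + -m * y u) := by
      refine Finset.sum_congr rfl fun u _ => ?_
      simp only [hy, level]
      split_ifs <;> ring
    rw [this, Finset.sum_add_distrib, ← Finset.mul_sum, hysum, mul_zero, add_zero]
  have hlow : ∀ f : (V → Fin 2) → ℝ, (∀ u, f u ≠ 0 → weight u = n) →
      ∑ u, f u * hop f u = ∑ u, lower f u ^ 2 - n * ∑ u, f u ^ 2 := by
    intro f hf
    have h2 : ∑ u, lower f u ^ 2 = ∑ u, f u * raise (lower f) u := by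
      simp_rw [sq]
      rw [sum_mul_lower]; simp_rw [mul_comm]
    rw [h2, Finset.mul_sum, ← Finset.sum_sub_distrib]
    refine Finset.sum_congr rfl fun u _ => ?_
    rw [raise_lower]
    by_cases h : f u = 0
    · simp [h]
    · rw [hf u h]; ring
  have hlower : ∀ u, lower (level n x) u = lower y u + m * lower (level n fun _ => 1) u := by
    intro u
    simp only [lower, Finset.mul_sum, ← Finset.sum_add_distrib]
    refine Finset.sum_congr rfl fun i _ => ?_
    split_ifs
    · exact hyx _
    · ring
  have hraise : ∀ f : (V → Fin 2) → ℝ, (∀ u, f u ≠ 0 → weight u = n) →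
      ∑ u, lower (level n fun _ => 1) u * lower f u = (n + n * n) * ∑ u, f u := by
    intro f hf
    rw [sum_mul_lower, Finset.mul_sum]
    refine Finset.sum_congr rfl fun u _ => ?_
    by_cases h : f u = 0
    · simp [h]
    · have hu := hf u h
      rw [raise_lower, hop_level hu, hop_one, level, if_pos hu, hu, hV]
      push_cast
      ring
  have hcross := hraise y fun u => weight_of_level_ne_zero u
  have hoo := hraise (level n fun _ => 1) fun u => weight_of_level_ne_zero u
  rw [hysum] at hcross
  rw [hone] at hoo
  have hexp : ∑ u, lower (level n x) u ^ 2
      = ∑ u, lower y u ^ 2 + m ^ 2 * ((n + n * n) * (2 * n).choose n) := by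
    have : ∀ u, lower (level n x) u ^ 2 = lower y u ^ 2
        + 2 * m * (lower (level n fun _ => 1) u * lower y u)
        + m ^ 2 * (lower (level n fun _ => 1) u * lower (level n fun _ => 1) u) := by
      intro u
      rw [hlower]; ring
    simp_rw [this, Finset.sum_add_distrib, ← Finset.mul_sum, hcross, hoo]
    ring
  rw [hlow _ fun u => weight_of_level_ne_zero u, hexp]
  rw [hlow _ fun u => weight_of_level_ne_zero u, hV] at hgap
  have hms : m ^ 2 * (((n : ℝ) + n * n) * (2 * n).choose n) = (n + n * n) * (m * s) := by
    have : s = m * (2 * n).choose n := by rw [hm, div_mul_cancel₀ _ hC.ne']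
    rw [this]; ring
  have hms2 : s ^ 2 / (2 * n).choose n = m * s := by rw [hm]; ring
  rw [hms, hms2, hsq]
  push_cast at hgap
  nlinarith [hgap]

/-- Schur's test: the quadratic form of a symmetric matrix with nonnegative entries is bounded by
its row sums. -/
theorem form_le_row_sums {ι : Type*} [Fintype ι] {a : ι → ι → ℝ} (hsymm : ∀ u v, a u v = a v u)
    (hnonneg : ∀ u v, 0 ≤ a u v) (x : ι → ℝ) :
    ∑ u, ∑ v, a u v * x u * x v ≤ ∑ u, (∑ v, a u v) * x u ^ 2 := by
  have h1 : ∑ u, (∑ v, a u v) * x u ^ 2 = ∑ u, ∑ v, a u v * x u ^ 2 := by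
    simp_rw [Finset.sum_mul]
  have h2 : ∑ u, ∑ v, a u v * x u ^ 2 = ∑ u, ∑ v, a u v * x v ^ 2 := by
    rw [Finset.sum_comm]
    simp_rw [hsymm]
  have h3 : 2 * ∑ u, ∑ v, a u v * x u * x v
      ≤ ∑ u, ∑ v, a u v * x u ^ 2 + ∑ u, ∑ v, a u v * x v ^ 2 := by
    rw [Finset.mul_sum, ← Finset.sum_add_distrib]
    refine Finset.sum_le_sum fun u _ => ?_
    rw [Finset.mul_sum, ← Finset.sum_add_distrib]
    refine Finset.sum_le_sum fun v _ => ?_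
    nlinarith [mul_nonneg (hnonneg u v) (sq_nonneg (x u - x v))]
  linarith

end Weights

/-! ### The three components as real matrices, and their quadratic forms -/

section Components

variable {n : ℕ}

/-- The entries of the component on the weights `0`, `n` and `2n`: the diagonal is `α₀` on the
weights `0` and `2n` and `α₁` on the weight `n`, neighbours in the Johnson graph are coupled by `γ`,
and `δ` couples the weights `0` and `2n` to the weight `n`. -/
def entry1 (n : ℕ) (α₀ α₁ γ δ : ℝ) (u v : Fin (2 * n) → Fin 2) : ℝ :=
  (if u = v then (if weight u = n then α₁ else if weight u = 0 ∨ weight u = 2 * n then α₀ else 0)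
    else 0) +
  γ * (if weight u = n ∧ weight v = n ∧ weight (u + v) = 2 then 1 else 0) +
  δ * (if (weight u = 0 ∨ weight u = 2 * n) ∧ weight v = n ∨
    weight u = n ∧ (weight v = 0 ∨ weight v = 2 * n) then 1 else 0)

/-- The entries of the component on the weights `n - 1` and `n + 1`. -/
def entry2 (n : ℕ) (α γ : ℝ) (u v : Fin (2 * n) → Fin 2) : ℝ :=
  (if u = v then (if weight u + 1 = n ∨ weight u = n + 1 then α else 0) else 0) +
  γ * (if (weight u + 1 = n ∧ weight v = n + 1 ∨ weight v + 1 = n ∧ weight u = n + 1) ∧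
    weight (u + v) = 2 then 1 else 0)

/-- The diagonal of the component on the remaining weights: `d m` on the weights `m` and
`2n - m`, for `1 ≤ m ≤ n - 2`. -/
def diag3 (n : ℕ) (d : ℕ → ℝ) (w : ℕ) : ℝ :=
  if 1 ≤ w ∧ w + 2 ≤ n then d w else if n + 2 ≤ w ∧ w < 2 * n then d (2 * n - w) else 0

/-- The entries of the diagonal component on the remaining weights. -/
def entry3 (n : ℕ) (d : ℕ → ℝ) (u v : Fin (2 * n) → Fin 2) : ℝ :=
  if u = v then diag3 n d (weight u) else 0

theorem entry1_comm (n : ℕ) (α₀ α₁ γ δ : ℝ) (u v : Fin (2 * n) → Fin 2) :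
    entry1 n α₀ α₁ γ δ u v = entry1 n α₀ α₁ γ δ v u := by
  unfold entry1
  congr 1
  · congr 1
    · by_cases h : u = v
      · subst h; rfl
      · rw [if_neg h, if_neg (Ne.symm h)]
    · rw [add_comm u v]
      congr 2
      exact propext (by tauto)
  · congr 2
    exact propext (by tauto)

theorem entry2_comm (n : ℕ) (α γ : ℝ) (u v : Fin (2 * n) → Fin 2) :
    entry2 n α γ u v = entry2 n α γ v u := by
  unfold entry2
  congr 1
  · by_cases h : u = v
    · subst h; rfl
    · rw [if_neg h, if_neg (Ne.symm h)]
  · rw [add_comm u v]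
    congr 2
    exact propext (by tauto)

theorem entry3_comm (n : ℕ) (d : ℕ → ℝ) (u v : Fin (2 * n) → Fin 2) :
    entry3 n d u v = entry3 n d v u := by
  unfold entry3
  by_cases h : u = v
  · subst h; rfl
  · rw [if_neg h, if_neg (Ne.symm h)]

theorem sum_entry1_mul (hn : 1 ≤ n) (α₀ α₁ γ δ : ℝ) (f : (Fin (2 * n) → Fin 2) → ℝ)
    (u : Fin (2 * n) → Fin 2) :
    ∑ v, entry1 n α₀ α₁ γ δ u v * f v =
      (if weight u = n then
        α₁ * f u + γ * hop (level n f) u + δ * (f (fun _ => 0) + f (fun _ => 1)) else 0) +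
      if weight u = 0 ∨ weight u = 2 * n then α₀ * f u + δ * ∑ v, level n f v else 0 := by
  have : Nonempty (Fin (2 * n)) := ⟨⟨0, by omega⟩⟩
  have hext := sum_extreme_weights f
  rw [Fintype.card_fin] at hext
  have h1 : ∑ v, entry1 n α₀ α₁ γ δ u v * f v =
      (if weight u = n then α₁ else if weight u = 0 ∨ weight u = 2 * n then α₀ else 0) * f u
      + γ * (if weight u = n then
          ∑ v, (if weight (u + v) = 2 then level n f v else 0) else 0)
      + δ * ∑ v, (if (weight u = 0 ∨ weight u = 2 * n) ∧ weight v = n ∨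
          weight u = n ∧ (weight v = 0 ∨ weight v = 2 * n) then f v else 0) := by
    simp only [entry1, add_mul, Finset.sum_add_distrib, ite_mul, zero_mul, Finset.sum_ite_eq,
      Finset.mem_univ, if_true, mul_assoc, ← Finset.mul_sum, one_mul]
    congr 3
    split_ifs with hu
    · refine Finset.sum_congr rfl fun v _ => ?_
      by_cases hv : weight v = n <;> by_cases hd : weight (u + v) = 2 <;> simp [hu, hv, hd, level]
    · simp [hu]
  rw [h1]
  by_cases hu : weight u = n
  · have h0 : ¬ (weight u = 0 ∨ weight u = 2 * n) := by omega
    rw [if_pos hu, if_pos hu, if_pos hu, if_neg h0, add_zero,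
      sum_distance_two_eq_hop (fun v => weight_of_level_ne_zero v) hu, ← hext]
    congr 2
    exact Finset.sum_congr rfl fun v _ => if_congr (by omega) rfl rfl
  · rw [if_neg hu, if_neg hu, if_neg hu, mul_zero, add_zero, zero_add]
    split_ifs with h0
    · congr 2
      exact Finset.sum_congr rfl fun v _ => if_congr (by omega) rfl rfl
    · rw [zero_mul, zero_add, Finset.sum_eq_zero fun v _ => if_neg (by omega), mul_zero]

theorem sum_entry1_form (hn : 1 ≤ n) (α₀ α₁ γ δ : ℝ) (x : (Fin (2 * n) → Fin 2) → ℝ) :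
    ∑ u, ∑ v, entry1 n α₀ α₁ γ δ u v * x u * x v =
      α₀ * (x (fun _ => 0) ^ 2 + x (fun _ => 1) ^ 2) + α₁ * ∑ u, level n x u ^ 2 +
      γ * ∑ u, level n x u * hop (level n x) u +
      2 * δ * (x (fun _ => 0) + x (fun _ => 1)) * ∑ u, level n x u := by
  have : Nonempty (Fin (2 * n)) := ⟨⟨0, by omega⟩⟩
  have h1 : ∀ u, ∑ v, entry1 n α₀ α₁ γ δ u v * x u * x v =
      (α₁ * level n x u ^ 2 + γ * (level n x u * hop (level n x) u) +
        δ * (x (fun _ => 0) + x (fun _ => 1)) * level n x u) +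
      if weight u = 0 ∨ weight u = 2 * n then α₀ * x u ^ 2 + δ * (∑ v, level n x v) * x u
        else 0 := by
    intro u
    have : ∑ v, entry1 n α₀ α₁ γ δ u v * x u * x v
        = x u * ∑ v, entry1 n α₀ α₁ γ δ u v * x v := by
      rw [Finset.mul_sum]
      exact Finset.sum_congr rfl fun v _ => by ring
    rw [this, sum_entry1_mul hn, mul_add]
    congr 1
    · by_cases hu : weight u = n
      · rw [if_pos hu, show level n x u = x u from if_pos hu]; ring
      · rw [if_neg hu, show level n x u = 0 from if_neg hu]; ring
    · split_ifs <;> ring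
  have hext := sum_extreme_weights fun u => α₀ * x u ^ 2 + δ * (∑ v, level n x v) * x u
  rw [Fintype.card_fin] at hext
  simp_rw [h1, Finset.sum_add_distrib, ← Finset.mul_sum]
  rw [hext]
  ring

/-- On the orthogonal complement of the target state, with amplitude `1` on the weights `0` and `2n`
and `κ = √(λ₁/λ₀)` on the weight `n`, the quadratic form of the component on the weights `0`, `n`
and `2n` is at most `b ‖x‖²`, if `b` is at least the eigenvalue at the antisymmetric combination of
`0…0` and `1…1` and the eigenvalue at the sign of a single bit. -/
theorem form_entry1_le (hn : 1 ≤ n) {p l0 l1 κ b : ℝ} (hp : p < 1) (hl1 : 0 ≤ l1)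
    (hsum : l0 + l1 = 1) (hκ : κ ^ 2 * l0 = l1)
    (hb0 : p + (1 - p) * l0 ≤ b)
    (hb1 : 1 - 1 / (2 * n - 1) - 2 * (1 - p) * l0 / (2 * n).choose n ≤ b)
    {x : (Fin (2 * n) → Fin 2) → ℝ}
    (hx : x (fun _ => 0) + x (fun _ => 1) + κ * ∑ u, level n x u = 0) :
    ∑ u, ∑ v, entry1 n (p + (1 - p) * l0)
        ((3 * n - 2) / (2 * (2 * n - 1)) - 2 * (1 - p) * l0 / (2 * n).choose n)
        (1 / (2 * n * (2 * n - 1))) ((1 - p) * (l0 * κ) / (2 * n).choose n) u v * x u * x v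
      ≤ b * (x (fun _ => 0) ^ 2 + x (fun _ => 1) ^ 2 + ∑ u, level n x u ^ 2) := by
  rw [sum_entry1_form hn]
  have hC : (0 : ℝ) < (2 * n).choose n := by exact_mod_cast Nat.choose_pos (by omega)
  have hn' : (1 : ℝ) ≤ n := by exact_mod_cast hn
  have h2n : (0 : ℝ) < 2 * n - 1 := by linarith
  have hgap := sum_mul_hop_level_le (Fintype.card_fin (2 * n)) x
  have hcs := Finset.sum_mul_sq_le_sq_mul_sq Finset.univ (level n x)
    (level (V := Fin (2 * n)) n fun _ => 1)
  have h1 : ∀ u, level n x u * level n (fun _ => 1) u = level n x u := by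
    intro u; simp only [level]; split_ifs <;> ring
  have h2 : ∀ u : Fin (2 * n) → Fin 2, level n (fun _ => 1) u ^ 2 = level n (fun _ => 1) u := by
    intro u; simp only [level]; split_ifs <;> ring
  simp_rw [h1, h2, sum_level_one, Fintype.card_fin] at hcs
  set C : ℝ := ((2 * n).choose n : ℝ) with hCdef
  set s := ∑ u, level n x u
  set X := ∑ u, level n x u ^ 2
  set H := ∑ u, level n x u * hop (level n x) u
  set a := x (fun _ => 0)
  set c := x (fun _ => 1)
  -- `t` is the squared norm of the projection onto the constants on weight `n`
  set t := s ^ 2 / C with ht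
  have htX : t ≤ X := by rw [ht, div_le_iff₀ hC]; exact hcs
  have ht0 : 0 ≤ t := by positivity
  have hac : a + c = -(κ * s) := by linarith
  have hγ : (0 : ℝ) ≤ 1 / (2 * n * (2 * n - 1)) := by positivity
  have e1 : 1 / (2 * n * (2 * n - 1)) * H ≤ (n - 2) / (2 * (2 * n - 1)) * X
      + 1 / (2 * n - 1) * t := by
    refine (mul_le_mul_of_nonneg_left hgap hγ).trans (le_of_eq ?_)
    field_simp
  -- orthogonality to the target state turns the coherence into a nonpositive multiple of `t`
  have e2 : 2 * ((1 - p) * (l0 * κ) / C) * (a + c) * s = -(2 * (1 - p) * l1) * t := by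
    rw [hac, ht, ← hκ]; ring
  have e3 : ((3 * n - 2) / (2 * (2 * n - 1)) - 2 * (1 - p) * l0 / C : ℝ)
      = (1 - 1 / (2 * n - 1) - 2 * (1 - p) * l0 / C) - (n - 2) / (2 * (2 * n - 1)) := by
    have h3 : ((3 * n - 2) / (2 * (2 * n - 1)) : ℝ)
        = 1 - 1 / (2 * n - 1) - (n - 2) / (2 * (2 * n - 1)) := by
      rw [eq_sub_iff_add_eq, ← add_div, eq_sub_iff_add_eq, div_add_div _ _ (by positivity) h2n.ne',
        div_eq_one_iff_eq (by positivity)]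
      ring
    linarith
  have hε : 0 ≤ 2 * (1 - p) * l0 / C := by
    have : 0 ≤ l0 := by nlinarith [sq_nonneg κ]
    have : 0 ≤ 1 - p := by linarith
    positivity
  rw [e2, e3]
  -- `X - t` carries the mean-zero part of `x` on weight `n`, `t` its mean
  have h3 := mul_le_mul_of_nonneg_right hb1 (sub_nonneg.2 htX)
  have h4 := mul_le_mul_of_nonneg_right hb0 (add_nonneg (sq_nonneg a) (sq_nonneg c))
  have h5 : (1 - 2 * (1 - p) * l0 / C - 2 * (1 - p) * l1) * t ≤ b * t := by
    refine mul_le_mul_of_nonneg_right ?_ ht0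
    have : 1 - 2 * (1 - p) * l1 ≤ p + (1 - p) * l0 := by
      have : l0 = 1 - l1 := by linarith
      rw [this]
      nlinarith [mul_nonneg (sub_nonneg.2 hp.le) hl1]
    linarith
  linarith

theorem sum_entry2_row (α γ : ℝ) (u : Fin (2 * n) → Fin 2) :
    ∑ v, entry2 n α γ u v
      = if weight u + 1 = n ∨ weight u = n + 1 then α + γ * ((n + 1) * n / 2) else 0 := by
  have hpairs : ∑ v, (if weight (u + v) = 2 then
      (if weight u + 1 = n ∧ weight v = n + 1 ∨ weight v + 1 = n ∧ weight u = n + 1 then (1 : ℝ)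
        else 0) else 0)
      = ∑ x ∈ Finset.univ.filter (fun x : Fin (2 * n) × Fin (2 * n) => x.1 < x.2),
        (if weight u + 1 = n then (1 - 1 * (((u x.1 : ℕ) : ℝ) + ((u x.2 : ℕ) : ℝ))
          + 1 * (((u x.1 : ℕ) : ℝ) * ((u x.2 : ℕ) : ℝ))) else if weight u = n + 1 then
          (0 + 0 * (((u x.1 : ℕ) : ℝ) + ((u x.2 : ℕ) : ℝ))
          + 1 * (((u x.1 : ℕ) : ℝ) * ((u x.2 : ℕ) : ℝ))) else 0) := by
    rw [sum_distance_two]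
    refine Finset.sum_congr rfl fun x hx => ?_
    have hw := weight_flipOn_pair (Finset.mem_filter.1 hx).2.ne u
    generalize weight (flipOn {x.1, x.2} u) = w at hw
    rcases fin2_eq_zero_or_one (u x.1) with h1 | h1 <;>
      rcases fin2_eq_zero_or_one (u x.2) with h2 | h2 <;> rw [h1, h2] at hw ⊢ <;>
      simp at hw ⊢ <;> first | omega | (split_ifs <;> first | rfl | omega)
  have hsplit : ∑ v, entry2 n α γ u v
      = (if weight u + 1 = n ∨ weight u = n + 1 then α else 0) + γ * ∑ v, (if weight (u + v) = 2 then
      (if weight u + 1 = n ∧ weight v = n + 1 ∨ weight v + 1 = n ∧ weight u = n + 1 then (1 : ℝ)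
        else 0) else 0) := by
    simp only [entry2, Finset.sum_add_distrib, Finset.sum_ite_eq, Finset.mem_univ, if_true,
      ← Finset.mul_sum]
    congr 2
    refine Finset.sum_congr rfl fun v _ => ?_
    rw [← ite_and]
    congr 1
    exact propext (by tauto)
  rw [hsplit, hpairs]
  by_cases h1 : weight u + 1 = n
  · simp only [h1, if_true, true_or]
    have := sum_pairs_polynomial u 1 (-1) 1
    simp only [neg_mul, ← sub_eq_add_neg] at this
    rw [this, Fintype.card_fin]
    have hw : (weight u : ℝ) = n - 1 := by
      rw [eq_sub_iff_add_eq]; exact_mod_cast h1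
    rw [hw]
    push_cast
    ring
  · by_cases h2 : weight u = n + 1
    · simp only [if_neg h1, if_pos h2, if_pos (Or.inr h2)]
      rw [sum_pairs_polynomial u 0 0 1, h2]
      push_cast
      ring
    · simp [h1, h2]

theorem entry2_nonneg {α γ : ℝ} (hα : 0 ≤ α) (hγ : 0 ≤ γ) (u v : Fin (2 * n) → Fin 2) :
    0 ≤ entry2 n α γ u v := by
  unfold entry2
  refine add_nonneg ?_ (mul_nonneg hγ ?_) <;> split_ifs <;> simp [hα]

theorem form_entry2_le {α γ b : ℝ} (hα : 0 ≤ α) (hγ : 0 ≤ γ)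
    (hb : α + γ * ((n + 1) * n / 2) ≤ b) (x : (Fin (2 * n) → Fin 2) → ℝ) :
    ∑ u, ∑ v, entry2 n α γ u v * x u * x v
      ≤ b * ∑ u, if weight u + 1 = n ∨ weight u = n + 1 then x u ^ 2 else 0 := by
  refine (form_le_row_sums (entry2_comm n α γ) (entry2_nonneg hα hγ) x).trans ?_
  rw [Finset.mul_sum]
  refine Finset.sum_le_sum fun u _ => ?_
  rw [sum_entry2_row]
  split_ifs
  · exact mul_le_mul_of_nonneg_right hb (sq_nonneg _)
  · simp

theorem sum_entry3_mul (d : ℕ → ℝ) (f : (Fin (2 * n) → Fin 2) → ℝ) (u : Fin (2 * n) → Fin 2) :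
    ∑ v, entry3 n d u v * f v = diag3 n d (weight u) * f u := by
  simp [entry3]

theorem form_entry3_le {d : ℕ → ℝ} {b : ℝ} (hb : ∀ m, 1 ≤ m → m + 2 ≤ n → d m ≤ b)
    (x : (Fin (2 * n) → Fin 2) → ℝ) :
    ∑ u, ∑ v, entry3 n d u v * x u * x v
      ≤ b * ∑ u, if 1 ≤ weight u ∧ weight u + 2 ≤ n ∨ n + 2 ≤ weight u ∧ weight u < 2 * n
        then x u ^ 2 else 0 := by
  rw [Finset.mul_sum]
  refine Finset.sum_le_sum fun u _ => ?_
  have : ∑ v, entry3 n d u v * x u * x v = x u * ∑ v, entry3 n d u v * x v := by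
    rw [Finset.mul_sum]
    exact Finset.sum_congr rfl fun v _ => by ring
  rw [this, sum_entry3_mul, diag3]
  by_cases h1 : 1 ≤ weight u ∧ weight u + 2 ≤ n
  · rw [if_pos h1, if_pos (Or.inl h1)]
    linarith [mul_le_mul_of_nonneg_right (hb _ h1.1 h1.2) (sq_nonneg (x u))]
  · by_cases h2 : n + 2 ≤ weight u ∧ weight u < 2 * n
    · rw [if_neg h1, if_pos h2, if_pos (Or.inr h2)]
      linarith [mul_le_mul_of_nonneg_right (hb (2 * n - weight u) (by omega) (by omega))
        (sq_nonneg (x u))]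
    · rw [if_neg h1, if_neg h2, if_neg (by tauto)]
      simp

end Components

/-! ### The entries of the strategy for GHZ-like states -/

section GHZ

variable {V : Type} [Fintype V] [DecidableEq V]

theorem tensorOp_mul (M M' : V → Matrix (Fin 2) (Fin 2) ℂ) :
    tensorOp M * tensorOp M' = tensorOp fun i => M i * M' i := by
  ext u v
  simp only [tensorOp, Matrix.mul_apply, Matrix.of_apply, ← Finset.prod_mul_distrib]
  rw [Finset.prod_univ_sum, Fintype.piFinset_univ]

theorem siteOp_apply (k : V) (M : Matrix (Fin 2) (Fin 2) ℂ) (u v : V → Fin 2) :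
    siteOp k M u v =
      (∏ i ∈ Finset.univ.erase k, (1 : Matrix (Fin 2) (Fin 2) ℂ) (u i) (v i)) * M (u k) (v k) := by
  simp only [siteOp, tensorOp, Matrix.of_apply]
  rw [← Finset.prod_erase_mul _ _ (Finset.mem_univ k)]
  congr 1
  · refine Finset.prod_congr rfl fun i hi => ?_
    rw [if_neg (Finset.ne_of_mem_erase hi)]
  · rw [if_pos rfl]

theorem siteOp_add (k : V) (M M' : Matrix (Fin 2) (Fin 2) ℂ) :
    siteOp k (M + M') = siteOp k M + siteOp k M' := by
  ext u v
  simp only [Matrix.add_apply, siteOp_apply, mul_add]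

theorem siteOp_smul (k : V) (c : ℂ) (M : Matrix (Fin 2) (Fin 2) ℂ) :
    siteOp k (c • M) = c • siteOp k M := by
  ext u v
  simp only [Matrix.smul_apply, siteOp_apply, smul_eq_mul]
  ring

theorem siteOp_diagonal (k : V) (d : Fin 2 → ℂ) (u v : V → Fin 2) :
    siteOp k (Matrix.diagonal d) u v = if u = v then d (u k) else 0 := by
  rw [siteOp_apply]
  split_ifs with h
  · subst h; simp
  · obtain ⟨i, hi⟩ := Function.ne_iff.1 h
    by_cases hik : i = k
    · subst hik
      simp [Matrix.diagonal_apply_ne _ hi]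
    · have h0 : ∏ j ∈ Finset.univ.erase k, (1 : Matrix (Fin 2) (Fin 2) ℂ) (u j) (v j) = 0 :=
        Finset.prod_eq_zero (i := i) (Finset.mem_erase.2 ⟨hik, Finset.mem_univ i⟩)
          (Matrix.one_apply_ne hi)
      rw [h0, zero_mul]

/-- The sum over the strings of even weight of a product function, by the character `(-1)^|r|`. -/
theorem sum_even_prod (g : V → Fin 2 → ℂ) :
    ∑ r ∈ Finset.univ.filter (fun r : V → Fin 2 => Even (∑ i, (r i : ℕ))), ∏ i, g i (r i)
      = (1 / 2) * (∏ i, (g i 0 + g i 1) + ∏ i, (g i 0 - g i 1)) := by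
  have h1 : ∏ i, (g i 0 + g i 1) = ∑ r : V → Fin 2, ∏ i, g i (r i) := by
    have := Finset.prod_univ_sum (fun _ : V => (Finset.univ : Finset (Fin 2))) g
    rw [Fintype.piFinset_univ] at this
    rw [← this]
    simp
  have h2 : ∏ i, (g i 0 - g i 1) = ∑ r : V → Fin 2, (-1) ^ (∑ i, (r i : ℕ)) * ∏ i, g i (r i) := by
    have := Finset.prod_univ_sum (fun _ : V => (Finset.univ : Finset (Fin 2)))
      fun i b => (-1) ^ (b : ℕ) * g i b
    rw [Fintype.piFinset_univ] at this
    simp_rw [← Finset.prod_pow_eq_pow_sum, ← Finset.prod_mul_distrib]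
    rw [← this]
    simp [sub_eq_add_neg]
  rw [h1, h2, ← Finset.sum_add_distrib, Finset.mul_sum, Finset.sum_filter]
  refine Finset.sum_congr rfl fun r _ => ?_
  split_ifs with h
  · rw [h.neg_one_pow]; ring
  · rw [(Nat.not_even_iff_odd.1 h).neg_one_pow]; ring

theorem card_even_strings [Nonempty V] :
    ((Finset.univ.filter (fun r : V → Fin 2 => Even (∑ i, (r i : ℕ)))).card : ℂ)
      = 2 ^ (Fintype.card V - 1) := by
  have h := sum_even_prod (V := V) fun _ _ => 1
  simp only [Finset.prod_const_one, Finset.sum_const, nsmul_eq_mul, mul_one, sub_self,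
    Finset.prod_const, Finset.card_univ, zero_pow (Fintype.card_ne_zero (α := V)), add_zero] at h
  rw [h]
  obtain ⟨m, hm⟩ := Nat.exists_eq_succ_of_ne_zero (Fintype.card_ne_zero (α := V))
  rw [hm, Nat.succ_sub_one, pow_succ]
  ring

/-- `S^b X (S†)^b` is `X` for `b = 0` and `Y` for `b = 1`. -/
theorem rotX_apply (b a c : Fin 2) :
    rotX b a c = if a = 0 ∧ c = 1 then (-Complex.I) ^ (b : ℕ)
      else if a = 1 ∧ c = 0 then Complex.I ^ (b : ℕ) else 0 := by
  fin_cases b <;> fin_cases a <;> fin_cases c <;>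
    simp [rotX, phaseS, pauliX, Matrix.mul_apply, Matrix.conjTranspose_apply, Fin.sum_univ_two]

/-- The sum over `r` in the GHZ-like strategy only leaves the coherence between `0…0` and `1…1`:
the phase `(-1)^{|r|/2} = i^{|r|}` is a product over the qubits, and `X ± iY` are the
raising and lowering operators. -/
theorem sum_even_tensorOp_rotX (k : V) {l : Fin 2 → ℝ} (a b : V → Fin 2) :
    ∑ r ∈ Finset.univ.filter (fun r : V → Fin 2 => Even (∑ i, (r i : ℕ))),
      (-1 : ℂ) ^ ((∑ i, (r i : ℕ)) / 2) *
        tensorOp (fun i => if i = k then filterF l * rotX (r i) * filterF l else rotX (r i)) a b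
      = 2 ^ Fintype.card V * (((Real.sqrt (l 0) * Real.sqrt (l 1) : ℝ) : ℂ)) *
        ((if (∀ i, a i = 0 ∧ b i = 1) then 1 else 0) +
          if (∀ i, a i = 1 ∧ b i = 0) then 1 else 0) := by
  set c : ℂ := ((Real.sqrt 2 * Real.sqrt (l 0) * (Real.sqrt 2 * Real.sqrt (l 1)) : ℝ) : ℂ) with hc
  -- `rotX` is off-diagonal, so that the filter only contributes the scalar `c`
  have hF : ∀ x y z : Fin 2, (filterF l * rotX x * filterF l) y z = c * rotX x y z := by
    intro x y z
    simp only [filterF, Matrix.mul_diagonal, Matrix.diagonal_mul, rotX_apply, hc]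
    fin_cases y <;> fin_cases z <;> simp <;> ring
  have hterm : ∀ r ∈ Finset.univ.filter (fun r : V → Fin 2 => Even (∑ i, (r i : ℕ))),
      (-1 : ℂ) ^ ((∑ i, (r i : ℕ)) / 2) *
        tensorOp (fun i => if i = k then filterF l * rotX (r i) * filterF l else rotX (r i)) a b
      = ∏ i, ((if i = k then c else 1) * (Complex.I ^ (r i : ℕ) * rotX (r i) (a i) (b i))) := by
    intro r hr
    obtain ⟨m, hm⟩ := (Finset.mem_filter.1 hr).2
    have h1 : (-1 : ℂ) ^ ((∑ i, (r i : ℕ)) / 2) = ∏ i, Complex.I ^ (r i : ℕ) := by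
      rw [Finset.prod_pow_eq_pow_sum, hm, ← two_mul, Nat.mul_div_cancel_left _ two_pos, pow_mul,
        Complex.I_sq]
    rw [h1, tensorOp, Matrix.of_apply, ← Finset.prod_mul_distrib]
    refine Finset.prod_congr rfl fun i _ => ?_
    by_cases hik : i = k
    · rw [if_pos hik, if_pos hik, hF]; ring
    · rw [if_neg hik, if_neg hik]; ring
  rw [Finset.sum_congr rfl hterm, sum_even_prod fun i x =>
    (if i = k then c else 1) * (Complex.I ^ (x : ℕ) * rotX x (a i) (b i))]
  have hplus : ∀ i, (if i = k then c else 1) * (Complex.I ^ ((0 : Fin 2) : ℕ) * rotX 0 (a i) (b i))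
      + (if i = k then c else 1) * (Complex.I ^ ((1 : Fin 2) : ℕ) * rotX 1 (a i) (b i))
      = (if i = k then c else 1) * (2 * if a i = 0 ∧ b i = 1 then 1 else 0) := by
    intro i
    rw [← mul_add, rotX_apply, rotX_apply]
    congr 1
    rcases fin2_eq_zero_or_one (a i) with h | h <;> rcases fin2_eq_zero_or_one (b i) with h' | h' <;>
      (simp [h, h']; try norm_num)
  have hminus : ∀ i, (if i = k then c else 1) * (Complex.I ^ ((0 : Fin 2) : ℕ) * rotX 0 (a i) (b i))
      - (if i = k then c else 1) * (Complex.I ^ ((1 : Fin 2) : ℕ) * rotX 1 (a i) (b i))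
      = (if i = k then c else 1) * (2 * if a i = 1 ∧ b i = 0 then 1 else 0) := by
    intro i
    rw [← mul_sub, rotX_apply, rotX_apply]
    congr 1
    rcases fin2_eq_zero_or_one (a i) with h | h <;> rcases fin2_eq_zero_or_one (b i) with h' | h' <;>
      (simp [h, h']; try norm_num)
  simp_rw [hplus, hminus, Finset.prod_mul_distrib, Finset.prod_ite_eq', Finset.prod_ite_zero]
  simp only [Finset.mem_univ, if_true, Finset.prod_const, Finset.card_univ, one_pow, forall_const,
    hc]
  have h2 : (Real.sqrt 2 : ℂ) * Real.sqrt 2 = 2 := by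
    rw [← Complex.ofReal_mul, Real.mul_self_sqrt (by norm_num)]; norm_num
  push_cast
  linear_combination (1 / 2 * (Real.sqrt (l 0) : ℂ) * (Real.sqrt (l 1)) * 2 ^ Fintype.card V *
    ((if (∀ i, a i = 0 ∧ b i = 1) then 1 else 0) +
          if (∀ i, a i = 1 ∧ b i = 0) then 1 else 0)) * h2

/-- The entries of the strategy for GHZ-like states: the agreement of all outcomes in the `Z` basis,
the diagonal, and the coherence between `0…0` and `1…1`. -/
noncomputable def ghzEntry (p : ℝ) (l : Fin 2 → ℝ) (a b : V → Fin 2) : ℝ :=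
  p * ((if (∀ i, a i = 0 ∧ b i = 0) then 1 else 0) + if (∀ i, a i = 1 ∧ b i = 1) then 1 else 0) +
  (1 - p) / Fintype.card V * (if a = b then ∑ k, l (a k) else 0) +
  (1 - p) * (Real.sqrt (l 0) * Real.sqrt (l 1)) *
    ((if (∀ i, a i = 0 ∧ b i = 1) then 1 else 0) + if (∀ i, a i = 1 ∧ b i = 0) then 1 else 0)

theorem ghzStrategy_apply [Nonempty V] (p : ℝ) {l : Fin 2 → ℝ} (hl : ∀ z, 0 ≤ l z)
    (a b : V → Fin 2) : ghzStrategy V p l a b = (ghzEntry p l a b : ℂ) := by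
  have hFF : filterF l * filterF l = Matrix.diagonal fun z => ((2 * l z : ℝ) : ℂ) := by
    rw [filterF, Matrix.diagonal_mul_diagonal]
    congr 1
    ext z
    rw [← Complex.ofReal_mul]
    congr 1
    rw [mul_mul_mul_comm, Real.mul_self_sqrt (by norm_num), Real.mul_self_sqrt (hl z)]
  have hsite : ∀ (k : V) (c : ℂ) (R : Matrix (Fin 2) (Fin 2) ℂ),
      siteOp k (filterF l * ((1 / 2 : ℂ) • (1 + c • R)) * filterF l)
        = (1 / 2 : ℂ) • (siteOp k (filterF l * filterF l)
          + c • siteOp k (filterF l * R * filterF l)) := by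
    intro k c R
    rw [← siteOp_smul, ← siteOp_add, ← siteOp_smul]
    congr 1
    simp only [mul_add, add_mul, Matrix.mul_smul, Matrix.smul_mul, mul_one]
  -- summing over the outcome `o` cancels the terms that are linear in the sign `(-1)^o`
  have hsumo : ∀ (k : V) (r : V → Fin 2), ∑ o : Fin 2,
      ((1 / 2 : ℂ) • (1 + ((-1 : ℂ) ^ (o : ℕ)) •
            tensorOp (fun i => if i = k then 1 else rotX (r i)))) *
        siteOp k (filterF l *
          ((1 / 2 : ℂ) • (1 + ((-1 : ℂ) ^ ((o : ℕ) + (∑ i, (r i : ℕ)) / 2)) • rotX (r k))) *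
          filterF l)
      = (1 / 2 : ℂ) • (siteOp k (filterF l * filterF l) + ((-1 : ℂ) ^ ((∑ i, (r i : ℕ)) / 2)) •
        tensorOp (fun i => if i = k then filterF l * rotX (r i) * filterF l else rotX (r i))) := by
    intro k r
    have hprod : tensorOp (fun i => if i = k then filterF l * rotX (r i) * filterF l else rotX (r i))
        = tensorOp (fun i => if i = k then 1 else rotX (r i)) *
          siteOp k (filterF l * rotX (r k) * filterF l) := by
      rw [siteOp, tensorOp_mul]
      congr 1
      ext1 i
      by_cases h : i = k
      · subst h; simp
      · simp [h]
    rw [Fin.sum_univ_two, hsite, hsite, hprod]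
    simp only [Fin.val_zero, Fin.val_one, pow_zero, pow_one, pow_add, zero_add, one_smul, one_mul,
      neg_smul, neg_mul, Matrix.smul_mul, Matrix.mul_smul, add_mul, mul_add, mul_neg, smul_add,
      smul_neg]
    module
  have hN : (Fintype.card V : ℂ) ≠ 0 := by exact_mod_cast Fintype.card_ne_zero
  have hk : ∀ k : V, ((1 / 2 ^ (Fintype.card V - 1) : ℂ) • ∑ o : Fin 2,
      ∑ r ∈ Finset.univ.filter (fun r : V → Fin 2 => Even (∑ i, (r i : ℕ))),
        ((1 / 2 : ℂ) • (1 + ((-1 : ℂ) ^ (o : ℕ)) •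
            tensorOp (fun i => if i = k then 1 else rotX (r i)))) *
        siteOp k (filterF l *
          ((1 / 2 : ℂ) • (1 + ((-1 : ℂ) ^ ((o : ℕ) + (∑ i, (r i : ℕ)) / 2)) • rotX (r k))) *
          filterF l)) a b
      = (if a = b then (l (a k) : ℂ) else 0) + ((Real.sqrt (l 0) * Real.sqrt (l 1) : ℝ) : ℂ) *
        ((if (∀ i, a i = 0 ∧ b i = 1) then 1 else 0) +
          if (∀ i, a i = 1 ∧ b i = 0) then 1 else 0) := by
    intro k
    rw [Finset.sum_comm]
    simp_rw [hsumo, Matrix.smul_apply, Matrix.sum_apply, Matrix.smul_apply, Matrix.add_apply,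
      Matrix.smul_apply, smul_eq_mul]
    rw [← Finset.mul_sum, Finset.sum_add_distrib, sum_even_tensorOp_rotX, Finset.sum_const,
      nsmul_eq_mul, card_even_strings, hFF, siteOp_diagonal]
    obtain ⟨m, hm⟩ := Nat.exists_eq_succ_of_ne_zero (Fintype.card_ne_zero (α := V))
    rw [hm, Nat.succ_sub_one, pow_succ]
    have h2 : (2 : ℂ) ^ m ≠ 0 := pow_ne_zero _ two_ne_zero
    by_cases hab : a = b
    · simp only [if_pos hab]
      push_cast
      field_simp
    · simp only [if_neg hab]
      push_cast
      field_simp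
      ring
  have hz : ∀ z : Fin 2, tensorOp (fun _ : V => Matrix.single z z (1 : ℂ)) a b
      = if (∀ i, a i = z ∧ b i = z) then 1 else 0 := by
    intro z
    simp only [tensorOp, Matrix.of_apply, Matrix.single_apply]
    rw [Finset.prod_ite_zero]
    simp [eq_comm]
  unfold ghzStrategy
  rw [Matrix.add_apply, Matrix.smul_apply, Matrix.smul_apply, Matrix.sum_apply, Matrix.sum_apply,
    Fin.sum_univ_two, hz, hz, Finset.sum_congr rfl fun k _ => hk k, Finset.sum_add_distrib,
    Finset.sum_const, Finset.card_univ, ghzEntry, nsmul_eq_mul, smul_eq_mul, smul_eq_mul]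
  have hif : ∑ k, (if a = b then (l (a k) : ℂ) else 0)
      = ((if a = b then ∑ k, l (a k) else 0 : ℝ) : ℂ) := by
    split_ifs <;> simp
  rw [hif]
  push_cast [apply_ite Complex.ofReal]
  field_simp
  ring

end GHZ

/-! ### The entries of the strategy for Dicke states -/

section Dicke

variable {V : Type} [Fintype V] [DecidableEq V]

theorem siteOp_pauliZ (k : V) :
    siteOp k pauliZ = Matrix.diagonal fun u : V → Fin 2 => (-1 : ℂ) ^ (u k : ℕ) := by
  have h : pauliZ = Matrix.diagonal fun b : Fin 2 => (-1 : ℂ) ^ (b : ℕ) := by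
    ext i j
    fin_cases i <;> fin_cases j <;> simp [pauliZ]
  ext u v
  rw [h, siteOp_diagonal, Matrix.diagonal_apply]

theorem plusProj_pauliZ (k : V) :
    plusProj (siteOp k pauliZ) = Matrix.diagonal fun u => if u k = 0 then (1 : ℂ) else 0 := by
  ext u v
  rw [plusProj, siteOp_pauliZ]
  by_cases h : u = v
  · subst h
    rcases fin2_eq_zero_or_one (u k) with h | h <;> norm_num [h]
  · simp [h]

theorem minusProj_pauliZ (k : V) :
    minusProj (siteOp k pauliZ) = Matrix.diagonal fun u => if u k = 1 then (1 : ℂ) else 0 := by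
  ext u v
  rw [minusProj, siteOp_pauliZ]
  by_cases h : u = v
  · subst h
    rcases fin2_eq_zero_or_one (u k) with h | h <;> norm_num [h]
  · simp [h]

/-- `X ⊗ X` on the qubits `x` and `y` flips the two bits. -/
theorem siteOp_pauliX_mul_apply {x y : V} (hxy : x ≠ y) (u v : V → Fin 2) :
    (siteOp x pauliX * siteOp y pauliX) u v = if v = flipOn {x, y} u then 1 else 0 := by
  have h : ∀ i, ((if i = x then pauliX else 1) * (if i = y then pauliX else 1) :
      Matrix (Fin 2) (Fin 2) ℂ) (u i) (v i) = if v i = flipOn {x, y} u i then 1 else 0 := by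
    intro i
    by_cases h1 : i = x
    · have h2 : i ≠ y := fun h => hxy (h1 ▸ h)
      rw [if_pos h1, if_neg h2, mul_one]
      simp only [flipOn, h1, Finset.mem_insert, true_or, if_true]
      generalize u x = a
      generalize v x = b
      fin_cases a <;> fin_cases b <;> simp [pauliX]
    · by_cases h2 : i = y
      · rw [if_neg h1, if_pos h2, one_mul]
        simp only [flipOn, h2, Finset.mem_insert, Finset.mem_singleton, or_true, if_true]
        generalize u y = a
        generalize v y = b
        fin_cases a <;> fin_cases b <;> simp [pauliX]
      · rw [if_neg h1, if_neg h2, one_mul]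
        simp only [flipOn, h1, h2, Finset.mem_insert, Finset.mem_singleton, or_self, if_false]
        rw [Matrix.one_apply]
        simp [eq_comm]
  rw [siteOp, siteOp, tensorOp_mul, tensorOp, Matrix.of_apply, Finset.prod_congr rfl fun i _ => h i,
    Finset.prod_ite_zero]
  simp [funext_iff]

theorem card_filter_compl_pair {x y : V} (hxy : x ≠ y) (u : V → Fin 2) :
    (((({x, y}ᶜ : Finset V).filter fun i => u i = 1).card : ℕ) : ℤ)
      = weight u - (u x : ℕ) - (u y : ℕ) := by
  have h1 : ∀ s : Finset V, (s.filter fun i => u i = 1).card = ∑ i ∈ s, (u i : ℕ) := by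
    intro s
    rw [Finset.card_filter]
    refine Finset.sum_congr rfl fun i _ => ?_
    rcases fin2_eq_zero_or_one (u i) with h | h <;> simp [h]
  have h2 := Finset.sum_add_sum_compl ({x, y} : Finset V) fun i => (u i : ℕ)
  rw [Finset.sum_pair hxy, ← weight_eq_sum] at h2
  rw [h1]
  omega

/-- The entries of the operator measured on the pair `x`, `y` of qubits in the Dicke strategy with
`k` excitations. -/
noncomputable def pairEntry (k : ℤ) (x y : V) (a b : V → Fin 2) : ℝ :=
  (if a = b then
    (if (weight a : ℤ) - (a x : ℕ) - (a y : ℕ) = k ∧ a x = 0 ∧ a y = 0 then 1 else 0) +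
    (if (weight a : ℤ) - (a x : ℕ) - (a y : ℕ) = k - 2 ∧ a x = 1 ∧ a y = 1 then 1 else 0) +
    1 / 2 * (if (weight a : ℤ) - (a x : ℕ) - (a y : ℕ) = k - 1 then 1 else 0) else 0) +
  1 / 2 * (if b = flipOn {x, y} a ∧ (weight a : ℤ) - (a x : ℕ) - (a y : ℕ) = k - 1 then 1 else 0)

theorem dickeStrategy_apply {V : Type} [Fintype V] [LinearOrder V] (k : ℤ) (a b : V → Fin 2) :
    dickeStrategy V k a b = (((1 / ((Fintype.card V).choose 2 : ℝ)) *
      ∑ x ∈ Finset.univ.filter (fun x : V × V => x.1 < x.2), pairEntry k x.1 x.2 a b : ℝ) : ℂ) := by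
  rw [dickeStrategy, Matrix.smul_apply, Matrix.sum_apply, smul_eq_mul]
  push_cast
  congr 1
  refine Finset.sum_congr rfl fun x hx => ?_
  have hxy : x.1 ≠ x.2 := (Finset.mem_filter.1 hx).2.ne
  simp only [plusProj_pauliZ, minusProj_pauliZ, weightProj, Matrix.diagonal_mul_diagonal,
    Matrix.add_apply, Matrix.diagonal_mul, card_filter_compl_pair hxy]
  rw [plusProj, Matrix.smul_apply, Matrix.add_apply, siteOp_pauliX_mul_apply hxy,
    Matrix.diagonal_apply, Matrix.diagonal_apply, Matrix.one_apply, pairEntry]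
  have hmul : ∀ (P Q : Prop) [Decidable P] [Decidable Q],
      (if P then (1 : ℂ) else 0) * (if Q then 1 else 0) = if P ∧ Q then 1 else 0 := by
    intro P Q _ _
    rw [ite_and, ite_mul, one_mul, zero_mul]
  have hcomm : ∀ P : Prop, (P ∧ (weight a : ℤ) - (a x.1 : ℕ) - (a x.2 : ℕ) = k - 1)
      ↔ ((weight a : ℤ) - (a x.1 : ℕ) - (a x.2 : ℕ) = k - 1 ∧ P) := fun P => and_comm
  simp only [hmul, and_assoc, hcomm, smul_eq_mul]
  rw [mul_left_comm, mul_add, hmul, hmul]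
  by_cases hab : a = b
  · simp only [and_true, hab]
    push_cast [apply_ite Complex.ofReal]
    ring
  · simp only [hab, and_false, if_false]
    push_cast [apply_ite Complex.ofReal]
    ring

theorem val_add_val_le_weight {x y : V} (hxy : x ≠ y) (a : V → Fin 2) :
    (a x : ℕ) + (a y : ℕ) ≤ weight a := by
  rw [weight_eq_sum, ← Finset.sum_pair (f := fun i => (a i : ℕ)) hxy]
  exact Finset.sum_le_univ_sum_of_nonneg fun _ => Nat.zero_le _

theorem weight_add_two_le {x y : V} (hxy : x ≠ y) (a : V → Fin 2) :
    weight a + 2 ≤ Fintype.card V + (a x : ℕ) + (a y : ℕ) := by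
  have h1 := val_add_val_le_weight hxy (flipAll a)
  have h2 := weight_flipAll a
  have hb : ∀ b : Fin 2, ((b + 1 : Fin 2) : ℕ) + (b : ℕ) = 1 := by decide
  have h3 := hb (a x)
  have h4 := hb (a y)
  simp only [flipAll] at h1 h2
  omega

/-- If all qubits are to be excited, the operators of the Dicke strategy all reduce to the projector
onto `|1…1⟩`. -/
theorem pairEntry_card {x y : V} (hxy : x ≠ y) (a b : V → Fin 2) :
    pairEntry (Fintype.card V) x y a b = if (∀ i, a i = 1 ∧ b i = 1) then 1 else 0 := by
  have h1 := weight_add_two_le hxy a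
  have h2 := weight_le_card a
  have h3 : (∀ i, a i = 1 ∧ b i = 1) ↔ a = b ∧ weight a = Fintype.card V := by
    rw [weight_eq_card_iff]
    simp only [forall_and, funext_iff]
    exact ⟨fun h => ⟨fun i => by rw [h.1 i, h.2 i], h.1⟩, fun h => ⟨h.2, fun i => by
      rw [← h.1 i, h.2 i]⟩⟩
  have h4 : weight a = Fintype.card V → a x = 1 ∧ a y = 1 := by
    rw [weight_eq_card_iff]
    rintro rfl
    exact ⟨rfl, rfl⟩
  have h5 : ¬ ((weight a : ℤ) - (a x : ℕ) - (a y : ℕ) = Fintype.card V - 1) := by omega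
  have h6 : ¬ ((weight a : ℤ) - (a x : ℕ) - (a y : ℕ) = Fintype.card V ∧ a x = 0 ∧ a y = 0) := by
    rintro ⟨h, hx, hy⟩
    rw [hx, hy] at h h1
    simp at h h1
    omega
  have h7 : ((weight a : ℤ) - (a x : ℕ) - (a y : ℕ) = Fintype.card V - 2 ∧ a x = 1 ∧ a y = 1)
      ↔ weight a = Fintype.card V := by
    constructor
    · rintro ⟨h, hx, hy⟩
      rw [hx, hy] at h
      simp at h
      omega
    · intro h
      obtain ⟨hx, hy⟩ := h4 h
      refine ⟨?_, hx, hy⟩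
      rw [hx, hy, h]
      simp
      ring
  rw [pairEntry, if_congr h3 rfl rfl]
  simp only [h5, h6, h7, if_false, and_false, mul_zero, add_zero, zero_add]
  rw [ite_and]

/-- If no qubit is to be excited, the operators of the Dicke strategy all reduce to the projector
onto `|0…0⟩`. -/
theorem pairEntry_zero {x y : V} (hxy : x ≠ y) (a b : V → Fin 2) :
    pairEntry 0 x y a b = if (∀ i, a i = 0 ∧ b i = 0) then 1 else 0 := by
  have h1 := val_add_val_le_weight hxy a
  have h3 : (∀ i, a i = 0 ∧ b i = 0) ↔ a = b ∧ weight a = 0 := by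
    rw [weight_eq_zero_iff]
    simp only [forall_and, funext_iff]
    exact ⟨fun h => ⟨fun i => by rw [h.1 i, h.2 i], h.1⟩, fun h => ⟨h.2, fun i => by
      rw [← h.1 i, h.2 i]⟩⟩
  have h4 : weight a = 0 → a x = 0 ∧ a y = 0 := by
    rw [weight_eq_zero_iff]
    rintro rfl
    exact ⟨rfl, rfl⟩
  have h5 : ¬ ((weight a : ℤ) - (a x : ℕ) - (a y : ℕ) = 0 - 1) := by omega
  have h6 : ¬ ((weight a : ℤ) - (a x : ℕ) - (a y : ℕ) = 0 - 2 ∧ a x = 1 ∧ a y = 1) := by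
    rintro ⟨h, -, -⟩
    omega
  have h7 : ((weight a : ℤ) - (a x : ℕ) - (a y : ℕ) = 0 ∧ a x = 0 ∧ a y = 0)
      ↔ weight a = 0 := by
    constructor
    · rintro ⟨h, hx, hy⟩
      rw [hx, hy] at h
      simpa using h
    · intro h
      obtain ⟨hx, hy⟩ := h4 h
      refine ⟨?_, hx, hy⟩
      rw [hx, hy, h]
      simp
  rw [pairEntry, if_congr h3 rfl rfl]
  simp only [h5, h6, h7, if_false, and_false, mul_zero, add_zero]
  rw [ite_and]

end Dicke

/-! ### The strategy conditioned on the first measurements -/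

section Restriction

variable {V : Type} [Fintype V] [DecidableEq V]

/-- The restriction of a bit string to the complement of `R`. -/
def restrict {V : Type} [Fintype V] [DecidableEq V] (R : Finset V) (u : V → Fin 2) :
    (Rᶜ : Finset V) → Fin 2 := fun i => u i

theorem weight_restrict (R : Finset V) (u : V → Fin 2) :
    (R.filter fun i => u i = 1).card + weight (restrict R u) = weight u := by
  have h1 : (R.filter fun i => u i = 1).card = ∑ i ∈ R, (u i : ℕ) := by
    rw [Finset.card_filter]
    refine Finset.sum_congr rfl fun i _ => ?_
    rcases fin2_eq_zero_or_one (u i) with h | h <;> simp [h]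
  rw [h1, weight_eq_sum, weight_eq_sum, ← Finset.sum_add_sum_compl R]
  congr 1
  exact Finset.sum_coe_sort Rᶜ fun i => (u i : ℕ)

theorem restrict_eq_iff {R : Finset V} {u v : V → Fin 2} (h : ∀ i ∈ R, u i = v i) :
    restrict R u = restrict R v ↔ u = v := by
  constructor
  · intro h1
    ext1 i
    by_cases hi : i ∈ R
    · exact h i hi
    · exact congrFun h1 ⟨i, Finset.mem_compl.2 hi⟩
  · rintro rfl
    rfl

theorem restrict_flipOn (R : Finset V) (u : V → Fin 2) (x y : (Rᶜ : Finset V)) :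
    restrict R (flipOn {(x : V), (y : V)} u) = flipOn {x, y} (restrict R u) := by
  ext1 i
  have h : i ∈ ({x, y} : Finset (Rᶜ : Finset V)) ↔ (i : V) ∈ ({(x : V), (y : V)} : Finset V) := by
    rw [Finset.mem_insert, Finset.mem_insert, Finset.mem_singleton, Finset.mem_singleton,
      Subtype.ext_iff, Subtype.ext_iff]
  rw [restrict, flipOn, flipOn, if_congr h rfl rfl]
  rfl

theorem restrict_eq_flipOn_iff {R : Finset V} {u v : V → Fin 2} (h : ∀ i ∈ R, u i = v i)
    (x y : (Rᶜ : Finset V)) :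
    restrict R v = flipOn {x, y} (restrict R u) ↔ v = flipOn {(x : V), (y : V)} u := by
  rw [← restrict_flipOn, restrict_eq_iff]
  intro i hi
  have hx : i ≠ x := fun h => (Finset.mem_compl.1 x.2) (h ▸ hi)
  have hy : i ≠ y := fun h => (Finset.mem_compl.1 y.2) (h ▸ hi)
  simp [flipOn, hx, hy, h i hi]

/-- The Dicke strategy on the complement of `R` asks for `n` excitations in total, whatever has been
found on `R`: its operators do not depend on `R`. -/
theorem pairEntry_restrict {R : Finset V} {u v : V → Fin 2} (h : ∀ i ∈ R, u i = v i)
    (n : ℤ) (x y : (Rᶜ : Finset V)) :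
    pairEntry (n - (R.filter fun i => u i = 1).card) x y (restrict R u) (restrict R v)
      = pairEntry n (x : V) (y : V) u v := by
  have hw := weight_restrict R u
  have hk : ∀ c : ℤ, ((weight (restrict R u) : ℤ) - (restrict R u x : ℕ) - (restrict R u y : ℕ)
      = n - (R.filter fun i => u i = 1).card - c)
      ↔ ((weight u : ℤ) - (u x : ℕ) - (u y : ℕ) = n - c) := by
    intro c
    have hx : restrict R u x = u x := rfl
    have hy : restrict R u y = u y := rfl
    rw [hx, hy]
    omega
  have hk0 := hk 0
  rw [sub_zero, sub_zero] at hk0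
  have hx : restrict R u x = u x := rfl
  have hy : restrict R u y = u y := rfl
  simp only [pairEntry, hk, hk0, restrict_eq_iff h, restrict_eq_flipOn_iff h]
  rw [hx, hy]

/-- The operators on pairs outside `R` do not change the bits in `R`. -/
theorem pairEntry_eq_zero {R : Finset V} {u v : V → Fin 2} (h : ¬ ∀ i ∈ R, u i = v i)
    (n : ℤ) {x y : V} (hx : x ∉ R) (hy : y ∉ R) : pairEntry n x y u v = 0 := by
  have h1 : u ≠ v := by
    rintro rfl
    exact h fun _ _ => rfl
  have h2 : v ≠ flipOn {x, y} u := by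
    rintro rfl
    refine h fun i hi => ?_
    have hx : i ≠ x := fun h => hx (h ▸ hi)
    have hy : i ≠ y := fun h => hy (h ▸ hi)
    simp [flipOn, hx, hy]
  simp [pairEntry, h1, h2]

theorem weightProj_mul_onQubits_apply (R : Finset V) (m : ℤ) (M : Op (Rᶜ : Finset V))
    (u v : V → Fin 2) :
    (weightProj R m * onQubits Rᶜ M) u v =
      if ((R.filter fun i => u i = 1).card : ℤ) = m then
        (if ∀ i ∈ R, u i = v i then M (restrict R u) (restrict R v) else 0) else 0 := by
  rw [weightProj, Matrix.diagonal_mul, onQubits, Matrix.of_apply, ite_mul, one_mul, zero_mul]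
  simp only [Finset.mem_compl, not_not]
  rfl

theorem sum_pairs_restrict {V : Type} [Fintype V] [LinearOrder V] (R : Finset V) (F : V → V → ℝ) :
    ∑ x ∈ Finset.univ.filter (fun x : (Rᶜ : Finset V) × (Rᶜ : Finset V) => x.1 < x.2),
      F x.1 x.2 = ∑ x ∈ Finset.univ.filter (fun x : V × V => x.1 < x.2),
        if x.1 ∉ R ∧ x.2 ∉ R then F x.1 x.2 else 0 := by
  rw [Finset.sum_filter, Finset.sum_filter, ← Finset.univ_product_univ, ← Finset.univ_product_univ,
    Finset.sum_product, Finset.sum_product]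
  simp only [← Subtype.coe_lt_coe]
  rw [Finset.sum_coe_sort Rᶜ fun x => ∑ y : (Rᶜ : Finset V), if x < (y : V) then F x y else 0]
  rw [← Finset.sum_filter_add_sum_filter_not Finset.univ (fun x => x ∉ R)
    fun x => ∑ y, if x < y then if x ∉ R ∧ y ∉ R then F x y else 0 else 0]
  rw [Finset.sum_eq_zero (s := Finset.univ.filter fun x => ¬ x ∉ R), add_zero]
  · refine Finset.sum_congr (by ext; simp) fun x hx => ?_
    have hx' : x ∉ R := (Finset.mem_filter.1 hx).2
    rw [Finset.sum_coe_sort Rᶜ fun y => if x < y then F x y else 0]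
    rw [← Finset.sum_filter_add_sum_filter_not Finset.univ (fun y => y ∉ R)
      fun y => if x < y then if x ∉ R ∧ y ∉ R then F x y else 0 else 0]
    rw [Finset.sum_eq_zero (s := Finset.univ.filter fun y => ¬ y ∉ R), add_zero]
    · refine Finset.sum_congr (by ext; simp) fun y hy => ?_
      have hy' : y ∉ R := (Finset.mem_filter.1 hy).2
      simp [hx', hy']
    · intro y hy
      simp [(Finset.mem_filter.1 hy).2]
  · intro x hx
    refine Finset.sum_eq_zero fun y _ => ?_
    simp [(Finset.mem_filter.1 hx).2]

end Restriction

section StrategyR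

variable {n : ℕ}

/-- Exchanging the two weights of a GHZ-like state amounts to flipping all bits. -/
theorem ghzEntry_one_sub {V : Type} [Fintype V] [DecidableEq V] (p : ℝ) {l : Fin 2 → ℝ}
    (hl : l 0 + l 1 = 1) (a b : V → Fin 2) :
    ghzEntry p (1 - l) a b = ghzEntry p l (flipAll a) (flipAll b) := by
  have h0 : (1 - l) 0 = l 1 := by simp; linarith
  have h1 : (1 - l) 1 = l 0 := by simp; linarith
  have hf : ∀ b : Fin 2, (1 - l) b = l (b + 1) := by
    intro b
    rcases fin2_eq_zero_or_one b with rfl | rfl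
    · exact h0
    · exact h1
  have e0 : ∀ b : Fin 2, b + 1 = 0 ↔ b = 1 := by decide
  have e1 : ∀ b : Fin 2, b + 1 = 1 ↔ b = 0 := by decide
  have heq : flipAll a = flipAll b ↔ a = b := flipAll_involutive.injective.eq_iff
  simp only [ghzEntry, heq]
  rw [h0, h1]
  simp only [flipAll, e0, e1, hf]
  ring

theorem card_filter_flipAll {V : Type} (R : Finset V) (u : V → Fin 2) :
    (R.filter fun i => flipAll u i = 1).card + (R.filter fun i => u i = 1).card = R.card := by
  have e1 : ∀ b : Fin 2, b + 1 = 1 ↔ ¬ b = 1 := by decide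
  simp only [flipAll, e1]
  rw [add_comm]
  exact Finset.card_filter_add_card_filter_not _

/-- The excess of the GHZ-like strategy over the Dicke strategy with `n` excitations, which is the
projector onto `|1…1⟩`, when all qubits of `R` are found in `|0⟩`. -/
noncomputable def ghzPart (n : ℕ) (p : ℝ) (l : Fin 2 → ℝ) (R : Finset (Fin (2 * n)))
    (u v : Fin (2 * n) → Fin 2) : ℝ :=
  if (R.filter fun i => u i = 1).card = 0 ∧ ∀ i ∈ R, u i = v i then
    ghzEntry p l (restrict R u) (restrict R v) -
      if (∀ i, restrict R u i = 1 ∧ restrict R v i = 1) then 1 else 0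
  else 0

/-- The entries of the conditional strategy. The Dicke strategy is extended to all outcomes on `R`;
where the GHZ-like strategy is run instead, the difference is `ghzPart`, for the strings
themselves or for the flipped strings. -/
theorem strategyR_apply (hn : 2 ≤ n) (p : ℝ) {l : Fin 2 → ℝ} (hl0 : 0 ≤ l 0) (hl1 : 0 ≤ l 1)
    (hl : l 0 + l 1 = 1) {R : Finset (Fin (2 * n))} (hR : R.card = n)
    (u v : Fin (2 * n) → Fin 2) :
    strategyR n p l R u v = ((1 / (n.choose 2 : ℝ) *
      (∑ x ∈ Finset.univ.filter (fun x : Fin (2 * n) × Fin (2 * n) => x.1 < x.2),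
        if x.1 ∉ R ∧ x.2 ∉ R then pairEntry n x.1 x.2 u v else 0) +
      (ghzPart n p l R u v + ghzPart n p l R (flipAll u) (flipAll v)) : ℝ) : ℂ) := by
  have hcard : Fintype.card (Rᶜ : Finset (Fin (2 * n))) = n := by
    rw [Fintype.card_coe, Finset.card_compl, Fintype.card_fin, hR]; omega
  have hne : Nonempty (Rᶜ : Finset (Fin (2 * n))) := by
    rw [← Fintype.card_pos_iff, hcard]; omega
  have hlz : ∀ z, 0 ≤ l z := by
    intro z
    rcases fin2_eq_zero_or_one z with rfl | rfl <;> assumption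
  have hlz' : ∀ z, 0 ≤ (1 - l) z := by
    intro z
    rcases fin2_eq_zero_or_one z with rfl | rfl <;> simp <;> linarith
  have hflip := card_filter_flipAll R u
  rw [hR] at hflip
  have hagree : (∀ i ∈ R, flipAll u i = flipAll v i) ↔ ∀ i ∈ R, u i = v i := by
    simp only [flipAll, add_left_inj]
  rw [strategyR, Matrix.add_apply, Matrix.add_apply, Matrix.sum_apply]
  simp only [weightProj_mul_onQubits_apply]
  by_cases hag : ∀ i ∈ R, u i = v i
  · have hpairs := sum_pairs_restrict R fun x y => pairEntry (n : ℤ) x y u v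
    have hpairs' : ∑ x ∈ Finset.univ.filter
          (fun x : (Rᶜ : Finset (Fin (2 * n))) × (Rᶜ : Finset (Fin (2 * n))) => x.1 < x.2),
          pairEntry ((n : ℤ) - (R.filter fun i => u i = 1).card) x.1 x.2 (restrict R u)
            (restrict R v)
        = ∑ x ∈ Finset.univ.filter (fun x : Fin (2 * n) × Fin (2 * n) => x.1 < x.2),
          if x.1 ∉ R ∧ x.2 ∉ R then pairEntry n x.1 x.2 u v else 0 := by
      rw [← hpairs]
      exact Finset.sum_congr rfl fun x _ => pairEntry_restrict hag n x.1 x.2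
    have hcount : ((Finset.univ.filter
          (fun x : (Rᶜ : Finset (Fin (2 * n))) × (Rᶜ : Finset (Fin (2 * n))) => x.1 < x.2)).card
          : ℝ) = n.choose 2 := by
      have h := sum_pairs_polynomial (V := (Rᶜ : Finset (Fin (2 * n)))) (fun _ => 0) 1 0 0
      simp only [zero_mul, add_zero, Finset.sum_const, nsmul_eq_mul, mul_one, one_mul] at h
      rw [h, hcard, Nat.cast_choose_two]
    have hch : (n.choose 2 : ℝ) ≠ 0 := by
      exact_mod_cast (Nat.choose_pos hn).ne'
    rw [← hpairs']
    simp only [if_pos hag]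
    -- the outcomes on `R` are all `0`, all `1`, or mixed
    by_cases h0 : (R.filter fun i => u i = 1).card = 0
    · have hA : ∑ x ∈ Finset.univ.filter
          (fun x : (Rᶜ : Finset (Fin (2 * n))) × (Rᶜ : Finset (Fin (2 * n))) => x.1 < x.2),
          pairEntry ((n : ℤ) - (R.filter fun i => u i = 1).card) x.1 x.2 (restrict R u)
            (restrict R v)
          = n.choose 2 * if (∀ i, restrict R u i = 1 ∧ restrict R v i = 1) then 1 else 0 := by
        rw [← hcount, ← nsmul_eq_mul, ← Finset.sum_const]
        refine Finset.sum_congr rfl fun x hx => ?_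
        rw [← pairEntry_card (Finset.mem_filter.1 hx).2.ne, hcard, h0, Nat.cast_zero, sub_zero]
      have hg : ghzPart n p l R u v = ghzEntry p l (restrict R u) (restrict R v) -
          if (∀ i, restrict R u i = 1 ∧ restrict R v i = 1) then 1 else 0 := if_pos ⟨h0, hag⟩
      have hg' : ghzPart n p l R (flipAll u) (flipAll v) = 0 := if_neg fun h => by omega
      have c0 : ((R.filter fun i => u i = 1).card : ℤ) = 0 := by omega
      have c1 : ¬ ((R.filter fun i => u i = 1).card : ℤ) = n := by omega
      rw [hA, hg, hg', if_pos c0, if_neg c1, ghzStrategy_apply p hlz,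
        Finset.sum_eq_zero, add_zero, add_zero]
      · congr 1
        field_simp
        ring
      · intro m hm
        rw [if_neg]
        have := (Finset.mem_Icc.1 hm).1
        omega
    · by_cases h1 : (R.filter fun i => u i = 1).card = n
      · have hA : ∑ x ∈ Finset.univ.filter
            (fun x : (Rᶜ : Finset (Fin (2 * n))) × (Rᶜ : Finset (Fin (2 * n))) => x.1 < x.2),
            pairEntry ((n : ℤ) - (R.filter fun i => u i = 1).card) x.1 x.2 (restrict R u)
              (restrict R v)
            = n.choose 2 * if (∀ i, restrict R u i = 0 ∧ restrict R v i = 0) then 1 else 0 := by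
          rw [← hcount, ← nsmul_eq_mul, ← Finset.sum_const]
          refine Finset.sum_congr rfl fun x hx => ?_
          rw [← pairEntry_zero (Finset.mem_filter.1 hx).2.ne, h1, sub_self]
        have e1 : ∀ b : Fin 2, b + 1 = 1 ↔ b = 0 := by decide
        have hB : (∀ i, restrict R (flipAll u) i = 1 ∧ restrict R (flipAll v) i = 1)
            ↔ ∀ i, restrict R u i = 0 ∧ restrict R v i = 0 := by
          simp only [restrict, flipAll, e1]
        have hg : ghzPart n p l R u v = 0 := if_neg fun h => by omega
        have hg' : ghzPart n p l R (flipAll u) (flipAll v)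
            = ghzEntry p l (restrict R (flipAll u)) (restrict R (flipAll v)) -
            if (∀ i, restrict R (flipAll u) i = 1 ∧ restrict R (flipAll v) i = 1) then 1 else 0 :=
          if_pos ⟨by omega, hagree.2 hag⟩
        have c0 : ¬ ((R.filter fun i => u i = 1).card : ℤ) = 0 := by omega
        have c1 : ((R.filter fun i => u i = 1).card : ℤ) = n := by omega
        rw [hA, hg, hg', if_neg c0, if_pos c1, ghzStrategy_apply p hlz', ghzEntry_one_sub p hl,
          Finset.sum_eq_zero, zero_add, zero_add, add_zero, if_congr hB rfl rfl]
        · rw [show flipAll (restrict R u) = restrict R (flipAll u) from rfl,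
            show flipAll (restrict R v) = restrict R (flipAll v) from rfl]
          congr 1
          field_simp
          ring
        · intro m hm
          rw [if_neg]
          have := (Finset.mem_Icc.1 hm).2
          omega
      · have hg : ghzPart n p l R u v = 0 := if_neg fun h => by omega
        have hg' : ghzPart n p l R (flipAll u) (flipAll v) = 0 := if_neg fun h => by omega
        have c0 : ¬ ((R.filter fun i => u i = 1).card : ℤ) = 0 := by omega
        have c1 : ¬ ((R.filter fun i => u i = 1).card : ℤ) = n := by omega
        rw [hg, hg', if_neg c0, if_neg c1, add_zero, add_zero, zero_add, add_zero,
          Finset.sum_eq_single (R.filter fun i => u i = 1).card, if_pos rfl,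
          dickeStrategy_apply, hcard]
        · rfl
        · intro m _ hm
          rw [if_neg]
          omega
        · intro hm
          exact absurd (Finset.mem_Icc.2 ⟨by omega, by omega⟩) hm
  · have hzero : ∑ x ∈ Finset.univ.filter (fun x : Fin (2 * n) × Fin (2 * n) => x.1 < x.2),
        (if x.1 ∉ R ∧ x.2 ∉ R then pairEntry (n : ℤ) x.1 x.2 u v else 0) = 0 := by
      refine Finset.sum_eq_zero fun x _ => ?_
      split_ifs with h
      · exact pairEntry_eq_zero hag n h.1 h.2
      · rfl
    have hg : ghzPart n p l R u v = 0 := if_neg fun h => hag h.2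
    have hg' : ghzPart n p l R (flipAll u) (flipAll v) = 0 := if_neg fun h => hag (hagree.1 h.2)
    rw [hzero, hg, hg']
    simp [hag]

theorem card_filter_eq_zero {V : Type} (u : V → Fin 2) (R : Finset V) :
    (R.filter fun i => u i = 1).card = 0 ↔ ∀ i ∈ R, u i = 0 := by
  have e : ∀ b : Fin 2, ¬ b = 1 ↔ b = 0 := by decide
  simp only [Finset.card_eq_zero, Finset.filter_eq_empty_iff, e]

theorem card_zeros (u : Fin (2 * n) → Fin 2) :
    (Finset.univ.filter fun i => u i = 0).card = 2 * n - weight u := by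
  have e : ∀ b : Fin 2, ¬ b = 1 ↔ b = 0 := by decide
  have h := Finset.card_filter_add_card_filter_not (s := Finset.univ) fun i => u i = 1
  simp only [e] at h
  rw [Finset.card_univ, Fintype.card_fin] at h
  rw [weight]
  omega

/-- The diagonal entries of `ghzPart` at a string of weight `w`. -/
noncomputable def ghzDiag (n : ℕ) (p : ℝ) (l : Fin 2 → ℝ) (w : ℕ) : ℝ :=
  (if w = 0 then p else 0) + (if w = n then p - 1 else 0) +
    (1 - p) / n * ((n - w) * l 0 + w * l 1)

/-- The terms of `ghzPart` through strings on all qubits. A coherence between `0…0` and a string `v`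
occurs only if `R` consists of the zeros of `v`. -/
theorem ghzPart_eq (hn : 1 ≤ n) (p : ℝ) (l : Fin 2 → ℝ) {R : Finset (Fin (2 * n))} (hR : R.card = n)
    (u v : Fin (2 * n) → Fin 2) :
    ghzPart n p l R u v =
      (if ∀ i ∈ R, u i = 0 then (if u = v then ghzDiag n p l (weight u) else 0) else 0) +
      (1 - p) * (Real.sqrt (l 0) * Real.sqrt (l 1)) *
        ((if R = Finset.univ.filter (fun i => v i = 0) then (if weight u = 0 then 1 else 0) else 0)
        + if R = Finset.univ.filter (fun i => u i = 0) then (if weight v = 0 then 1 else 0)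
          else 0) := by
  have hcard : Fintype.card (Rᶜ : Finset (Fin (2 * n))) = n := by
    rw [Fintype.card_coe, Finset.card_compl, Fintype.card_fin, hR]; omega
  have hz : ∀ w : Fin (2 * n) → Fin 2, R = Finset.univ.filter (fun i => w i = 0) ↔
      (∀ i ∈ R, w i = 0) ∧ ∀ i, i ∉ R → w i = 1 := by
    intro w
    have e : ∀ b : Fin 2, b = 1 ↔ ¬ b = 0 := by decide
    simp only [Finset.ext_iff, Finset.mem_filter, Finset.mem_univ, true_and, e, ← forall_and]
    refine forall_congr' fun i => ?_
    tauto
  have hsub : ∀ P : Fin (2 * n) → Prop, (∀ i : (Rᶜ : Finset (Fin (2 * n))), P i)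
      ↔ ∀ i, i ∉ R → P i := by
    intro P
    simp [Finset.mem_compl]
  have hw0 : ∀ w : Fin (2 * n) → Fin 2, weight w = 0 ↔ ∀ i, w i = 0 := by
    intro w
    rw [weight_eq_zero_iff, funext_iff]
  have hall : ∀ w : Fin (2 * n) → Fin 2, (∀ i, w i = 0) ↔
      (∀ i ∈ R, w i = 0) ∧ ∀ i, i ∉ R → w i = 0 := by
    intro w
    rw [← forall_and]
    refine forall_congr' fun i => ?_
    tauto
  by_cases hu : ∀ i ∈ R, u i = 0
  · by_cases huv : ∀ i ∈ R, u i = v i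
    · have hv : ∀ i ∈ R, v i = 0 := fun i hi => (huv i hi).symm.trans (hu i hi)
      have hwr := weight_restrict R u
      rw [(card_filter_eq_zero u R).2 hu, zero_add] at hwr
      have h00 : (∀ i, restrict R u i = 0 ∧ restrict R v i = 0) ↔ u = v ∧ weight u = 0 := by
        rw [forall_and, ← funext_iff (g := fun _ => 0), ← weight_eq_zero_iff, hwr,
          ← restrict_eq_iff huv]
        constructor
        · rintro ⟨h1, h2⟩
          refine ⟨?_, h1⟩
          rw [← hwr, weight_eq_zero_iff] at h1
          ext1 i
          rw [h1, h2]
        · rintro ⟨h1, h2⟩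
          refine ⟨h2, fun i => ?_⟩
          rw [← hwr, weight_eq_zero_iff] at h2
          rw [← h1, h2]
      have h11 : (∀ i, restrict R u i = 1 ∧ restrict R v i = 1) ↔ u = v ∧ weight u = n := by
        have hone : weight (restrict R u) = n ↔ restrict R u = fun _ => 1 := by
          rw [← weight_eq_card_iff, hcard]
        rw [forall_and, ← funext_iff (g := fun _ => 1), ← restrict_eq_iff huv, ← hwr, hone]
        constructor
        · rintro ⟨h1, h2⟩
          refine ⟨?_, h1⟩
          ext1 i
          rw [h1, h2]
        · rintro ⟨h1, h2⟩
          refine ⟨h2, fun i => ?_⟩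
          rw [← h1, h2]
      have h01 : (∀ i, restrict R u i = 0 ∧ restrict R v i = 1) ↔
          (R = Finset.univ.filter fun i => v i = 0) ∧ weight u = 0 := by
        refine (hsub fun i => u i = 0 ∧ v i = 1).trans ?_
        rw [hz, hw0, hall]
        exact ⟨fun h => ⟨⟨hv, fun i hi => (h i hi).2⟩, hu, fun i hi => (h i hi).1⟩,
          fun h i hi => ⟨h.2.2 i hi, h.1.2 i hi⟩⟩
      have h10 : (∀ i, restrict R u i = 1 ∧ restrict R v i = 0) ↔
          (R = Finset.univ.filter fun i => u i = 0) ∧ weight v = 0 := by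
        refine (hsub fun i => u i = 1 ∧ v i = 0).trans ?_
        rw [hz, hw0, hall]
        exact ⟨fun h => ⟨⟨hu, fun i hi => (h i hi).1⟩, hv, fun i hi => (h i hi).2⟩,
          fun h i hi => ⟨h.1.2 i hi, h.2.2 i hi⟩⟩
      have hsum : ∑ k, l (restrict R u k) = (n - weight u) * l 0 + weight u * l 1 := by
        have h1 : ∀ k, l (restrict R u k) = l 0 + ((restrict R u k : ℕ) : ℝ) * (l 1 - l 0) := by
          intro k
          rcases fin2_eq_zero_or_one (restrict R u k) with h | h <;> simp [h]
        simp_rw [h1, Finset.sum_add_distrib, ← Finset.sum_mul]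
        rw [sum_val_eq_weight, hwr, Finset.sum_const, Finset.card_univ, hcard, nsmul_eq_mul]
        ring
      rw [ghzPart, if_pos ⟨(card_filter_eq_zero u R).2 hu, huv⟩, ghzEntry, if_congr h00 rfl rfl,
        if_congr h11 rfl rfl, if_congr h01 rfl rfl, if_congr h10 rfl rfl,
        if_congr (restrict_eq_iff huv) rfl rfl, hsum, hcard, if_pos hu, ghzDiag]
      simp only [ite_and]
      by_cases h : u = v
      · simp only [if_pos h]
        split_ifs <;> ring
      · simp only [if_neg h]
        ring
    · have hne : u ≠ v := by
        rintro rfl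
        exact huv fun _ _ => rfl
      rw [ghzPart, if_neg fun h => huv h.2, if_pos hu, if_neg hne]
      have hv : ¬ ∀ i ∈ R, v i = 0 := fun h => huv fun i hi => by rw [hu i hi, h i hi]
      have h1 : ¬ R = Finset.univ.filter fun i => v i = 0 := fun h => hv ((hz v).1 h).1
      have h2 : ¬ weight v = 0 := fun h => hv fun i _ => (hw0 v).1 h i
      rw [if_neg h1, if_neg h2]
      simp
  · rw [ghzPart, if_neg fun h => hu ((card_filter_eq_zero u R).1 h.1), if_neg hu]
    have h1 : ¬ R = Finset.univ.filter fun i => u i = 0 := fun h => hu ((hz u).1 h).1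
    have h2 : ¬ weight u = 0 := fun h => hu fun i _ => (hw0 u).1 h i
    rw [if_neg h1, if_neg h2]
    simp

/-- The sum over `R` counts the sets `R` contained in the zeros of `u`. -/
theorem sum_ghzPart (hn : 1 ≤ n) (p : ℝ) (l : Fin 2 → ℝ) (u v : Fin (2 * n) → Fin 2) :
    ∑ R ∈ Finset.powersetCard n Finset.univ, ghzPart n p l R u v =
      (if u = v then (2 * n - weight u).choose n * ghzDiag n p l (weight u) else 0) +
      (1 - p) * (Real.sqrt (l 0) * Real.sqrt (l 1)) *
        ((if weight u = 0 ∧ weight v = n then 1 else 0)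
        + if weight u = n ∧ weight v = 0 then 1 else 0) := by
  have hz : ∀ (w : Fin (2 * n) → Fin 2) (c : ℝ), ∑ R ∈ Finset.powersetCard n Finset.univ,
      (if R = Finset.univ.filter (fun i => w i = 0) then c else 0)
        = if weight w = n then c else 0 := by
    intro w c
    have hw := weight_le_card w
    rw [Fintype.card_fin] at hw
    rw [Finset.sum_ite_eq']
    refine if_congr ?_ rfl rfl
    rw [Finset.mem_powersetCard, card_zeros]
    simp only [Finset.subset_univ, true_and]
    omega
  have hfilter : ∀ c : ℝ, ∑ R ∈ Finset.powersetCard n (Finset.univ : Finset (Fin (2 * n))),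
      (if ∀ i ∈ R, u i = 0 then c else 0) = (2 * n - weight u).choose n * c := by
    intro c
    rw [← Finset.sum_filter, Finset.sum_const, nsmul_eq_mul, ← card_zeros,
      ← Finset.card_powersetCard]
    congr 3
    ext R
    simp only [Finset.mem_filter, Finset.mem_powersetCard, true_and,
      Finset.subset_iff, Finset.mem_univ]
    tauto
  rw [Finset.sum_congr rfl fun R hR => ghzPart_eq hn p l (Finset.mem_powersetCard.1 hR).2 u v,
    Finset.sum_add_distrib, ← Finset.mul_sum, Finset.sum_add_distrib, hz, hz, hfilter]
  simp only [← ite_and, mul_ite, mul_zero]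
  rw [if_congr (and_comm (a := weight v = n)) rfl rfl]

/-- Averaging the extended Dicke strategy over `R`: every pair of qubits is avoided by equally many
sets `R`. -/
theorem sum_pairEntry (u v : Fin (2 * n) → Fin 2) :
    ∑ R ∈ Finset.powersetCard n (Finset.univ : Finset (Fin (2 * n))),
      ∑ x ∈ Finset.univ.filter (fun x : Fin (2 * n) × Fin (2 * n) => x.1 < x.2),
        (if x.1 ∉ R ∧ x.2 ∉ R then pairEntry (n : ℤ) x.1 x.2 u v else 0)
      = (2 * n - 2).choose n *
        ∑ x ∈ Finset.univ.filter (fun x : Fin (2 * n) × Fin (2 * n) => x.1 < x.2),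
          pairEntry (n : ℤ) x.1 x.2 u v := by
  rw [Finset.sum_comm, Finset.mul_sum]
  refine Finset.sum_congr rfl fun x hx => ?_
  have hxy : x.1 ≠ x.2 := (Finset.mem_filter.1 hx).2.ne
  have hset : (Finset.powersetCard n (Finset.univ : Finset (Fin (2 * n)))).filter
      (fun R => x.1 ∉ R ∧ x.2 ∉ R) = Finset.powersetCard n {x.1, x.2}ᶜ := by
    ext R
    simp only [Finset.mem_filter, Finset.mem_powersetCard, Finset.subset_univ, true_and,
      Finset.subset_compl_comm (s := R), Finset.insert_subset_iff, Finset.singleton_subset_iff,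
      Finset.mem_compl]
    exact and_comm
  rw [← Finset.sum_filter, hset, Finset.sum_const, Finset.card_powersetCard, Finset.card_compl,
    Fintype.card_fin, Finset.card_pair hxy, nsmul_eq_mul]

end StrategyR

/-! ### The decomposition of the strategy -/

section Decomposition

variable {n : ℕ}

/-- On the diagonal, the sum over pairs depends on the weight only; off the diagonal, a pair
contributes iff flipping it maps `u` to `v`. -/
theorem sum_pairs_pairEntry (u v : Fin (2 * n) → Fin 2) :
    ∑ x ∈ Finset.univ.filter (fun x : Fin (2 * n) × Fin (2 * n) => x.1 < x.2),
      pairEntry (n : ℤ) x.1 x.2 u v =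
    (if u = v then (if weight u = n then (3 * (n : ℝ) ^ 2 - 2 * n) / 2 else
      if weight u + 1 = n ∨ weight u = n + 1 then ((n : ℝ) + 1) * n / 4 else 0) else 0) +
    1 / 2 * (if (weight u = n ∧ weight v = n ∨ weight u + 1 = n ∧ weight v = n + 1 ∨
      weight v + 1 = n ∧ weight u = n + 1) ∧ weight (u + v) = 2 then 1 else 0) := by
  set P : Prop := weight u = n ∧ weight v = n ∨ weight u + 1 = n ∧ weight v = n + 1 ∨
      weight v + 1 = n ∧ weight u = n + 1 with hP
  -- a diagonal entry is a polynomial in the two bits of the pair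
  set a : ℝ := if weight u = n then 1 else if weight u + 1 = n then 1 / 2 else 0 with ha
  set b : ℝ := if weight u = n then -1 / 2 else if weight u + 1 = n then -1 / 2 else 0 with hb
  set c : ℝ := if weight u = n then 1 else if weight u + 1 = n then 1 / 2 else
    if weight u = n + 1 then 1 / 2 else 0 with hc
  have hterm : ∀ x ∈ Finset.univ.filter (fun x : Fin (2 * n) × Fin (2 * n) => x.1 < x.2),
      pairEntry (n : ℤ) x.1 x.2 u v =
      (if u = v then a + b * (((u x.1 : ℕ) : ℝ) + ((u x.2 : ℕ) : ℝ))
        + c * (((u x.1 : ℕ) : ℝ) * ((u x.2 : ℕ) : ℝ)) else 0) +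
      1 / 2 * (if P then (if v = flipOn {x.1, x.2} u then 1 else 0) else 0) := by
    intro x hx
    have hxy : x.1 ≠ x.2 := (Finset.mem_filter.1 hx).2.ne
    have hw := weight_flipOn_pair hxy u
    rw [pairEntry]
    congr 1
    · by_cases huv : u = v
      · rw [if_pos huv, if_pos huv, ha, hb, hc]
        generalize weight u = w
        rcases fin2_eq_zero_or_one (u x.1) with h1 | h1 <;>
          rcases fin2_eq_zero_or_one (u x.2) with h2 | h2 <;> rw [h1, h2] <;>
          simp <;> split_ifs <;> first | omega | norm_num
      · rw [if_neg huv, if_neg huv]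
    · rw [← ite_and]
      congr 1
      refine if_congr ?_ rfl rfl
      rw [and_comm]
      refine and_congr_left fun hv => ?_
      rw [← hv] at hw
      rw [hP]
      rcases fin2_eq_zero_or_one (u x.1) with h1 | h1 <;>
        rcases fin2_eq_zero_or_one (u x.2) with h2 | h2 <;> rw [h1, h2] at hw ⊢ <;>
        simp at hw ⊢ <;> omega
  rw [Finset.sum_congr rfl hterm, Finset.sum_add_distrib, ← Finset.mul_sum]
  congr 1
  · by_cases huv : u = v
    · simp only [if_pos huv]
      rw [sum_pairs_polynomial, ha, hb, hc, Fintype.card_fin]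
      by_cases h1 : weight u = n
      · simp only [if_pos h1]
        have hw : (weight u : ℝ) = n := by exact_mod_cast h1
        rw [hw]
        push_cast
        ring
      · by_cases h2 : weight u + 1 = n
        · simp only [if_neg h1, if_pos h2, if_pos (Or.inl h2)]
          have hw : (weight u : ℝ) = n - 1 := by
            rw [eq_sub_iff_add_eq]; exact_mod_cast h2
          rw [hw]
          push_cast
          ring
        · by_cases h3 : weight u = n + 1
          · simp only [if_neg h1, if_neg h2, if_pos h3, if_pos (Or.inr h3)]
            have hw : (weight u : ℝ) = n + 1 := by exact_mod_cast h3
            rw [hw]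
            push_cast
            ring
          · have h4 : ¬ (weight u + 1 = n ∨ weight u = n + 1) := by tauto
            simp only [if_neg h1, if_neg h2, if_neg h3, if_neg h4]
            ring
    · simp only [if_neg huv, Finset.sum_const_zero]
  · rw [ite_and]
    by_cases h : P
    · rw [if_pos h, ← sum_pairs_flipOn]
      simp only [if_pos h]
    · rw [if_neg h]
      simp only [if_neg h, Finset.sum_const_zero]

/-- The diagonal coefficient of the strategy on the weights `m` and `2n - m`, for
`1 ≤ m ≤ n - 2`. -/
noncomputable def coeff3 (n : ℕ) (p l0 : ℝ) (m : ℕ) : ℝ :=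
  (1 - p) / (2 * n).choose n * ((2 * n - m).choose n * ((m : ℝ) / n + (1 - 2 * m / n) * l0))

/-- The average of `ghzPart` on the diagonal. For `w > n` it vanishes since no `R` fits into the zeros
of the string. -/
theorem ghzDiag_eq (hn : 1 ≤ n) (p : ℝ) {l : Fin 2 → ℝ} (hl : l 0 + l 1 = 1) {w : ℕ} :
    1 / ((2 * n).choose n : ℝ) * ((2 * n - w).choose n * ghzDiag n p l w) =
      if w = 0 then p + (1 - p) * l 0 else if w < n then coeff3 n p (l 0) w else
        if w = n then -((1 - p) * l 0 / (2 * n).choose n) else 0 := by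
  have hC : ((2 * n).choose n : ℝ) ≠ 0 := by exact_mod_cast (Nat.choose_pos (by omega)).ne'
  have hn' : (n : ℝ) ≠ 0 := by exact_mod_cast (by omega : n ≠ 0)
  have hl1 : l 1 = 1 - l 0 := by linarith
  by_cases h0 : w = 0
  · subst h0
    rw [if_pos rfl, ghzDiag, if_pos rfl, if_neg (by omega), Nat.sub_zero, Nat.cast_zero]
    field_simp
    ring
  · rw [if_neg h0]
    by_cases h1 : w < n
    · rw [if_pos h1, ghzDiag, if_neg h0, if_neg h1.ne, coeff3, hl1]
      field_simp
      ring
    · rw [if_neg h1]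
      by_cases h2 : w = n
      · subst h2
        rw [if_pos rfl, ghzDiag, if_neg h0, if_pos rfl, hl1, show 2 * w - w = w by omega,
          Nat.choose_self]
        field_simp
        push_cast
        ring
      · rw [if_neg h2, Nat.choose_eq_zero_of_lt (show 2 * n - w < n by omega)]
        simp

/-- The diagonal coefficient of the strategy on the weights `n - 1` and `n + 1`. -/
noncomputable def coeff2 (n : ℕ) (p l0 : ℝ) : ℝ :=
  (n + 1) * (1 / (4 * (2 * n - 1)) +
      (1 - p) / (2 * n).choose n * (1 - 1 / n - (1 - 2 / n) * l0))

/-- At the weight `n - 1` the formula for `coeff3` yields the part of `coeff2` which stems from the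
GHZ-like strategies. -/
theorem coeff3_pred (hn : 1 ≤ n) (p l0 : ℝ) {w : ℕ} (hw : w + 1 = n) :
    coeff3 n p l0 w = (n + 1) * ((1 - p) / (2 * n).choose n * (1 - 1 / n - (1 - 2 / n) * l0)) := by
  have hn' : (n : ℝ) ≠ 0 := by exact_mod_cast (by omega : n ≠ 0)
  have hw' : (w : ℝ) = n - 1 := by
    rw [eq_sub_iff_add_eq]; exact_mod_cast hw
  rw [coeff3, show 2 * n - w = n + 1 by omega, Nat.choose_succ_self_right, hw']
  push_cast
  field_simp
  ring

/-- The diagonal and the coherence between the weights `0`, `2n` and the weight `n` come from the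
GHZ-like strategies, the Johnson graph from the Dicke strategies. -/
theorem strategy_eq_realOp (hn : 2 ≤ n) (p : ℝ) {l : Fin 2 → ℝ} (hl0 : 0 ≤ l 0) (hl1 : 0 ≤ l 1)
    (hl : l 0 + l 1 = 1) :
    strategy n p l = realOp fun u v =>
      entry1 n (p + (1 - p) * l 0)
        ((3 * n - 2) / (2 * (2 * n - 1)) - 2 * (1 - p) * l 0 / (2 * n).choose n)
        (1 / (2 * n * (2 * n - 1))) ((1 - p) * (Real.sqrt (l 0) * Real.sqrt (l 1)) /
          (2 * n).choose n) u v +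
      entry2 n (coeff2 n p (l 0)) (1 / (2 * n * (2 * n - 1))) u v +
      entry3 n (coeff3 n p (l 0)) u v := by
  ext u v
  have hC : ((2 * n).choose n : ℝ) ≠ 0 := by exact_mod_cast (Nat.choose_pos (by omega)).ne'
  have hc2 : (n.choose 2 : ℝ) ≠ 0 := by exact_mod_cast (Nat.choose_pos hn).ne'
  have hn' : (2 : ℝ) ≤ n := by exact_mod_cast hn
  have hn0 : (n : ℝ) ≠ 0 := by linarith
  have hn1 : (2 * n - 1 : ℝ) ≠ 0 := by linarith
  -- the probability that a fixed pair of qubits is the one measured last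
  have hK : 1 / ((2 * n).choose n : ℝ) * (1 / (n.choose 2 : ℝ) * (2 * n - 2).choose n)
      = 1 / (n * (2 * n - 1)) := by
    have h1 : (2 * n).choose n * n.choose 2 = (2 * n).choose 2 * (2 * n - 2).choose n := by
      rw [Nat.choose_mul hn, ← Nat.choose_symm (show n - 2 ≤ 2 * n - 2 by omega),
        show 2 * n - 2 - (n - 2) = n by omega]
    have h2 : ((2 * n).choose n : ℝ) * n.choose 2 = (n * (2 * n - 1)) * (2 * n - 2).choose n := by
      have h3 := congrArg (Nat.cast (R := ℝ)) h1
      rw [Nat.cast_mul, Nat.cast_mul, Nat.cast_choose_two ℝ (2 * n)] at h3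
      rw [h3]
      push_cast
      ring
    rw [← mul_assoc, one_div_mul_one_div, one_div_mul_eq_div, div_eq_div_iff
      (mul_ne_zero hC hc2) (mul_ne_zero hn0 hn1), h2]
    ring
  have hsum : strategy n p l u v = ((1 / ((2 * n).choose n : ℝ) * (1 / (n.choose 2 : ℝ) *
      ((2 * n - 2).choose n *
        ∑ x ∈ Finset.univ.filter (fun x : Fin (2 * n) × Fin (2 * n) => x.1 < x.2),
          pairEntry (n : ℤ) x.1 x.2 u v) +
      (∑ R ∈ Finset.powersetCard n Finset.univ, ghzPart n p l R u v +
        ∑ R ∈ Finset.powersetCard n Finset.univ, ghzPart n p l R (flipAll u) (flipAll v))) : ℝ)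
        : ℂ) := by
    rw [strategy, Matrix.smul_apply, Matrix.sum_apply, Finset.sum_congr rfl fun R hR =>
      strategyR_apply hn p hl0 hl1 hl (Finset.mem_powersetCard.1 hR).2 u v,
      ← Complex.ofReal_sum, Finset.sum_add_distrib, Finset.sum_add_distrib, ← Finset.mul_sum,
      sum_pairEntry, smul_eq_mul]
    push_cast
    ring
  rw [hsum, realOp, Matrix.of_apply]
  congr 1
  have hwu := weight_flipAll u
  have hwv := weight_flipAll v
  rw [Fintype.card_fin] at hwu hwv
  rw [sum_ghzPart (by omega), sum_ghzPart (by omega), sum_pairs_pairEntry, mul_add,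
    ← mul_assoc, ← mul_assoc, mul_assoc (1 / _) (1 / _), hK]
  by_cases huv : u = v
  · subst huv
    have hd : ¬ weight (u + u) = 2 := by
      have : u + u = fun _ => 0 := by
        ext1 i
        have e : ∀ b : Fin 2, b + b = 0 := by decide
        exact e _
      rw [this, (weight_eq_zero_iff _).2 rfl]
      omega
    have hg := ghzDiag_eq (n := n) (by omega) p hl (w := weight u)
    have hg' := ghzDiag_eq (n := n) (by omega) p hl (w := weight (flipAll u))
    generalize weight (flipAll u) = w' at *
    simp only [entry1, entry2, entry3, diag3, hd, and_false, if_false, mul_zero, add_zero, if_true]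
    generalize weight u = w at *
    have hx1 : ¬ (w = 0 ∧ w = n) := by omega
    have hx2 : ¬ (w = n ∧ w = 0) := by omega
    have hx3 : ¬ (w' = 0 ∧ w' = n) := by omega
    have hx4 : ¬ (w' = n ∧ w' = 0) := by omega
    have hx5 : ¬ ((w = 0 ∨ w = 2 * n) ∧ w = n ∨ w = n ∧ (w = 0 ∨ w = 2 * n)) := by omega
    rw [if_neg hx1, if_neg hx2, if_neg hx3, if_neg hx4, if_neg hx5]
    simp only [mul_zero, add_zero]
    rw [mul_add (1 / ((2 * n).choose n : ℝ)), hg, hg']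
    by_cases h1 : w < n
    · have hA : ¬ w' = 0 := by omega
      have hB : ¬ w' < n := by omega
      have hD : ¬ w' = n := by omega
      have hE : ¬ w = n := by omega
      have hF : ¬ w = n + 1 := by omega
      have hG : ¬ n + 2 ≤ w := by omega
      have hH : ¬ w = 2 * n := by omega
      simp only [hA, hB, hD, hE, hF, hG, hH, h1, if_true, if_false, or_false, false_and, add_zero]
      by_cases h2 : w = 0
      · have h3 : ¬ w + 1 = n := by omega
        have h4 : ¬ (1 ≤ w ∧ w + 2 ≤ n) := by omega
        simp only [h2, if_true]
        simp only [← h2, h3, h4, if_false]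
        ring
      · by_cases h3 : w + 1 = n
        · have h4 : ¬ (1 ≤ w ∧ w + 2 ≤ n) := by omega
          rw [if_neg h2, if_pos h3, if_neg h2, if_pos h3, if_neg h4,
            coeff3_pred (by omega) p _ h3, coeff2]
          field_simp
          ring
        · have h4 : 1 ≤ w ∧ w + 2 ≤ n := by omega
          rw [if_neg h2, if_neg h3, if_neg h2, if_neg h3, if_pos h4]
          ring
    · by_cases h2 : w = n
      · have hA : w' = n := by omega
        have hB : ¬ n = 0 := by omega
        have hD : ¬ n + 1 = n := by omega
        have hE : ¬ n = n + 1 := by omega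
        have hF : ¬ n + 2 ≤ n := by omega
        simp only [h2, hA, hB, hD, hE, hF, if_true, if_false, or_self, false_and, and_false,
          lt_irrefl, add_zero]
        field_simp
        ring
      · have hA : ¬ w = 0 := by omega
        have hB : w' < n := by omega
        have hD : ¬ w + 1 = n := by omega
        have hE : ¬ (1 ≤ w ∧ w + 2 ≤ n) := by omega
        simp only [h1, h2, hA, hB, hD, hE, if_true, if_false, false_or, zero_add]
        by_cases h3 : w = 2 * n
        · have h4 : w' = 0 := by omega
          have h5 : ¬ w = n + 1 := by omega
          have h6 : ¬ (n + 2 ≤ w ∧ w < 2 * n) := by omega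
          rw [if_neg h5, if_pos h4, if_pos h3, if_neg h5, if_neg h6]
          ring
        · have h4 : ¬ w' = 0 := by omega
          rw [if_neg h4, if_neg h3]
          by_cases h5 : w = n + 1
          · have h6 : ¬ (n + 2 ≤ w ∧ w < 2 * n) := by omega
            have h7 : w' + 1 = n := by omega
            rw [if_pos h5, if_pos h5, if_neg h6, coeff3_pred (by omega) p _ h7, coeff2]
            field_simp
            ring
          · have h6 : n + 2 ≤ w ∧ w < 2 * n := by omega
            have h7 : 2 * n - w = w' := by omega
            rw [if_neg h5, if_neg h5, if_pos h6, h7]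
            ring
  · have huv' : flipAll u ≠ flipAll v := fun h => huv (flipAll_involutive.injective h)
    simp only [entry1, entry2, entry3, if_neg huv, if_neg huv', zero_add, add_zero]
    generalize weight (flipAll u) = w' at *
    generalize weight (flipAll v) = z' at *
    generalize weight (u + v) = d at *
    generalize weight u = w at *
    generalize weight v = z at *
    have hcross : ((if (w = 0 ∨ w = 2 * n) ∧ z = n ∨ w = n ∧ (z = 0 ∨ z = 2 * n) then (1 : ℝ)
        else 0)) = (if w = 0 ∧ z = n then 1 else 0) + (if w = n ∧ z = 0 then 1 else 0) +
        ((if w' = 0 ∧ z' = n then 1 else 0) + (if w' = n ∧ z' = 0 then 1 else 0)) := by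
      split_ifs <;> first | omega | norm_num
    have hjoin : (if (w = n ∧ z = n ∨ w + 1 = n ∧ z = n + 1 ∨ z + 1 = n ∧ w = n + 1) ∧ d = 2
        then (1 : ℝ) else 0) = (if w = n ∧ z = n ∧ d = 2 then 1 else 0) +
        if (w + 1 = n ∧ z = n + 1 ∨ z + 1 = n ∧ w = n + 1) ∧ d = 2 then 1 else 0 := by
      split_ifs <;> first | omega | norm_num
    rw [hcross, hjoin]
    field_simp
    ring

end Decomposition

/-! ### The entries of `omega1`, `omega2` and `omega3` -/

section OmegaEntries

variable {n : ℕ}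

theorem zProj_apply (n : ℕ) (m : ℤ) (u v : Fin (2 * n) → Fin 2) :
    zProj n m u v = if u = v then (if (weight u : ℤ) = m then 1 else 0) else 0 := by
  rw [zProj, weightProj, Matrix.diagonal_apply]
  rfl

theorem ketbra_ket_apply {V : Type} [Fintype V] [DecidableEq V] (a b u v : V → Fin 2) :
    ketbra (ket a) (ket b) u v = if u = a ∧ v = b then 1 else 0 := by
  rw [ketbra, Matrix.vecMulVec_apply, ket, ket, Pi.star_apply, Pi.single_apply, Pi.single_apply]
  by_cases h1 : u = a <;> by_cases h2 : v = b <;> simp [h1, h2]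

theorem sum_ketbra_apply {V : Type} [Fintype V] [DecidableEq V] (j k : ℕ)
    (P : (V → Fin 2) → (V → Fin 2) → Prop) [∀ a b, Decidable (P a b)] (u v : V → Fin 2) :
    (∑ a ∈ strings V j, ∑ b ∈ strings V k, if P a b then ketbra (ket a) (ket b) else 0) u v
      = if weight u = j ∧ weight v = k ∧ P u v then 1 else 0 := by
  have h : ∀ a b : V → Fin 2, (if P a b then ketbra (ket a) (ket b) else 0 : Op V) u v
      = if v = b then (if u = a then (if P u v then 1 else 0) else 0) else 0 := by
    intro a b
    by_cases h1 : u = a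
    · subst h1
      by_cases h2 : v = b
      · subst h2
        by_cases hP : P u v <;> simp [hP, ketbra_ket_apply]
      · split_ifs <;> simp [ketbra_ket_apply, h2]
    · split_ifs <;> simp [ketbra_ket_apply, h1]
  simp only [Matrix.sum_apply, h, Finset.sum_ite_eq]
  by_cases hv : v ∈ strings V k
  · simp only [if_pos hv, Finset.sum_ite_eq]
    simp only [strings, Finset.mem_filter, Finset.mem_univ, true_and] at hv ⊢
    simp only [hv, true_and, ite_and]
  · simp only [if_neg hv, Finset.sum_const_zero]
    simp only [strings, Finset.mem_filter, Finset.mem_univ, true_and] at hv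
    simp [hv]

theorem ghz_apply (hn : 1 ≤ n) (u : Fin (2 * n) → Fin 2) :
    ghz (Fin (2 * n)) u = ((1 / Real.sqrt 2 *
      (if weight u = 0 ∨ weight u = 2 * n then 1 else 0) : ℝ) : ℂ) := by
  have h0 := weight_eq_zero_iff u
  have h1 := weight_eq_card_iff u
  rw [Fintype.card_fin] at h1
  rw [ghz, Pi.smul_apply, Pi.add_apply, ket, ket, Pi.single_apply, Pi.single_apply, ← if_congr h0 rfl
    rfl, ← if_congr h1 rfl rfl, smul_eq_mul, Complex.ofReal_mul]
  congr 1
  by_cases h : weight u = 0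
  · have h' : ¬ weight u = 2 * n := by omega
    rw [if_pos h, if_neg h', if_pos (Or.inl h)]
    simp
  · by_cases h' : weight u = 2 * n
    · rw [if_neg h, if_pos h', if_pos (Or.inr h')]
      simp
    · rw [if_neg h, if_neg h', if_neg (by tauto)]
      simp

theorem dicke_apply {V : Type} [Fintype V] [DecidableEq V] (k : ℕ) (u : V → Fin 2) :
    dicke V k u = ((1 / Real.sqrt ((Fintype.card V).choose k) *
      (if weight u = k then 1 else 0) : ℝ) : ℂ) := by
  rw [dicke, Pi.smul_apply, Finset.sum_apply, smul_eq_mul, Complex.ofReal_mul]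
  congr 1
  simp only [ket, Pi.single_apply, Finset.sum_ite_eq, strings, Finset.mem_filter, Finset.mem_univ,
    true_and]
  split_ifs <;> simp

theorem omega1_eq_realOp (hn : 1 ≤ n) (p : ℝ) {l : Fin 2 → ℝ} (hl0 : 0 ≤ l 0) :
    omega1 n p l = realOp (entry1 n (p + (1 - p) * l 0)
        ((3 * n - 2) / (2 * (2 * n - 1)) - 2 * (1 - p) * l 0 / (2 * n).choose n)
        (1 / (2 * n * (2 * n - 1))) ((1 - p) * (Real.sqrt (l 0) * Real.sqrt (l 1)) /
          (2 * n).choose n)) := by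
  ext u v
  have hC : (0 : ℝ) < (2 * n).choose n := by exact_mod_cast Nat.choose_pos (by omega)
  have hsqrt : Real.sqrt (2 * l 0 * l 1 / (2 * n).choose n) *
      (1 / Real.sqrt 2 * (1 / Real.sqrt ((2 * n).choose n)))
      = Real.sqrt (l 0) * Real.sqrt (l 1) / (2 * n).choose n := by
    rw [Real.sqrt_div' _ hC.le, Real.sqrt_mul (by positivity), Real.sqrt_mul (by norm_num)]
    have h1 := Real.mul_self_sqrt hC.le
    have h2 : Real.sqrt ((2 * n).choose n) ≠ 0 := (Real.sqrt_pos.2 hC).ne'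
    have h3 : Real.sqrt 2 ≠ 0 := by positivity
    rw [eq_div_iff hC.ne']
    nth_rw 3 [← h1]
    field_simp
  have hket : (ketbra (ghz (Fin (2 * n))) (dicke (Fin (2 * n)) n) +
      ketbra (dicke (Fin (2 * n)) n) (ghz (Fin (2 * n)))) u v =
      ((1 / Real.sqrt 2 * (1 / Real.sqrt ((2 * n).choose n)) *
        (if (weight u = 0 ∨ weight u = 2 * n) ∧ weight v = n ∨
          weight u = n ∧ (weight v = 0 ∨ weight v = 2 * n) then 1 else 0) : ℝ) : ℂ) := by
    rw [Matrix.add_apply, ketbra, ketbra, Matrix.vecMulVec_apply, Matrix.vecMulVec_apply,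
      Pi.star_apply, Pi.star_apply, ghz_apply hn, ghz_apply hn, dicke_apply, dicke_apply,
      Fintype.card_fin]
    simp only [RCLike.star_def, Complex.conj_ofReal, ← Complex.ofReal_mul, ← Complex.ofReal_add]
    congr 1
    by_cases h1 : weight u = n
    · have h2 : ¬ (weight u = 0 ∨ weight u = 2 * n) := by omega
      rw [if_pos h1, if_neg h2]
      by_cases h3 : weight v = 0 ∨ weight v = 2 * n
      · rw [if_pos h3, if_pos (Or.inr ⟨h1, h3⟩)]
        ring
      · rw [if_neg h3, if_neg (show ¬ ((weight u = 0 ∨ weight u = 2 * n) ∧ weight v = n ∨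
          weight u = n ∧ (weight v = 0 ∨ weight v = 2 * n)) from by tauto)]
        ring
    · simp only [h1, if_false, false_and, or_false, mul_zero, zero_mul, add_zero]
      rw [ite_and]
      split_ifs <;> ring
  rw [omega1, Matrix.add_apply, Matrix.add_apply, Matrix.add_apply, Matrix.smul_apply,
    Matrix.smul_apply, Matrix.smul_apply, Matrix.smul_apply, hket, Matrix.add_apply, zProj_apply,
    zProj_apply, zProj_apply, johnson, sum_ketbra_apply, realOp, Matrix.of_apply, entry1]
  have hcoh : ∀ x : ℝ, (((1 - p) * Real.sqrt (2 * l 0 * l 1 / (2 * n).choose n) : ℝ) : ℂ) *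
      ((1 / Real.sqrt 2 * (1 / Real.sqrt ((2 * n).choose n)) * x : ℝ) : ℂ)
      = (((1 - p) * (Real.sqrt (l 0) * Real.sqrt (l 1)) / (2 * n).choose n * x : ℝ) : ℂ) := by
    intro x
    rw [← Complex.ofReal_mul]
    congr 1
    rw [mul_div_assoc (1 - p), ← hsqrt]
    ring
  have hcast : ∀ a b c : ℝ, ((a + b + c : ℝ) : ℂ) = a + b + c := by
    intro a b c
    push_cast
    rfl
  rw [smul_eq_mul, smul_eq_mul, smul_eq_mul, smul_eq_mul, hcoh, hcast,
    Complex.ofReal_mul (1 / (2 * (n : ℝ) * (2 * n - 1)))]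
  congr 2
  · by_cases huv : u = v
    · simp only [if_pos huv]
      have h0 : ((weight u : ℤ) = 0) ↔ weight u = 0 := by omega
      have h1 : ((weight u : ℤ) = 2 * n) ↔ weight u = 2 * n := by omega
      have h2 : ((weight u : ℤ) = n) ↔ weight u = n := by omega
      rw [if_congr h0 rfl rfl, if_congr h1 rfl rfl, if_congr h2 rfl rfl]
      by_cases hA : weight u = n
      · have hB : ¬ weight u = 0 := by omega
        have hD : ¬ weight u = 2 * n := by omega
        rw [if_pos hA, if_neg hB, if_neg hD, if_pos hA]
        ring
      · by_cases hB : weight u = 0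
        · have hD : ¬ weight u = 2 * n := by omega
          rw [if_neg hA, if_pos hB, if_neg hD, if_neg hA, if_pos (Or.inl hB)]
          ring
        · by_cases hD : weight u = 2 * n
          · rw [if_neg hA, if_neg hB, if_pos hD, if_neg hA, if_pos (Or.inr hD)]
            ring
          · rw [if_neg hA, if_neg hB, if_neg hD, if_neg hA, if_neg (by tauto)]
            simp
    · simp only [if_neg huv]
      simp
  · split_ifs <;> simp

theorem omega2_eq_realOp (hn : 1 ≤ n) (p : ℝ) (l : Fin 2 → ℝ) :
    omega2 n p l = realOp (entry2 n (coeff2 n p (l 0)) (1 / (2 * n * (2 * n - 1)))) := by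
  ext u v
  have hsum : (∑ a ∈ strings (Fin (2 * n)) (n - 1), ∑ b ∈ strings (Fin (2 * n)) (n + 1),
      if weight (a + b) = 2 then ketbra (ket a) (ket b) + ketbra (ket b) (ket a) else 0)
      = (∑ a ∈ strings (Fin (2 * n)) (n - 1), ∑ b ∈ strings (Fin (2 * n)) (n + 1),
        if weight (a + b) = 2 then ketbra (ket a) (ket b) else 0) +
        ∑ b ∈ strings (Fin (2 * n)) (n + 1), ∑ a ∈ strings (Fin (2 * n)) (n - 1),
        if weight (b + a) = 2 then ketbra (ket b) (ket a) else 0 := by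
    rw [Finset.sum_comm (s := strings (Fin (2 * n)) (n + 1))]
    simp only [← Finset.sum_add_distrib]
    refine Finset.sum_congr rfl fun a _ => Finset.sum_congr rfl fun b _ => ?_
    rw [add_comm b a]
    split_ifs
    · rfl
    · rw [add_zero]
  rw [omega2, hsum, Matrix.add_apply, Matrix.smul_apply, Matrix.smul_apply, Matrix.add_apply,
    Matrix.add_apply, sum_ketbra_apply, sum_ketbra_apply, zProj_apply, zProj_apply, realOp,
    Matrix.of_apply, entry2, ← coeff2, Complex.ofReal_add, Complex.ofReal_mul]
  simp only [smul_eq_mul]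
  have h0 : ((weight u : ℤ) = n - 1) ↔ weight u + 1 = n := by omega
  have h1 : ((weight u : ℤ) = n + 1) ↔ weight u = n + 1 := by omega
  rw [if_congr h0 rfl rfl, if_congr h1 rfl rfl]
  congr 1
  · by_cases huv : u = v
    · simp only [if_pos huv]
      split_ifs <;> first | omega | simp
    · simp only [if_neg huv]
      simp
  · congr 1
    generalize weight (u + v) = d
    generalize weight u = w
    generalize weight v = z
    split_ifs <;> first | omega | simp

theorem omega3_eq_realOp (p : ℝ) (l : Fin 2 → ℝ) :
    omega3 n p l = realOp (entry3 n (coeff3 n p (l 0))) := by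
  ext u v
  rw [omega3, Matrix.smul_apply, Matrix.sum_apply, realOp, Matrix.of_apply, entry3, smul_eq_mul]
  simp only [Matrix.smul_apply, Matrix.add_apply, zProj_apply, smul_eq_mul]
  by_cases huv : u = v
  · simp only [if_pos huv]
    have hw := weight_le_card u
    rw [Fintype.card_fin] at hw
    rw [diag3]
    by_cases h1 : 1 ≤ weight u ∧ weight u + 2 ≤ n
    · rw [if_pos h1, Finset.sum_eq_single (weight u), if_pos rfl, if_neg (by omega), add_zero,
        mul_one, ← Complex.ofReal_mul, coeff3]
      · intro m hm hne
        have := Finset.mem_Icc.1 hm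
        rw [if_neg (by omega), if_neg (by omega), add_zero, mul_zero]
      · intro h
        exact absurd (Finset.mem_Icc.2 ⟨h1.1, by omega⟩) h
    · rw [if_neg h1]
      by_cases h2 : n + 2 ≤ weight u ∧ weight u < 2 * n
      · rw [if_pos h2, Finset.sum_eq_single (2 * n - weight u), if_neg (by omega),
          if_pos (by omega), zero_add, mul_one, ← Complex.ofReal_mul, coeff3]
        · intro m hm hne
          have := Finset.mem_Icc.1 hm
          rw [if_neg (by omega), if_neg (by omega), add_zero, mul_zero]
        · intro h
          exact absurd (Finset.mem_Icc.2 ⟨by omega, by omega⟩) h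
      · rw [if_neg h2, Finset.sum_eq_zero, mul_zero, Complex.ofReal_zero]
        intro m hm
        have := Finset.mem_Icc.1 hm
        rw [if_neg (by omega), if_neg (by omega), add_zero, mul_zero]
  · simp only [if_neg huv]
    simp

end OmegaEntries

/-! ### The coefficients -/

section Coefficients

variable {n : ℕ}

theorem five_mul_succ_le_choose (hn : 3 ≤ n) : 5 * (n + 1) ≤ (2 * n).choose n := by
  rw [← Nat.centralBinom_eq_two_mul_choose]
  induction n, hn using Nat.le_induction with
  | base => decide
  | succ k hk ih =>
    have h := Nat.succ_mul_centralBinom_succ k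
    nlinarith

theorem coeff3_one (hn : 1 ≤ n) (p l0 : ℝ) :
    coeff3 n p l0 1 = (1 - p) * ((n - 2) * l0 + 1) / (2 * n) := by
  have hC : ((2 * n).choose n : ℝ) ≠ 0 := by exact_mod_cast (Nat.choose_pos (by omega)).ne'
  have hn' : (n : ℝ) ≠ 0 := by exact_mod_cast (by omega : n ≠ 0)
  have h := Nat.choose_mul_succ_eq (2 * n - 1) n
  rw [show 2 * n - 1 + 1 = 2 * n by omega, show 2 * n - n = n by omega] at h
  have h1 : ((2 * n - 1).choose n : ℝ) * (2 * n) = (2 * n).choose n * n := by exact_mod_cast h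
  have h2 : ((2 * n - 1).choose n : ℝ) = (2 * n).choose n / 2 := by
    have : ((2 * n - 1).choose n : ℝ) * 2 * n = (2 * n).choose n * n := by linarith
    have := mul_right_cancel₀ hn' this
    linarith
  rw [coeff3, h2]
  push_cast
  field_simp
  ring

theorem coeff3_succ_le (p : ℝ) (hp : p < 1) {l0 : ℝ} (hl0 : 0 ≤ l0) (hl1 : l0 ≤ 1)
    {m : ℕ} (hm : 1 ≤ m) (hmn : m + 1 ≤ n) : coeff3 n p l0 (m + 1) ≤ coeff3 n p l0 m := by
  have hn' : (0 : ℝ) < n := by exact_mod_cast (by omega : 0 < n)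
  have hm' : (1 : ℝ) ≤ m := by exact_mod_cast hm
  have hmn' : (m : ℝ) + 1 ≤ n := by exact_mod_cast hmn
  have h := Nat.choose_mul_succ_eq (2 * n - (m + 1)) n
  rw [show 2 * n - (m + 1) + 1 = 2 * n - m by omega, show 2 * n - m - n = n - m by omega] at h
  have h1 : ((2 * n - (m + 1)).choose n : ℝ) * (2 * n - m) = (2 * n - m).choose n * (n - m) := by
    have h2 := congrArg (Nat.cast (R := ℝ)) h
    rw [Nat.cast_mul, Nat.cast_mul, Nat.cast_sub (show m ≤ 2 * n by omega),
      Nat.cast_sub (show m ≤ n by omega)] at h2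
    push_cast at h2
    exact h2
  have hC : 0 ≤ (1 - p) / (2 * n).choose n := div_nonneg (by linarith) (Nat.cast_nonneg _)
  refine mul_le_mul_of_nonneg_left ?_ hC
  set A : ℝ := ((2 * n - (m + 1)).choose n : ℝ)
  set B : ℝ := ((2 * n - m).choose n : ℝ)
  have hB : 0 ≤ B := Nat.cast_nonneg _
  have hE : ∀ x : ℝ, x / n + (1 - 2 * x / n) * l0 = (x + (n - 2 * x) * l0) / n := by
    intro x; field_simp
  rw [hE, hE, ← mul_div_assoc, ← mul_div_assoc]
  refine div_le_div_of_nonneg_right ?_ hn'.le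
  have hpos : (0 : ℝ) < 2 * n - m := by linarith
  refine le_of_mul_le_mul_right ?_ hpos
  rw [mul_right_comm, h1]
  push_cast
  have hE1 : (0 : ℝ) ≤ m + (n - 2 * m) * l0 := by
    nlinarith [mul_nonneg hl0 (sub_nonneg.2 hmn'), mul_nonneg (sub_nonneg.2 hl1) (by linarith : (0 : ℝ) ≤ m)]
  have hE2 : (m : ℝ) + 1 + (n - 2 * (m + 1)) * l0 ≤ 2 * (m + (n - 2 * m) * l0) := by
    nlinarith [mul_nonneg hl0 (by linarith : (0 : ℝ) ≤ n + 1 - m),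
      mul_nonneg (sub_nonneg.2 hl1) (by linarith : (0 : ℝ) ≤ m - 1)]
  have h3 : (n - m : ℝ) * (m + 1 + (n - 2 * (m + 1)) * l0)
      ≤ (2 * n - m) * (m + (n - 2 * m) * l0) := by
    have h4 := mul_le_mul_of_nonneg_left hE2 (by linarith : (0 : ℝ) ≤ n - m)
    have h5 : (n - m : ℝ) * (2 * (m + (n - 2 * m) * l0))
        ≤ (2 * n - m) * (m + (n - 2 * m) * l0) := by
      rw [← mul_assoc]
      exact mul_le_mul_of_nonneg_right (by linarith) hE1
    exact h4.trans h5
  have h6 := mul_le_mul_of_nonneg_left h3 hB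
  linarith

theorem coeff3_le_one (p : ℝ) (hp : p < 1) {l0 : ℝ} (hl0 : 0 ≤ l0) (hl1 : l0 ≤ 1)
    {m : ℕ} (hm : 1 ≤ m) (hmn : m ≤ n) : coeff3 n p l0 m ≤ coeff3 n p l0 1 := by
  induction m, hm using Nat.le_induction with
  | base => exact le_rfl
  | succ k hk ih => exact (coeff3_succ_le p hp hl0 hl1 hk hmn).trans (ih (by omega))

end Coefficients

/-! ### The spectrum of the components -/

section Spectrum

variable {n : ℕ}

/-- The amplitudes of the target state, up to normalization: `1` on the weights `0` and `2n`, and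
`κ` on the weight `n`. -/
def targetAmplitude (n : ℕ) (κ : ℝ) (u : Fin (2 * n) → Fin 2) : ℝ :=
  if weight u = n then κ else if weight u = 0 ∨ weight u = 2 * n then 1 else 0

theorem sum_targetAmplitude_mul (hn : 1 ≤ n) (κ : ℝ) (x : (Fin (2 * n) → Fin 2) → ℝ) :
    ∑ u, targetAmplitude n κ u * x u
      = x (fun _ => 0) + x (fun _ => 1) + κ * ∑ u, level n x u := by
  have : Nonempty (Fin (2 * n)) := ⟨⟨0, by omega⟩⟩
  have hext := sum_extreme_weights x
  rw [Fintype.card_fin] at hext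
  rw [← hext, Finset.mul_sum, ← Finset.sum_add_distrib]
  refine Finset.sum_congr rfl fun u _ => ?_
  unfold targetAmplitude level
  by_cases h : weight u = n
  · have h0 : ¬ (weight u = 0 ∨ weight u = 2 * n) := by omega
    rw [if_pos h, if_pos h, if_neg h0, zero_add]
  · rw [if_neg h, if_neg h, mul_zero, add_zero, ite_mul, one_mul, zero_mul]

theorem hop_const (κ : ℝ) (u : Fin (2 * n) → Fin 2) :
    hop (fun _ => κ) u = κ * hop (fun _ => 1) u := by
  simp only [hop, Finset.mul_sum, mul_ite, mul_one, mul_zero]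

/-- The target state is fixed by the component on the weights `0`, `n` and `2n`. -/
theorem sum_entry1_targetAmplitude (hn : 1 ≤ n) {p l0 l1 κ : ℝ} (hsum : l0 + l1 = 1)
    (hκ : κ ^ 2 * l0 = l1) (u : Fin (2 * n) → Fin 2) :
    ∑ v, entry1 n (p + (1 - p) * l0)
        ((3 * n - 2) / (2 * (2 * n - 1)) - 2 * (1 - p) * l0 / (2 * n).choose n)
        (1 / (2 * n * (2 * n - 1))) ((1 - p) * (l0 * κ) / (2 * n).choose n) u v *
          targetAmplitude n κ v
      = 1 * targetAmplitude n κ u := by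
  have : Nonempty (Fin (2 * n)) := ⟨⟨0, by omega⟩⟩
  have hC : ((2 * n).choose n : ℝ) ≠ 0 := by exact_mod_cast (Nat.choose_pos (by omega)).ne'
  have hn' : (1 : ℝ) ≤ n := by exact_mod_cast hn
  have h2n : (2 * n - 1 : ℝ) ≠ 0 := by linarith
  have hn0 : (n : ℝ) ≠ 0 := by linarith
  have hlev : level n (targetAmplitude n κ) = level n fun _ => κ := by
    funext v
    unfold level targetAmplitude
    split_ifs <;> rfl
  have hsumlev : ∑ v : Fin (2 * n) → Fin 2, level n (fun _ => κ) v = κ * (2 * n).choose n := by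
    have h := sum_level_one (V := Fin (2 * n)) n
    rw [Fintype.card_fin] at h
    rw [← h, Finset.mul_sum]
    exact Finset.sum_congr rfl fun v _ => by simp [level]
  have hext : ∀ b : Fin 2, targetAmplitude n κ (fun _ => b) = 1 := by
    intro b
    have hb : weight (fun _ : Fin (2 * n) => b) = 0 ∨
        weight (fun _ : Fin (2 * n) => b) = 2 * n := by
      rcases fin2_eq_zero_or_one b with rfl | rfl
      · exact Or.inl ((weight_eq_zero_iff _).2 rfl)
      · exact Or.inr (((weight_eq_card_iff _).2 rfl).trans (Fintype.card_fin _))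
    have hb' : ¬ weight (fun _ : Fin (2 * n) => b) = n := by omega
    rw [targetAmplitude, if_neg hb', if_pos hb]
  rw [sum_entry1_mul hn, hlev, hsumlev, hext, hext]
  by_cases hu : weight u = n
  · have h0 : ¬ (weight u = 0 ∨ weight u = 2 * n) := by omega
    rw [if_pos hu, if_neg h0, hop_level hu, hop_const, hop_one, Fintype.card_fin, hu,
      targetAmplitude, if_pos hu]
    push_cast
    have e : (3 * n - 2) / (2 * (2 * n - 1)) + 1 / (2 * n * (2 * n - 1)) * (n * n) = (1 : ℝ) := by
      rw [← mul_div_mul_left (3 * (n : ℝ) - 2) _ hn0, ← mul_assoc, mul_comm (n : ℝ) 2,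
        one_div_mul_eq_div, ← add_div, div_eq_one_iff_eq (mul_ne_zero (by positivity) h2n)]
      ring
    linear_combination κ * e
  · rw [if_neg hu, zero_add, targetAmplitude, if_neg hu]
    split_ifs
    · field_simp
      linear_combination (1 - p) * hκ + (1 - p) * hsum
    · simp

theorem sum_entry2_mul_eq_zero (hn : 2 ≤ n) (α γ : ℝ) {f : (Fin (2 * n) → Fin 2) → ℝ}
    (hf : ∀ v, f v ≠ 0 → weight v = n ∨ weight v = 0 ∨ weight v = 2 * n)
    (u : Fin (2 * n) → Fin 2) : ∑ v, entry2 n α γ u v * f v = 0 := by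
  refine Finset.sum_eq_zero fun v _ => ?_
  by_cases h : f v = 0
  · rw [h, mul_zero]
  · have hv := hf v h
    rw [entry2_comm, entry2, if_neg (by omega : ¬ (weight v + 1 = n ∨ weight v = n + 1)),
      if_neg (by omega : ¬ ((weight v + 1 = n ∧ weight u = n + 1 ∨
        weight u + 1 = n ∧ weight v = n + 1) ∧ weight (v + u) = 2))]
    simp

theorem sum_entry3_mul_eq_zero (d : ℕ → ℝ) {f : (Fin (2 * n) → Fin 2) → ℝ}
    (hf : ∀ v, f v ≠ 0 → weight v = n ∨ weight v = 0 ∨ weight v = 2 * n)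
    (u : Fin (2 * n) → Fin 2) : ∑ v, entry3 n d u v * f v = 0 := by
  rw [sum_entry3_mul]
  by_cases h : f u = 0
  · rw [h, mul_zero]
  · have hu := hf u h
    rw [diag3, if_neg (by omega), if_neg (by omega), zero_mul]

theorem sum_sq_eq (hn : 2 ≤ n) (x : (Fin (2 * n) → Fin 2) → ℝ) :
    ∑ u, x u ^ 2 = (x (fun _ => 0) ^ 2 + x (fun _ => 1) ^ 2 + ∑ u, level n x u ^ 2) +
      (∑ u, if weight u + 1 = n ∨ weight u = n + 1 then x u ^ 2 else 0) +
      ∑ u, if 1 ≤ weight u ∧ weight u + 2 ≤ n ∨ n + 2 ≤ weight u ∧ weight u < 2 * n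
        then x u ^ 2 else 0 := by
  have : Nonempty (Fin (2 * n)) := ⟨⟨0, by omega⟩⟩
  have hext := sum_extreme_weights fun u => x u ^ 2
  rw [Fintype.card_fin] at hext
  rw [← hext]
  simp only [← Finset.sum_add_distrib]
  refine Finset.sum_congr rfl fun u _ => ?_
  have hw := weight_le_card u
  rw [Fintype.card_fin] at hw
  unfold level
  split_ifs <;> first | omega | ring

/-- The antisymmetric combination of the strings `0…0` and `1…1` is an eigenvector: the coherences
with the weight `n` cancel. -/
theorem sum_entry1_antisymmetric (hn : 1 ≤ n) (α₀ α₁ γ δ : ℝ) (u : Fin (2 * n) → Fin 2) :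
    ∑ v, entry1 n α₀ α₁ γ δ u v * (if weight v = 0 then 1 else if weight v = 2 * n then -1 else 0)
      = α₀ * (if weight u = 0 then 1 else if weight u = 2 * n then -1 else 0) := by
  have hlev : level n (fun v : Fin (2 * n) → Fin 2 =>
      if weight v = 0 then (1 : ℝ) else if weight v = 2 * n then -1 else 0) = fun _ => 0 := by
    funext v
    unfold level
    dsimp only
    split_ifs <;> first | omega | rfl
  have h0 : weight (fun _ : Fin (2 * n) => (0 : Fin 2)) = 0 := (weight_eq_zero_iff _).2 rfl
  have h1 : weight (fun _ : Fin (2 * n) => (1 : Fin 2)) = 2 * n :=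
    ((weight_eq_card_iff _).2 rfl).trans (Fintype.card_fin _)
  rw [sum_entry1_mul hn, hlev, h0, h1, if_pos rfl, if_neg (by omega : ¬ 2 * n = 0), if_pos rfl]
  simp only [hop, ite_self, Finset.sum_const_zero]
  by_cases hu : weight u = n
  · rw [if_pos hu, if_neg (by omega : ¬ weight u = 0), if_neg (by omega : ¬ weight u = 2 * n),
      if_neg (by omega : ¬ (weight u = 0 ∨ weight u = 2 * n))]
    ring
  · rw [if_neg hu]
    by_cases hw : weight u = 0 ∨ weight u = 2 * n
    · rw [if_pos hw]
      ring
    · rw [if_neg hw, if_neg (by tauto), if_neg (by tauto)]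
      ring

/-- The sign of a single bit, on the strings of weight `n`, is an eigenvector: having mean zero, it is
not coupled to the weights `0` and `2n`. -/
theorem sum_entry1_sign (hn : 1 ≤ n) (a : Fin (2 * n)) (α₀ α₁ γ δ : ℝ)
    (u : Fin (2 * n) → Fin 2) :
    ∑ v, entry1 n α₀ α₁ γ δ u v * level n (fun w => 1 - 2 * ((w a : ℕ) : ℝ)) v
      = (α₁ + γ * ((n : ℝ) ^ 2 - 2 * n)) * level n (fun w => 1 - 2 * ((w a : ℕ) : ℝ)) u := by
  have hlev : ∀ f : (Fin (2 * n) → Fin 2) → ℝ, level n (level n f) = level n f := by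
    intro f
    funext v
    unfold level
    split_ifs <;> rfl
  have h0 : weight (fun _ : Fin (2 * n) => (0 : Fin 2)) = 0 := (weight_eq_zero_iff _).2 rfl
  have h1 : weight (fun _ : Fin (2 * n) => (1 : Fin 2)) = 2 * n :=
    ((weight_eq_card_iff _).2 rfl).trans (Fintype.card_fin _)
  rw [sum_entry1_mul hn, hlev, sum_level_sign (Fintype.card_fin (2 * n))]
  by_cases hu : weight u = n
  · rw [if_pos hu, if_neg (by omega : ¬ (weight u = 0 ∨ weight u = 2 * n)), hop_level hu,
      hop_sign (Fintype.card_fin (2 * n)) a hu]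
    simp only [level, h0, h1, hu, if_true]
    rw [if_neg (by omega), if_neg (by omega)]
    ring
  · simp only [level, hu, if_false]
    simp

/-- The second largest eigenvalue of a matrix whose component on the weights `0`, `n` and `2n` is
that of the strategy, provided the remaining components are dominated. -/
theorem secondEigenvalue_eq_max (hn : 2 ≤ n) {A : Op (Fin (2 * n))} (hA : A.IsHermitian)
    {p l0 l1 κ α γ : ℝ} {d : ℕ → ℝ} (hp0 : 0 ≤ p) (hp : p < 1) (hl0 : 0 ≤ l0) (hl1 : 0 ≤ l1)
    (hsum : l0 + l1 = 1) (hκ : κ ^ 2 * l0 = l1) (hα : 0 ≤ α) (hγ : 0 ≤ γ)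
    (hαγ : α + γ * ((n + 1) * n / 2) ≤ p + (1 - p) * l0)
    (hd : ∀ m, 1 ≤ m → m + 2 ≤ n → d m ≤ p + (1 - p) * l0)
    (ha : A = realOp fun u v => entry1 n (p + (1 - p) * l0)
        ((3 * n - 2) / (2 * (2 * n - 1)) - 2 * (1 - p) * l0 / (2 * n).choose n)
        (1 / (2 * n * (2 * n - 1))) ((1 - p) * (l0 * κ) / (2 * n).choose n) u v +
      entry2 n α γ u v + entry3 n d u v) :
    secondEigenvalue hA = max (p + (1 - p) * l0)
      (1 - 1 / (2 * n - 1) - 2 * (1 - p) * l0 / (2 * n).choose n) := by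
  have hne : Nonempty (Fin (2 * n)) := ⟨⟨0, by omega⟩⟩
  have hn1 : 1 ≤ n := by omega
  have hn' : (2 : ℝ) ≤ n := by exact_mod_cast hn
  have h2n : (0 : ℝ) < 2 * n - 1 := by linarith
  have h0 : weight (fun _ : Fin (2 * n) => (0 : Fin 2)) = 0 := (weight_eq_zero_iff _).2 rfl
  have h1 : weight (fun _ : Fin (2 * n) => (1 : Fin 2)) = 2 * n :=
    ((weight_eq_card_iff _).2 rfl).trans (Fintype.card_fin _)
  have hsplit : ∀ (f : (Fin (2 * n) → Fin 2) → ℝ),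
      (∀ v, f v ≠ 0 → weight v = n ∨ weight v = 0 ∨ weight v = 2 * n) → ∀ u,
      ∑ v, (entry1 n (p + (1 - p) * l0)
        ((3 * n - 2) / (2 * (2 * n - 1)) - 2 * (1 - p) * l0 / (2 * n).choose n)
        (1 / (2 * n * (2 * n - 1))) ((1 - p) * (l0 * κ) / (2 * n).choose n) u v +
        entry2 n α γ u v + entry3 n d u v) * f v
      = ∑ v, entry1 n (p + (1 - p) * l0)
        ((3 * n - 2) / (2 * (2 * n - 1)) - 2 * (1 - p) * l0 / (2 * n).choose n)
        (1 / (2 * n * (2 * n - 1))) ((1 - p) * (l0 * κ) / (2 * n).choose n) u v * f v := by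
    intro f hf u
    simp only [add_mul, Finset.sum_add_distrib]
    rw [sum_entry2_mul_eq_zero hn α γ hf, sum_entry3_mul_eq_zero d hf, add_zero, add_zero]
  set α₀ := p + (1 - p) * l0 with hα₀
  set β₁ := 1 - 1 / (2 * (n : ℝ) - 1) - 2 * (1 - p) * l0 / (2 * n).choose n with hβ₁
  have hbc : max α₀ β₁ ≤ 1 := by
    refine max_le ?_ ?_
    · nlinarith [mul_nonneg (sub_nonneg.2 hp.le) hl1]
    · have e1 : 0 ≤ 1 / (2 * (n : ℝ) - 1) := by positivity
      have e2 : 0 ≤ 2 * (1 - p) * l0 / ((2 * n).choose n : ℝ) :=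
        div_nonneg (mul_nonneg (by linarith) hl0) (Nat.cast_nonneg _)
      linarith
  have hψ0 : targetAmplitude n κ (fun _ => 0) ≠ 0 := by
    rw [targetAmplitude, if_neg (by omega), if_pos (Or.inl h0)]
    exact one_ne_zero
  have hψs : ∀ v, targetAmplitude n κ v ≠ 0 → weight v = n ∨ weight v = 0 ∨ weight v = 2 * n := by
    intro v hv
    by_contra h
    exact hv (by rw [targetAmplitude, if_neg (by tauto), if_neg (by tauto)])
  have hψ := fun u => (hsplit _ hψs u).trans (sum_entry1_targetAmplitude hn1 hsum hκ u)
  have hform : ∀ x : (Fin (2 * n) → Fin 2) → ℝ, ∑ u, targetAmplitude n κ u * x u = 0 →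
      ∑ u, ∑ v, (entry1 n α₀
        ((3 * n - 2) / (2 * (2 * n - 1)) - 2 * (1 - p) * l0 / (2 * n).choose n)
        (1 / (2 * n * (2 * n - 1))) ((1 - p) * (l0 * κ) / (2 * n).choose n) u v +
        entry2 n α γ u v + entry3 n d u v) * x u * x v ≤ max α₀ β₁ * ∑ u, x u ^ 2 := by
    intro x hx
    rw [sum_targetAmplitude_mul hn1] at hx
    rw [sum_sq_eq hn, mul_add, mul_add]
    simp only [add_mul, Finset.sum_add_distrib]
    exact add_le_add (add_le_add
      (form_entry1_le hn1 hp hl1 hsum hκ (le_max_left _ _) (le_max_right _ _) hx)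
      (form_entry2_le hα hγ (hαγ.trans (le_max_left _ _)) x))
      (form_entry3_le (fun m hm hmn => (hd m hm hmn).trans (le_max_left _ _)) x)
  rcases le_total β₁ α₀ with hle | hle
  · have hb : max α₀ β₁ = α₀ := max_eq_left hle
    refine secondEigenvalue_realOp hA ha (φ := fun v => if weight v = 0 then 1 else
      if weight v = 2 * n then -1 else 0) (u₁ := fun _ => 0) hψ0 (by simp [h0]) ?_ hbc hψ ?_ hform
    · rw [sum_targetAmplitude_mul hn1]
      simp only [h0, h1, if_true]
      rw [if_neg (by omega), Finset.sum_eq_zero fun u _ => ?_]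
      · ring
      · unfold level
        dsimp only
        split_ifs <;> first | omega | rfl
    · intro u
      rw [hb, hsplit _ _ u]
      · exact sum_entry1_antisymmetric hn1 _ _ _ _ u
      · intro v hv
        by_contra h
        exact hv (by rw [if_neg (by tauto), if_neg (by tauto)])
  · have hb : max α₀ β₁ = β₁ := max_eq_right hle
    obtain ⟨u₁, hu₁⟩ := exists_weight_eq (V := Fin (2 * n)) (k := n)
      (by rw [Fintype.card_fin]; omega)
    refine secondEigenvalue_realOp hA ha (φ := level n fun w =>
      1 - 2 * ((w ⟨0, by omega⟩ : ℕ) : ℝ)) (u₁ := u₁) hψ0 ?_ ?_ hbc hψ ?_ hform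
    · rw [level, if_pos hu₁]
      rcases fin2_eq_zero_or_one (u₁ ⟨0, by omega⟩) with h | h <;> rw [h] <;> norm_num
    · have hlev : level n (level n fun w : Fin (2 * n) → Fin 2 =>
          1 - 2 * ((w ⟨0, by omega⟩ : ℕ) : ℝ)) = level n fun w =>
          1 - 2 * ((w ⟨0, by omega⟩ : ℕ) : ℝ) := by
        funext v
        unfold level
        split_ifs <;> rfl
      rw [sum_targetAmplitude_mul hn1, hlev, sum_level_sign (Fintype.card_fin (2 * n)), level,
        level, if_neg (by omega), if_neg (by omega)]
      ring
    · intro u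
      rw [hb, hsplit _ (fun v hv => Or.inl (weight_of_level_ne_zero v hv)) u, sum_entry1_sign hn1]
      congr 1
      have hn0 : (n : ℝ) ≠ 0 := by linarith
      have e : (3 * n - 2) / (2 * (2 * n - 1)) +
          1 / (2 * n * (2 * n - 1)) * ((n : ℝ) ^ 2 - 2 * n) = 1 - 1 / (2 * n - 1) := by
        rw [← mul_div_mul_left (3 * (n : ℝ) - 2) _ hn0, ← mul_assoc, mul_comm (n : ℝ) 2,
          one_div_mul_eq_div, ← add_div, one_sub_div h2n.ne', div_eq_div_iff (by positivity) h2n.ne']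
        ring
      linear_combination e

/-- The eigenvector is constant on the weights `n - 1` and `n + 1`. -/
theorem largestEigenvalue_entry2 (hn : 2 ≤ n) {A : Op (Fin (2 * n))} (hA : A.IsHermitian)
    {α γ : ℝ} (hα : 0 ≤ α) (hγ : 0 ≤ γ) (ha : A = realOp (entry2 n α γ)) :
    largestEigenvalue hA = α + γ * ((n + 1) * n / 2) := by
  have hn' : (0 : ℝ) ≤ n := Nat.cast_nonneg n
  obtain ⟨u₁, hu₁⟩ := exists_weight_eq (V := Fin (2 * n)) (k := n + 1)
    (by rw [Fintype.card_fin]; omega)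
  refine largestEigenvalue_realOp hA ha (φ := fun u =>
    if weight u + 1 = n ∨ weight u = n + 1 then 1 else 0) (u₁ := u₁) (by simp [hu₁]) ?_ ?_
  · intro u
    have h : ∀ v, entry2 n α γ u v * (if weight v + 1 = n ∨ weight v = n + 1 then 1 else 0)
        = entry2 n α γ u v := by
      intro v
      by_cases hv : weight v + 1 = n ∨ weight v = n + 1
      · rw [if_pos hv, mul_one]
      · rw [if_neg hv, mul_zero, entry2_comm, entry2, if_neg hv,
          if_neg (by tauto : ¬ ((weight v + 1 = n ∧ weight u = n + 1 ∨
            weight u + 1 = n ∧ weight v = n + 1) ∧ weight (v + u) = 2))]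
        simp
    rw [Finset.sum_congr rfl fun v _ => h v, sum_entry2_row]
    split_ifs <;> simp
  · intro x
    refine (form_entry2_le hα hγ le_rfl x).trans
      (mul_le_mul_of_nonneg_left (Finset.sum_le_sum fun u _ => ?_) (by positivity))
    split_ifs
    · exact le_rfl
    · exact sq_nonneg _

theorem largestEigenvalue_entry3 (hn : 3 ≤ n) {A : Op (Fin (2 * n))} (hA : A.IsHermitian)
    {d : ℕ → ℝ} (hd0 : 0 ≤ d 1) (hd : ∀ m, 1 ≤ m → m + 2 ≤ n → d m ≤ d 1)
    (ha : A = realOp (entry3 n d)) : largestEigenvalue hA = d 1 := by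
  obtain ⟨u₁, hu₁⟩ := exists_weight_eq (V := Fin (2 * n)) (k := 1)
    (by rw [Fintype.card_fin]; omega)
  refine largestEigenvalue_realOp hA ha (φ := fun u => if weight u = 1 then 1 else 0) (u₁ := u₁)
    (by simp [hu₁]) ?_ ?_
  · intro u
    rw [sum_entry3_mul]
    by_cases h : weight u = 1
    · rw [h, diag3, if_pos ⟨le_rfl, by omega⟩]
    · rw [if_neg h, mul_zero, mul_zero]
  · intro x
    refine (form_entry3_le hd x).trans
      (mul_le_mul_of_nonneg_left (Finset.sum_le_sum fun u _ => ?_) hd0)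
    split_ifs
    · exact le_rfl
    · exact sq_nonneg _

end Spectrum

/-! ### Comparison of the eigenvalues -/

section Comparison

variable {n : ℕ}

theorem coeff2_nonneg (hn : 2 ≤ n) {p l0 : ℝ} (hp : p < 1) (hl0 : l0 ≤ 1) :
    0 ≤ coeff2 n p l0 := by
  have hn' : (2 : ℝ) ≤ n := by exact_mod_cast hn
  have hn0 : (0 : ℝ) < n := by linarith
  have h : 0 ≤ 1 - 1 / (n : ℝ) - (1 - 2 / n) * l0 := by
    have e : 1 - 1 / (n : ℝ) - (1 - 2 / n) * l0 = (1 + (n - 2) * (1 - l0)) / n := by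
      field_simp
      ring
    rw [e]
    exact div_nonneg (add_nonneg zero_le_one
      (mul_nonneg (by linarith) (by linarith))) hn0.le
  refine mul_nonneg (by linarith) (add_nonneg ?_ (mul_nonneg (div_nonneg (by linarith)
    (Nat.cast_nonneg _)) h))
  exact div_nonneg zero_le_one (by linarith)

/-- The contributions of the Dicke and of the GHZ-like strategies are at most `2/5` and `1/10`. The
hypothesis `3 ≤ n` is needed: the first contribution alone is `1/2` for `n = 2`. -/
theorem coeff2_add_le_half (hn : 3 ≤ n) {p l0 : ℝ} (hp0 : 0 ≤ p) (hp : p < 1)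
    (hhalf : 1 / 2 ≤ l0) :
    coeff2 n p l0 + 1 / (2 * n * (2 * n - 1)) * ((n + 1) * n / 2) ≤ 1 / 2 := by
  have hn' : (3 : ℝ) ≤ n := by exact_mod_cast hn
  have hn0 : (0 : ℝ) < n := by linarith
  have h2n : (0 : ℝ) < 2 * n - 1 := by linarith
  have hC : 5 * ((n : ℝ) + 1) ≤ (2 * n).choose n := by exact_mod_cast five_mul_succ_le_choose hn
  have hC0 : (0 : ℝ) < (2 * n).choose n := by linarith
  have h1 : (n + 1 : ℝ) / (2 * (2 * n - 1)) ≤ 2 / 5 := by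
    rw [div_le_div_iff₀ (by linarith) (by norm_num)]
    linarith
  have h2 : ((n : ℝ) + 1) / (2 * n).choose n ≤ 1 / 5 := by
    rw [div_le_div_iff₀ hC0 (by norm_num)]
    linarith
  have h3 : 1 - 1 / (n : ℝ) - (1 - 2 / n) * l0 ≤ 1 / 2 := by
    have e : 1 - 1 / (n : ℝ) - (1 - 2 / n) * l0 = (1 + (n - 2) * (1 - l0)) / n := by
      field_simp
      ring
    rw [e, div_le_iff₀ hn0]
    nlinarith [mul_nonneg (by linarith : (0 : ℝ) ≤ n - 2) (by linarith : 0 ≤ l0 - 1 / 2)]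
  have h4 : ((n : ℝ) + 1) / (2 * n).choose n * ((1 - p) *
      (1 - 1 / (n : ℝ) - (1 - 2 / n) * l0)) ≤ 1 / 5 * (1 / 2) := by
    have h5 : (1 - p) * (1 - 1 / (n : ℝ) - (1 - 2 / n) * l0) ≤ 1 / 2 := by
      have := mul_le_mul_of_nonneg_left h3 (by linarith : 0 ≤ 1 - p)
      linarith
    exact (mul_le_mul_of_nonneg_left h5 (by positivity)).trans
      (mul_le_mul_of_nonneg_right h2 (by norm_num))
  have e : coeff2 n p l0 + 1 / (2 * n * (2 * n - 1)) * ((n + 1) * n / 2)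
      = (n + 1 : ℝ) / (2 * (2 * n - 1)) + ((n : ℝ) + 1) / (2 * n).choose n * ((1 - p) *
      (1 - 1 / (n : ℝ) - (1 - 2 / n) * l0)) := by
    rw [coeff2]
    generalize 1 - 1 / (n : ℝ) - (1 - 2 / n) * l0 = E
    field_simp
    ring
  rw [e]
  linarith

theorem coeff3_one_nonneg (hn : 2 ≤ n) {p l0 : ℝ} (hp : p < 1) (hl0 : 0 ≤ l0) :
    0 ≤ coeff3 n p l0 1 := by
  have hn' : (2 : ℝ) ≤ n := by exact_mod_cast hn
  rw [coeff3_one (by omega)]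
  exact div_nonneg (mul_nonneg (by linarith) (add_nonneg (mul_nonneg (by linarith) hl0)
    zero_le_one)) (by linarith)

theorem coeff3_one_le (hn : 2 ≤ n) {p l0 : ℝ} (hp0 : 0 ≤ p) (hp : p < 1) (hhalf : 1 / 2 ≤ l0) :
    coeff3 n p l0 1 ≤ p + (1 - p) * l0 := by
  have hn' : (2 : ℝ) ≤ n := by exact_mod_cast hn
  have h : ((n - 2) * l0 + 1) / (2 * n) ≤ l0 := by
    rw [div_le_iff₀ (by linarith)]
    nlinarith
  rw [coeff3_one (by omega), mul_div_assoc]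
  have := mul_le_mul_of_nonneg_left h (by linarith : 0 ≤ 1 - p)
  linarith

end Comparison

end GHZDickeQSV

theorem mainTheorem1 (n : ℕ) (hn : 3 ≤ n) (p q0 q1 : ℝ) (hp0 : 0 ≤ p) (hp1 : p < 1)
    (hq0 : 0 < q0) (hq1 : 0 < q1) (hq : q0 + q1 = 1) (l : Fin 2 → ℝ)
    (hl : l = GHZDickeQSV.lam n q0 q1) (hl01 : l 1 ≤ l 0) :
    ∃ (h : (GHZDickeQSV.strategy n p l).IsHermitian)
      (h1 : (GHZDickeQSV.omega1 n p l).IsHermitian)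
      (h2 : (GHZDickeQSV.omega2 n p l).IsHermitian)
      (h3 : (GHZDickeQSV.omega3 n p l).IsHermitian),
      GHZDickeQSV.secondEigenvalue h = GHZDickeQSV.secondEigenvalue h1 ∧
      (1 ≤ l 0 * (1 + 2 / (2 * n).choose n) + 1 / ((2 * n - 1) * (1 - p)) →
        GHZDickeQSV.secondEigenvalue h = p + (1 - p) * l 0) ∧
      (¬ 1 ≤ l 0 * (1 + 2 / (2 * n).choose n) + 1 / ((2 * n - 1) * (1 - p)) →
        GHZDickeQSV.secondEigenvalue h =
          1 - 1 / (2 * n - 1) - 2 * (1 - p) * l 0 / (2 * n).choose n) ∧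
      GHZDickeQSV.largestEigenvalue h2 =
        (n + 1) / (2 * (2 * n - 1)) +
          (1 - p) * (n + 1) / (2 * n).choose n * (1 - 1 / n - (1 - 2 / n) * l 0) ∧
      GHZDickeQSV.largestEigenvalue h3 = (1 - p) * ((n - 2) * l 0 + 1) / (2 * n) ∧
      GHZDickeQSV.largestEigenvalue h2 ≤ GHZDickeQSV.secondEigenvalue h ∧
      GHZDickeQSV.largestEigenvalue h3 ≤ GHZDickeQSV.secondEigenvalue h := by
  open GHZDickeQSV in
  have hn' : (3 : ℝ) ≤ n := by exact_mod_cast hn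
  have h2n : (0 : ℝ) < 2 * n - 1 := by linarith
  have hn0 : (0 : ℝ) < n := by linarith
  have hp : 0 < 1 - p := by linarith
  have hC : (0 : ℝ) < (2 * n).choose n := by exact_mod_cast Nat.choose_pos (by omega)
  have hl0 : 0 < l 0 := by
    rw [hl]; simp only [lam, Matrix.cons_val_zero]; positivity
  have hl1 : 0 < l 1 := by
    rw [hl]; simp only [lam, Matrix.cons_val_one, Matrix.cons_val_zero]; positivity
  have hsum : l 0 + l 1 = 1 := by
    rw [hl]
    simp only [lam, Matrix.cons_val_one, Matrix.cons_val_zero]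
    rw [← add_div]
    exact div_self (by positivity)
  have hle1 : l 0 ≤ 1 := by linarith
  have hhalf : 1 / 2 ≤ l 0 := by linarith
  have hhalf' : 1 / 2 ≤ p + (1 - p) * l 0 := by nlinarith
  have hκ : Real.sqrt (l 1 / l 0) ^ 2 * l 0 = l 1 := by
    rw [Real.sq_sqrt (by positivity), div_mul_cancel₀ _ hl0.ne']
  -- with `κ = √(λ₁/λ₀)`, the coherence has the form required by `secondEigenvalue_eq_max`
  have hδ : Real.sqrt (l 0) * Real.sqrt (l 1) = l 0 * Real.sqrt (l 1 / l 0) := by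
    have hs := Real.mul_self_sqrt hl0.le
    have hs0 := (Real.sqrt_pos.2 hl0).ne'
    rw [Real.sqrt_div hl1.le]
    nth_rw 2 [← hs]
    field_simp
  have hγ : (0 : ℝ) ≤ 1 / (2 * n * (2 * n - 1)) := by positivity
  have hα := coeff2_nonneg (n := n) (by omega) hp1 hle1
  have hA := strategy_eq_realOp (n := n) (by omega) p hl0.le hl1.le hsum
  have hA1 := omega1_eq_realOp (n := n) (by omega) p hl0.le
  have hA2 := omega2_eq_realOp (n := n) (by omega) p l
  have hA3 := omega3_eq_realOp (n := n) p l
  rw [hδ] at hA hA1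
  have h : (strategy n p l).IsHermitian := by
    rw [hA]
    refine realOp_isHermitian fun u v => ?_
    rw [entry1_comm, entry2_comm, entry3_comm]
  have h1 : (omega1 n p l).IsHermitian := by
    rw [hA1]; exact realOp_isHermitian fun u v => entry1_comm _ _ _ _ _ u v
  have h2 : (omega2 n p l).IsHermitian := by
    rw [hA2]; exact realOp_isHermitian fun u v => entry2_comm _ _ _ u v
  have h3 : (omega3 n p l).IsHermitian := by
    rw [hA3]; exact realOp_isHermitian fun u v => entry3_comm _ _ u v
  have hle2 := (coeff2_add_le_half hn hp0 hp1 hhalf).trans hhalf'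
  have hle3 := coeff3_one_le (n := n) (by omega) hp0 hp1 hhalf
  have hd : ∀ m, 1 ≤ m → m + 2 ≤ n → coeff3 n p (l 0) m ≤ coeff3 n p (l 0) 1 :=
    fun m hm hmn => coeff3_le_one p hp1 hl0.le hle1 hm (by omega)
  have hβ := secondEigenvalue_eq_max (by omega) h hp0 hp1 hl0.le hl1.le hsum hκ hα hγ hle2
    (fun m hm hmn => (hd m hm hmn).trans hle3) hA
  -- `omega1` is the special case in which the other two components vanish
  have hβ1 := secondEigenvalue_eq_max (by omega) h1 hp0 hp1 hl0.le hl1.le hsum hκ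
    (α := 0) (γ := 0) (d := fun _ => 0) le_rfl le_rfl (by linarith) (fun _ _ _ => by linarith) (by
      rw [hA1]
      congr 1
      funext u v
      simp [entry2, entry3, diag3])
  have hΛ2 := largestEigenvalue_entry2 (by omega) h2 hα hγ hA2
  have hΛ3 := largestEigenvalue_entry3 hn h3 (coeff3_one_nonneg (by omega) hp1 hl0.le) hd hA3
  -- multiplied by `1 - p > 0`, the condition compares the two candidates for `β`
  have hcond : (1 ≤ l 0 * (1 + 2 / (2 * n).choose n) + 1 / ((2 * n - 1) * (1 - p))) ↔
      1 - 1 / (2 * n - 1) - 2 * (1 - p) * l 0 / (2 * n).choose n ≤ p + (1 - p) * l 0 := by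
    have e : (1 - p) * (l 0 * (1 + 2 / (2 * n).choose n) + 1 / ((2 * n - 1) * (1 - p)) - 1)
        = p + (1 - p) * l 0 -
          (1 - 1 / (2 * n - 1) - 2 * (1 - p) * l 0 / (2 * n).choose n) := by
      field_simp
      ring
    rw [← sub_nonneg, ← sub_nonneg (b := 1 - 1 / (2 * (n : ℝ) - 1) - _), ← e,
      mul_nonneg_iff_of_pos_left hp]
  refine ⟨h, h1, h2, h3, hβ.trans hβ1.symm, fun hc => ?_, fun hc => ?_, ?_, ?_, ?_, ?_⟩
  · rw [hβ, max_eq_left (hcond.1 hc)]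
  · rw [hβ, max_eq_right (not_le.1 fun h' => hc (hcond.2 h')).le]
  · rw [hΛ2, coeff2]
    generalize 1 - 1 / (n : ℝ) - (1 - 2 / n) * l 0 = E
    field_simp
    ring
  · rw [hΛ3, coeff3_one (by omega)]
  · rw [hΛ2, hβ]
    exact hle2.trans (le_max_left _ _)
  · rw [hΛ3, hβ]
    exact hle3.trans (le_max_left _ _)
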